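/- **Setting.** Words are elements of $\mathbb F_2^n$; $d_H$ is the Hamming distance. Fix integers $c,d\ge 1$, reals $\alpha,\delta\in(0,1]$, and a linear code $C_0\subseteq\mathbb F_2^d$ with minimum distance $d_0=\min\{d_H(x,y):x\ne y\in C_0\}$ (so $C_0\neq 0$). A $(c,d,\alpha,\delta)$-bipartite expander is a bipartite graph $G=(L\cup R,E)$ with $L=[n]$, $n\ge 1$, all left degrees $c$ and all right degrees $d$, such that $|N(S)|\ge\delta c|S|$ for every $S\subseteq L$ with $|S|\le\alpha n$. For each $v\in R$ a total ordering $N(v,1),\dots,N(v,d)$ of its neighbourhood $N(v)$ is fixed, and $x_{N(v)}=(x_{N(v,1)},\dots,x_{N(v,d)})$. The Tanner code is $T(G,C_0)=\{x\in\mathbb F_2^n: x_{N(v)}\in C_0\ \forall v\in R\}$, and $U(x)=\{v\in R:x_{N(v)}\notin C_0\}$. Put $$t=\tfrac{d_0}{2},\quad \gamma=\Bigl(1+\tfrac ct\Bigr)^{-1}\tfrac{\delta d_0-1}{d_0-1}\,\alpha,\quad \varepsilon_0=\tfrac{d_0}2-\tfrac1\delta,\quad \varepsilon=\tfrac{\varepsilon_0\delta}{2ct^2},\quad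 W^*=\Bigl\{\tfrac{i}{cd_0}:1\le i\le cd_0\Bigr\},$$ $$s=\left\lceil\frac{\log\frac{\delta d_0-1}{2(d_0-1)}}{\log(1-\varepsilon)}\right\rceil,\qquad r=\left\lceil\frac{\log\gamma}{\log(1-\varepsilon)}\right\rceil,\qquad r'=\lceil\log_2(\gamma n)\rceil+1 .$$ **Algorithms.** * $\mathsf{DeterFlip}(x,q)$: for $v\in R$ let $w_v$ be the codeword of $C_0$ closest to $x_{N(v)}$ (the lexicographically smallest one in case of a tie). Start with $p=0\in\mathbb R^n$. For each $v\in R$ with $1\le d_H(w_v,x_{N(v)})<t$, add $\frac{t-d_H(w_v,x_{N(v)})}{ct}$ to $p_i$, where $i\in N(v)\subseteq[n]$ is the smallest index at which $w_v$ and $x_{N(v)}$ differ. Then flip all bits $x_i$ with $p_i=q$ and return the result. * $\mathsf{DeepFlip}(x)$: start with $k_{\min}=|R|+1$, $x_{\min}=\bot$. For each $(q_1,\dots,q_s)\in (W^*)^s$, in lexicographic order, set $x^{(0)}=x$ and $x^{(i)}=\mathsf{DeterFlip}(x^{(i-1)},q_i)$ for $i=1,\dots,s$, abandoning the sequence as soon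 as $|U(x^{(i)})|>c\gamma n$; if it is not abandoned and $|U(x^{(s)})|<k_{\min}$, set $k_{\min}=|U(x^{(s)})|$ and $x_{\min}=x^{(s)}$. Return $x_{\min}$. * $\mathsf{MainDecode}(x)$: for each $(q_1,\dots,q_r)\in (W^*)^r$, in lexicographic order: set $\hat x=x$; for $i=1,\dots,r$ replace $\hat x$ by $\mathsf{DeterFlip}(\hat x,q_i)$; then for $i=1,\dots,r'$ (no iteration if $r'\le 0$) replace $\hat x$ by $\mathsf{DeepFlip}(\hat x)$, and if the result is $\bot$ or $|U(\hat x)|>c2^{-i}\gamma n$, abandon this sequence. If the sequence is not abandoned, $|U(\hat x)|=0$ and $d_H(x,\hat x)\le\alpha n$, return $\hat x$ and stop. If no sequence leads to a return, report failure. **Machine model.** A random access machine with finitely many registers and finitely many arrays of natural numbers; each memory access (direct or indirect), assignment, addition, truncated subtraction and comparison takes constant time. It may also compare a natural number with $\alpha$ or $\gamma$ times another one in constant time. The input consists of $n$, $|R|$, the word $x$, and adjacency lists of the left and of the right vertices of $G$, those of the right vertices being in the fixed order $N(v,1),\dots,N(v,d)$. **Theorem.** Suppose $\delta d_0>2$.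 There are a program for this machine and a constant $K$, both depending only on $c,d,\alpha,\delta,C_0$, such that for every $n\ge1$, every $(c,d,\alpha,\delta)$-bipartite expander $G$ with left vertex set $[n]$ (with any choice of the orderings and adjacency lists) and every $x\in\mathbb F_2^n$: 1. on this input the program halts after at most $Kn$ steps and outputs $\mathsf{MainDecode}(x)$ (the word returned, or failure); 2. if $y\in T(G,C_0)$ and $d_H(x,y)\le\alpha n$, then $\mathsf{MainDecode}(x)=y$. That is, $\mathsf{MainDecode}$ can be implemented to correct up to $\alpha n$ errors in $O(n)$ time for the code $T(G,C_0)$. -/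

import Mathlib

namespace Tanner

/-- Words of length `n` over the field with two elements. -/
abbrev Word (n : ℕ) : Type := Fin n → ZMod 2

/-- `k` is the minimum distance of the code `C`, i.e. the minimum of the Hamming distances
between two distinct codewords (in particular `C` has two distinct codewords). -/
def HasMinDist {n : ℕ} (C : Submodule (ZMod 2) (Word n)) (k : ℕ) : Prop :=
  IsLeast {j : ℕ | ∃ x ∈ C, ∃ y ∈ C, x ≠ y ∧ hammingDist x y = j} k

/-! ### Bipartite graphs and expanders -/

/-- A bipartite graph with left vertices `Fin n` and right vertices `Fin m`. -/
structure BipGraph (n m : ℕ) where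
  Adj : Fin n → Fin m → Prop

namespace BipGraph

variable {n m : ℕ}

open scoped Classical in
/-- The set of neighbours of a set `S` of left vertices. -/
noncomputable def nbhd (G : BipGraph n m) (S : Finset (Fin n)) : Finset (Fin m) :=
  Finset.univ.filter fun v => ∃ u ∈ S, G.Adj u v

/-- All left degrees are `c` and all right degrees are `d`. -/
def IsRegular (G : BipGraph n m) (c d : ℕ) : Prop :=
  (∀ u, {v | G.Adj u v}.ncard = c) ∧ ∀ v, {u | G.Adj u v}.ncard = d

/-- `(c, d, α, δ)`-bipartite expanders. -/
def IsExpander (G : BipGraph n m) (c d : ℕ) (α δ : ℝ) : Prop :=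
  G.IsRegular c d ∧
    ∀ S : Finset (Fin n), (S.card : ℝ) ≤ α * n → δ * c * S.card ≤ ((G.nbhd S).card : ℝ)

/-- `M` and `N` are adjacency lists of a `(c, d)`-regular graph `G`: `M u` enumerates without
repetition the neighbours of the left vertex `u`, and `N v` those of the right vertex `v`. The
list `N v` is also the chosen total ordering of the neighbourhood of `v`. -/
structure IsAdjLists (G : BipGraph n m) {c d : ℕ}
    (M : Fin n → Fin c → Fin m) (N : Fin m → Fin d → Fin n) : Prop where
  left_injective : ∀ u, Function.Injective (M u)
  left_range : ∀ u, Set.range (M u) = {v | G.Adj u v}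
  right_injective : ∀ v, Function.Injective (N v)
  right_range : ∀ v, Set.range (N v) = {u | G.Adj u v}

end BipGraph

/-! ### Parameters, Tanner codes, unsatisfied checks -/

/-- The data that are fixed while the block length varies: the degrees `c`, `d`, the inner code
`C₀` of length `d`, the number `d₀` (its minimum distance), and the reals `α`, `δ`. -/
structure Params where
  c : ℕ
  d : ℕ
  d₀ : ℕ
  α : ℝ
  δ : ℝ
  C₀ : Submodule (ZMod 2) (Word d)

namespace Params

/-- `t = d₀ / 2`. -/
noncomputable def t (P : Params) : ℝ := P.d₀ / 2

/-- `γ = (1 + c / t)⁻¹ * (δ d₀ - 1) / (d₀ - 1) * α`. -/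
noncomputable def γ (P : Params) : ℝ :=
  (1 + P.c / P.t)⁻¹ * ((P.δ * P.d₀ - 1) / (P.d₀ - 1)) * P.α

/-- `ε₀ = d₀ / 2 - 1 / δ`. -/
noncomputable def ε₀ (P : Params) : ℝ := P.d₀ / 2 - 1 / P.δ

/-- `ε = ε₀ δ / (2 c t²)`. -/
noncomputable def ε (P : Params) : ℝ := P.ε₀ * P.δ / (2 * P.c * P.t ^ 2)

/-- The length `s` of the sequences tried by `DeepFlip`. -/
noncomputable def s (P : Params) : ℕ :=
  ⌈Real.log ((P.δ * P.d₀ - 1) / (2 * (P.d₀ - 1))) / Real.log (1 - P.ε)⌉₊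

/-- The length `r` of the sequences tried by `MainDecode`. -/
noncomputable def r (P : Params) : ℕ := ⌈Real.log P.γ / Real.log (1 - P.ε)⌉₊

/-- The number `⌈log₂ (γ n)⌉ + 1` of rounds of `MainDecode` (no round if it is negative). -/
noncomputable def rounds (P : Params) (n : ℕ) : ℕ := (⌈Real.logb 2 (P.γ * n)⌉ + 1).toNat

/-- The elements `i / (c d₀)`, `1 ≤ i ≤ c d₀`, of `W \ {0}` in increasing order. -/
noncomputable def guesses (P : Params) : List ℝ :=
  (List.range (P.c * P.d₀)).map fun i : ℕ => ((i : ℝ) + 1) / ((P.c : ℝ) * P.d₀)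

end Params

/-- All sequences of length `k` with entries in the list `W`, in lexicographic order. -/
def seqs (W : List ℝ) : ℕ → List (List ℝ)
  | 0 => [[]]
  | k + 1 => W.flatMap fun q => (seqs W k).map fun l => q :: l

/-- The local view of `x` at a right vertex whose ordered neighbourhood is `Nv`. -/
def localView {n d : ℕ} (Nv : Fin d → Fin n) (x : Word n) : Word d := fun k => x (Nv k)

/-- The Tanner code: all words whose local views all lie in the inner code. -/
def tannerCode {n m d : ℕ} (N : Fin m → Fin d → Fin n) (C₀ : Submodule (ZMod 2) (Word d)) :
    Submodule (ZMod 2) (Word n) where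
  carrier := {x | ∀ v, localView (N v) x ∈ C₀}
  add_mem' := fun hx hy v => C₀.add_mem (hx v) (hy v)
  zero_mem' := fun _ => C₀.zero_mem
  smul_mem' := fun a _ hx v => C₀.smul_mem a (hx v)

open scoped Classical in
/-- The set of unsatisfied checks. -/
noncomputable def unsat {n m d : ℕ} (N : Fin m → Fin d → Fin n)
    (C₀ : Submodule (ZMod 2) (Word d)) (x : Word n) : Finset (Fin m) :=
  Finset.univ.filter fun v => localView (N v) x ∉ C₀

/-! ### The decoding algorithm -/

/-- Codewords are compared by their distance to `z`, then lexicographically. -/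
def decodeKey {d : ℕ} (z w : Word d) : ℕ ×ₗ Lex (Fin d → ℕ) :=
  toLex (hammingDist w z, toLex fun k => (w k).val)

theorem exists_decode {d : ℕ} (C₀ : Submodule (ZMod 2) (Word d)) (z : Word d) :
    ∃ w ∈ C₀, ∀ u ∈ C₀, decodeKey z w ≤ decodeKey z u := by
  classical
  obtain ⟨w, hw, h⟩ := Finset.exists_min_image (Finset.univ.filter fun w : Word d => w ∈ C₀)
    (decodeKey z) ⟨0, by simp [C₀.zero_mem]⟩
  exact ⟨w, by simpa using hw, fun u hu => h u (by simpa using hu)⟩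

/-- The codeword of `C₀` closest to `z`, the lexicographically smallest one in case of a tie. -/
noncomputable def decode {d : ℕ} (C₀ : Submodule (ZMod 2) (Word d)) (z : Word d) : Word d :=
  (exists_decode C₀ z).choose

section Algorithm

variable (P : Params) {n m : ℕ} (N : Fin m → Fin P.d → Fin n)

/-- The distance between the local view of `x` at `v` and the codeword to which it is decoded. -/
noncomputable def localDist (x : Word n) (v : Fin m) : ℕ :=
  hammingDist (decode P.C₀ (localView (N v) x)) (localView (N v) x)

/-- The neighbours of `v` at which the local view of `x` at `v` and the codeword to which it is
decoded differ. -/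
noncomputable def diffSet (x : Word n) (v : Fin m) : Finset (Fin n) :=
  (Finset.univ.filter fun k =>
    decode P.C₀ (localView (N v) x) k ≠ localView (N v) x k).image (N v)

open scoped Classical in
/-- The total weight `p_i` of the votes for `i`: every `v` with `1 ≤ localDist v < t` sends a vote
of weight `(t - localDist v) / (c t)` to the smallest element of `diffSet v`. -/
noncomputable def voteSum (x : Word n) (i : Fin n) : ℝ :=
  ∑ v : Fin m,
    if 1 ≤ localDist P N x v ∧ (localDist P N x v : ℝ) < P.t ∧
        (diffSet P N x v).min = (i : WithTop (Fin n)) then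
      (P.t - localDist P N x v) / (P.c * P.t)
    else 0

open scoped Classical in
/-- `DeterFlip (x, q)`: flip all the bits whose vote sum is `q`. -/
noncomputable def deterFlip (x : Word n) (q : ℝ) : Word n :=
  fun i => if voteSum P N x i = q then x i + 1 else x i

open scoped Classical in
/-- Apply `DeterFlip` along a sequence; give up as soon as there are more than `c γ n`
unsatisfied checks. -/
noncomputable def guardedRun : Word n → List ℝ → Option (Word n)
  | x, [] => some x
  | x, q :: qs =>
    if (P.c : ℝ) * P.γ * n < ((unsat N P.C₀ (deterFlip P N x q)).card : ℝ) then none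
    else guardedRun (deterFlip P N x q) qs

/-- One iteration of the outer loop of `DeepFlip x`; `best` is the pair `(k_min, x_min)`. -/
noncomputable def deepFlipStep (x : Word n) (best : ℕ × Option (Word n)) (qs : List ℝ) :
    ℕ × Option (Word n) :=
  match guardedRun P N x qs with
  | none => best
  | some z =>
    if (unsat N P.C₀ z).card < best.1 then ((unsat N P.C₀ z).card, some z) else best

/-- `DeepFlip x`; the value `none` is `⊥`. -/
noncomputable def deepFlip (x : Word n) : Option (Word n) :=
  ((seqs P.guesses P.s).foldl (deepFlipStep P N x) (m + 1, none)).2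

open scoped Classical in
/-- The `i`-th iteration of the second inner loop of `MainDecode`: apply `DeepFlip`, and give up
if more than `c 2⁻ⁱ γ n` checks are unsatisfied. The value `⊥` is kept. -/
noncomputable def mainRound (z : Option (Word n)) (i : ℕ) : Option (Word n) :=
  match z.bind (deepFlip P N) with
  | none => none
  | some w =>
    if (P.c : ℝ) * ((2 : ℝ) ^ i)⁻¹ * P.γ * n < ((unsat N P.C₀ w).card : ℝ) then none else some w

open scoped Classical in
/-- The iteration of the outer loop of `MainDecode x` for the sequence `qs`; the value is the word
that is returned, or `none` if nothing is returned in this iteration. -/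
noncomputable def mainBranch (x : Word n) (qs : List ℝ) : Option (Word n) :=
  match (List.range' 1 (P.rounds n)).foldl (mainRound P N) (some (qs.foldl (deterFlip P N) x)) with
  | none => none
  | some z =>
    if (unsat N P.C₀ z).card = 0 ∧ (hammingDist x z : ℝ) ≤ P.α * n then some z else none

/-- `MainDecode x`: the word returned by the first iteration that returns one, and `none` if no
iteration does. -/
noncomputable def mainDecode (x : Word n) : Option (Word n) :=
  (seqs P.guesses P.r).findSome? (mainBranch P N x)

end Algorithm

end Tanner

/-! ### Random access machines

Programs over finitely many registers and finitely many arrays of natural numbers, with indirect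
addressing, addition and truncated subtraction. Every operation, memory access and comparison costs
one step. There is no multiplication. A program contains no real number; it may
compare a natural number with a real parameter `ρ 0` or `ρ 1` times a natural number. -/

namespace RAM

structure State where
  reg : ℕ → ℕ
  mem : ℕ → ℕ → ℕ

inductive Expr where
  | const (k : ℕ)
  | reg (r : ℕ)
  | read (A : ℕ) (e : Expr)
  | add (e f : Expr)
  | sub (e f : Expr)

def Expr.eval (σ : State) : Expr → ℕ
  | .const k => k
  | .reg r => σ.reg r
  | .read A e => σ.mem A (e.eval σ)
  | .add e f => e.eval σ + f.eval σ
  | .sub e f => e.eval σ - f.eval σ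

def Expr.cost : Expr → ℕ
  | .const _ => 1
  | .reg _ => 1
  | .read _ e => e.cost + 1
  | .add e f => e.cost + f.cost + 1
  | .sub e f => e.cost + f.cost + 1

inductive Cond where
  | lt (e f : Expr)
  | eq (e f : Expr)
  | ltScaled (e : Expr) (j : Fin 2) (f : Expr)
  | scaledLt (j : Fin 2) (e f : Expr)

def Cond.Holds (ρ : Fin 2 → ℝ) (σ : State) : Cond → Prop
  | .lt e f => e.eval σ < f.eval σ
  | .eq e f => e.eval σ = f.eval σ
  | .ltScaled e j f => (e.eval σ : ℝ) < ρ j * f.eval σ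
  | .scaledLt j e f => ρ j * e.eval σ < (f.eval σ : ℝ)

def Cond.cost : Cond → ℕ
  | .lt e f => e.cost + f.cost + 1
  | .eq e f => e.cost + f.cost + 1
  | .ltScaled e _ f => e.cost + f.cost + 2
  | .scaledLt _ e f => e.cost + f.cost + 2

inductive Cmd where
  | skip
  | assign (r : ℕ) (e : Expr)
  | write (A : ℕ) (e f : Expr)
  | seq (p q : Cmd)
  | cond (b : Cond) (p q : Cmd)
  | loop (b : Cond) (p : Cmd)

def State.setReg (σ : State) (r k : ℕ) : State :=
  { σ with reg := Function.update σ.reg r k }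

def State.setMem (σ : State) (A a k : ℕ) : State :=
  { σ with mem := Function.update σ.mem A (Function.update (σ.mem A) a k) }

/-- `Exec ρ p σ T τ`: the program `p`, started in state `σ`, halts after exactly `T` steps in
state `τ`. -/
inductive Exec (ρ : Fin 2 → ℝ) : Cmd → State → ℕ → State → Prop
  | skip (σ : State) : Exec ρ .skip σ 1 σ
  | assign (r : ℕ) (e : Expr) (σ : State) :
      Exec ρ (.assign r e) σ (e.cost + 1) (σ.setReg r (e.eval σ))
  | write (A : ℕ) (e f : Expr) (σ : State) :
      Exec ρ (.write A e f) σ (e.cost + f.cost + 1) (σ.setMem A (e.eval σ) (f.eval σ))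
  | seq {p q : Cmd} {σ τ υ : State} {S T : ℕ} (hp : Exec ρ p σ S τ) (hq : Exec ρ q τ T υ) :
      Exec ρ (.seq p q) σ (S + T) υ
  | condTrue {b : Cond} {p q : Cmd} {σ τ : State} {T : ℕ} (hb : b.Holds ρ σ)
      (hp : Exec ρ p σ T τ) : Exec ρ (.cond b p q) σ (b.cost + T) τ
  | condFalse {b : Cond} {p q : Cmd} {σ τ : State} {T : ℕ} (hb : ¬ b.Holds ρ σ)
      (hq : Exec ρ q σ T τ) : Exec ρ (.cond b p q) σ (b.cost + T) τ
  | loopFalse {b : Cond} {p : Cmd} {σ : State} (hb : ¬ b.Holds ρ σ) :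
      Exec ρ (.loop b p) σ b.cost σ
  | loopTrue {b : Cond} {p : Cmd} {σ τ υ : State} {S T : ℕ} (hb : b.Holds ρ σ)
      (hp : Exec ρ p σ S τ) (hl : Exec ρ (.loop b p) τ T υ) :
      Exec ρ (.loop b p) σ (b.cost + S + T) υ

/-- The initial state. Registers `0` and `1` hold `n` and `m`; array `0` holds the word `x`; arrays
`1` and `2` hold the adjacency lists: `M u j` is at address `u * c + j` of array `1` and `N v k` at
address `v * d + k` of array `2`. Everything else is zero. -/
def inputState {n m c d : ℕ} (M : Fin n → Fin c → Fin m) (N : Fin m → Fin d → Fin n)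
    (x : Tanner.Word n) : State where
  reg := fun r => if r = 0 then n else if r = 1 then m else 0
  mem := fun A a =>
    if A = 0 then (if h : a < n then (x ⟨a, h⟩).val else 0)
    else if A = 1 then
      (if h : a < n * c then (M (Fin.divNat ⟨a, h⟩) (Fin.modNat ⟨a, h⟩)).val else 0)
    else if A = 2 then
      (if h : a < m * d then (N (Fin.divNat ⟨a, h⟩) (Fin.modNat ⟨a, h⟩)).val else 0)
    else 0

/-- The output in a final state: register `0` holds `1` and array `0` the word `y`, or register `0`
holds `0` to report failure. -/
def IsOutput {n : ℕ} (σ : State) : Option (Tanner.Word n) → Prop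
  | some y => σ.reg 0 = 1 ∧ ∀ i : Fin n, σ.mem 0 i = (y i).val
  | none => σ.reg 0 = 0

end RAM

/-! Correctness rests on a voting inequality at a single check. Let `F` be the set of errors of `x`
with respect to a codeword `y`, with `|F| ≤ α n`. In units of `1 / (c d₀)`, a check whose local view
lies at distance `e` from its decoding, `1 ≤ e < d₀ / 2`, gives `d₀ - 2 e` votes to one bit. If the
check sees `k ≥ 1` errors, its votes for wrong bits minus its votes for correct bits amount to at
least `d₀ - 2 k` (`le_signed_vote`): a correct decoding has `e = k`, and a wrong one has `e + k ≥
d₀`. Summing over the checks and using expansion, the net vote is at least `d₀ |N(F)| - 2 c |F| ≥ c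
(δ d₀ - 2) |F|`. The vote totals are integers between `0` and `c d₀`, so by averaging some level set
of the totals contains at least `ε |F|` more wrong bits than correct ones. Flipping it leaves at
most `(1 - ε) |F|` errors (`exists_good_guess`). The right level is unknown, hence the search over
all short sequences of guesses.

Errors are invisible to the decoder, but the set `U` of unsatisfied checks is not, and `ratio * c
|F| ≤ |U| ≤ c |F|` as long as `|F| ≤ α n` (`card_unsat_le`, `hammingDist_le_of_card_unsat`). The
guard of `DeepFlip` keeps every surviving sequence within this range, because one flip multiplies
the number of errors by at most `1 + c / t` (`hammingDist_guardedRun_le`). Minimizing `|U|`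
therefore at least halves the errors (`deepFlip_correct`). The first phase of `MainDecode` reaches
`γ n` errors for a suitable sequence, and the rounds of halving then leave less than one error. No
branch can return another codeword, since a ball of radius `α n` contains at most one
(`eq_of_hammingDist_le`).

For the running time, the program keeps `U` as a list together with the position of each of its
elements. A bit is flipped in constant time and at most `|U|` bits receive votes, so one `DeterFlip`
costs `O(|U| + 1)` (`detCmd_runs`) and enlarges `|U|` by a factor of at most `1 + c`. `DeepFlip`
also costs `O(|U| + 1)`, because it never copies a word: flips are logged and undone, only the
number of the best sequence is remembered, and that sequence is run again (`deepCmd_runs`). The test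
after round `i` forces `|U| ≤ c 2⁻ⁱ γ n`, so the costs of the rounds form a geometric series of sum
`O(n)` (`roundsLoop_runs`). The number of sequences does not depend on `n`. -/

namespace Tanner

/-- The standing assumptions on the fixed parameters. -/
structure Params.Valid (P : Params) : Prop where
  c_pos : 0 < P.c
  d_pos : 0 < P.d
  α_pos : 0 < P.α
  α_le : P.α ≤ 1
  δ_pos : 0 < P.δ
  δ_le : P.δ ≤ 1
  minDist : HasMinDist P.C₀ P.d₀
  two_lt : 2 < P.δ * P.d₀

/-! ### Local decoding -/

section Decode

variable {d : ℕ} {C : Submodule (ZMod 2) (Word d)} {k : ℕ}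

theorem decode_mem (C : Submodule (ZMod 2) (Word d)) (z : Word d) : decode C z ∈ C :=
  (exists_decode C z).choose_spec.1

theorem hammingDist_decode_le {u : Word d} (hu : u ∈ C) (z : Word d) :
    hammingDist (decode C z) z ≤ hammingDist u z := by
  have h := (exists_decode C z).choose_spec.2 u hu
  rw [decodeKey, decodeKey, Prod.Lex.toLex_le_toLex] at h
  rcases h with h | h
  · exact h.le
  · exact h.1.le

theorem decode_of_mem {z : Word d} (hz : z ∈ C) : decode C z = z := by
  have h := hammingDist_decode_le hz z
  rw [hammingDist_self] at h
  exact hammingDist_eq_zero.1 (Nat.le_zero.1 h)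

theorem decode_eq_self_iff {z : Word d} : hammingDist (decode C z) z = 0 ↔ z ∈ C := by
  rw [hammingDist_eq_zero]
  exact ⟨fun h => h ▸ decode_mem C z, decode_of_mem⟩

theorem HasMinDist.le (h : HasMinDist C k) {u w : Word d} (hu : u ∈ C) (hw : w ∈ C)
    (hne : u ≠ w) : k ≤ hammingDist u w :=
  h.2 ⟨u, hu, w, hw, hne, rfl⟩

/-- The triangle inequality through the received word: a wrong decoding at small distance can only
come from many errors. -/
theorem le_add_of_decode_ne (h : HasMinDist C k) {u z : Word d} (hu : u ∈ C)
    (hne : decode C z ≠ u) : k ≤ hammingDist (decode C z) z + hammingDist z u :=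
  (h.le (decode_mem C z) hu hne).trans (hammingDist_triangle _ _ _)

/-- The decoded word is at least as close to `z` as `u` is, so a decoding different from `u` would
violate `le_add_of_decode_ne`. -/
theorem decode_eq_of_lt (h : HasMinDist C k) {u z : Word d} (hu : u ∈ C)
    (hlt : 2 * hammingDist z u < k) : decode C z = u := by
  by_contra hne
  have h1 := le_add_of_decode_ne h hu hne
  have h2 := hammingDist_decode_le hu z
  rw [hammingDist_comm u z] at h2
  omega

end Decode

/-! ### Integral votes -/

section Votes

variable (P : Params) {n m : ℕ} (N : Fin m → Fin P.d → Fin n)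

open scoped Classical in
/-- The vote of the check `v` for the bit `i`, in units of `1 / (c d₀)`. -/
noncomputable def vote (x : Word n) (v : Fin m) (i : Fin n) : ℕ :=
  if 1 ≤ localDist P N x v ∧ 2 * localDist P N x v < P.d₀ ∧
      (diffSet P N x v).min = (i : WithTop (Fin n)) then
    P.d₀ - 2 * localDist P N x v
  else 0

/-- The total of the votes for `i`, in units of `1 / (c d₀)`. -/
noncomputable def voteCount (x : Word n) (i : Fin n) : ℕ := ∑ v, vote P N x v i

variable {P N}

theorem vote_pos {x : Word n} {v : Fin m} {i : Fin n} (h : vote P N x v i ≠ 0) :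
    1 ≤ localDist P N x v ∧ 2 * localDist P N x v < P.d₀ ∧
      (diffSet P N x v).min = (i : WithTop (Fin n)) := by
  unfold vote at h
  by_contra hc
  exact h (if_neg hc)

theorem vote_le (x : Word n) (v : Fin m) (i : Fin n) : vote P N x v i ≤ P.d₀ := by
  unfold vote; split_ifs <;> omega

/-- Since `t = d₀ / 2`, the weight `(t - e) / (c t)` equals `(d₀ - 2 e) / (c d₀)`. The guesses
become the integers `1, …, c d₀`, and the machine can add and compare votes exactly. -/
theorem voteSum_eq (hd : 0 < P.d₀) (x : Word n) (i : Fin n) :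
    voteSum P N x i = (voteCount P N x i : ℝ) / (P.c * P.d₀) := by
  have hd' : (0 : ℝ) < P.d₀ := by exact_mod_cast hd
  rw [voteSum, voteCount, Nat.cast_sum, Finset.sum_div]
  refine Finset.sum_congr rfl fun v _ => ?_
  have hiff : ((localDist P N x v : ℝ) < P.t) ↔ 2 * localDist P N x v < P.d₀ := by
    rw [Params.t, lt_div_iff₀ two_pos, ← Nat.cast_lt (α := ℝ)]
    push_cast
    rw [mul_comm]
  unfold vote
  by_cases h : 1 ≤ localDist P N x v ∧ 2 * localDist P N x v < P.d₀ ∧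
      (diffSet P N x v).min = (i : WithTop (Fin n))
  · rw [if_pos h, if_pos ⟨h.1, hiff.2 h.2.1, h.2.2⟩, Nat.cast_sub h.2.1.le, Params.t]
    push_cast
    rcases eq_or_ne (P.c : ℝ) 0 with hc | hc
    · simp [hc]
    · field_simp
  · rw [if_neg h, if_neg fun h' => h ⟨h'.1, hiff.1 h'.2.1, h'.2.2⟩]
    simp

theorem mem_guesses {q : ℝ} :
    q ∈ P.guesses ↔ ∃ j : ℕ, 1 ≤ j ∧ j ≤ P.c * P.d₀ ∧ q = (j : ℝ) / ((P.c : ℝ) * P.d₀) := by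
  simp only [Params.guesses, List.mem_map, List.mem_range]
  constructor
  · rintro ⟨j, hj, rfl⟩
    exact ⟨j + 1, by omega, by omega, by push_cast; rfl⟩
  · rintro ⟨j, h1, h2, rfl⟩
    refine ⟨j - 1, by omega, ?_⟩
    rw [Nat.cast_sub h1]
    simp

theorem voteSum_eq_iff (hc : 0 < P.c) (hd : 0 < P.d₀) (x : Word n) (i : Fin n) (j : ℕ) :
    voteSum P N x i = (j : ℝ) / ((P.c : ℝ) * P.d₀) ↔ voteCount P N x i = j := by
  have hc' : (0 : ℝ) < P.c := by exact_mod_cast hc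
  have hd' : (0 : ℝ) < P.d₀ := by exact_mod_cast hd
  rw [voteSum_eq hd, div_left_inj' (by positivity)]
  exact Nat.cast_inj

theorem deterFlip_apply (hc : 0 < P.c) (hd : 0 < P.d₀) (x : Word n) (i : Fin n) (j : ℕ) :
    deterFlip P N x ((j : ℝ) / ((P.c : ℝ) * P.d₀)) i =
      if voteCount P N x i = j then x i + 1 else x i := by
  unfold deterFlip
  simp only [voteSum_eq_iff hc hd]

theorem localDist_eq_zero_iff {x : Word n} {v : Fin m} :
    localDist P N x v = 0 ↔ v ∉ unsat N P.C₀ x := by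
  rw [localDist, decode_eq_self_iff]
  simp [unsat]

theorem vote_eq_zero_of_notMem {x : Word n} {v : Fin m} (h : v ∉ unsat N P.C₀ x) (i : Fin n) :
    vote P N x v i = 0 := by
  by_contra hv
  have := (vote_pos hv).1
  rw [localDist_eq_zero_iff.2 h] at this
  omega

theorem mem_diffSet_of_vote {x : Word n} {v : Fin m} {i : Fin n} (h : vote P N x v i ≠ 0) :
    i ∈ diffSet P N x v :=
  Finset.mem_of_min (vote_pos h).2.2

theorem exists_of_vote {x : Word n} {v : Fin m} {i : Fin n} (h : vote P N x v i ≠ 0) :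
    ∃ k, N v k = i := by
  have := mem_diffSet_of_vote h
  simp only [diffSet, Finset.mem_image, Finset.mem_filter] at this
  obtain ⟨k, -, hk⟩ := this
  exact ⟨k, hk⟩

theorem exists_vote_of_voteCount {x : Word n} {i : Fin n} (h : voteCount P N x i ≠ 0) :
    ∃ v, vote P N x v i ≠ 0 := by
  by_contra! hv
  exact h (Finset.sum_eq_zero fun v _ => hv v)

/-- The number of bits with a nonzero vote is at most the number of unsatisfied checks. -/
theorem card_voted_le (x : Word n) :
    (Finset.univ.filter fun i => voteCount P N x i ≠ 0).card ≤ (unsat N P.C₀ x).card := by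
  classical
  -- Sending an unsatisfied check to the minimum of its difference set hits every bit with a vote.
  -- The minimum lives in `WithTop (Fin n)`, which is read here as `Option (Fin n)`.
  have hsub : ((Finset.univ.filter fun i => voteCount P N x i ≠ 0).image
      fun i => (some i : Option (Fin n))) ⊆
      (unsat N P.C₀ x).image fun v => (diffSet P N x v).min := by
    intro o ho
    obtain ⟨i, hi, rfl⟩ := Finset.mem_image.1 ho
    obtain ⟨v, hv⟩ := exists_vote_of_voteCount (Finset.mem_filter.1 hi).2
    refine Finset.mem_image.2 ⟨v, ?_, (vote_pos hv).2.2⟩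
    by_contra hm
    exact hv (vote_eq_zero_of_notMem hm i)
  have := (Finset.card_le_card hsub).trans Finset.card_image_le
  rwa [Finset.card_image_of_injective _ (Option.some_injective _)] at this

end Votes

/-! ### Counting errors -/

section Counting

variable {n m c d : ℕ} {G : BipGraph n m} {M : Fin n → Fin c → Fin m} {N : Fin m → Fin d → Fin n}

/-- The set of positions at which two words differ. -/
def errs (x y : Word n) : Finset (Fin n) := Finset.univ.filter fun i => x i ≠ y i

theorem card_errs (x y : Word n) : (errs x y).card = hammingDist x y := rfl

@[simp] theorem mem_errs {x y : Word n} {i : Fin n} : i ∈ errs x y ↔ x i ≠ y i := by simp [errs]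

/-- The number of errors of `x` visible at the check `v`. -/
def localErrs (N : Fin m → Fin d → Fin n) (x y : Word n) (v : Fin m) : ℕ :=
  hammingDist (localView (N v) x) (localView (N v) y)

open scoped Classical in
theorem localErrs_eq (h : G.IsAdjLists M N) (x y : Word n) (v : Fin m) :
    localErrs N x y v = ((errs x y).filter fun u => G.Adj u v).card := by
  rw [localErrs, hammingDist, ← Finset.card_image_of_injective _ (h.right_injective v)]
  congr 1
  ext u
  have := Set.ext_iff.1 (h.right_range v) u
  have hadj : (∃ k, N v k = u) ↔ G.Adj u v := this
  rw [Finset.mem_image, Finset.mem_filter, mem_errs, ← hadj]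
  constructor
  · rintro ⟨k, hk, rfl⟩; exact ⟨(Finset.mem_filter.1 hk).2, k, rfl⟩
  · rintro ⟨hk, k, rfl⟩; exact ⟨k, Finset.mem_filter.2 ⟨Finset.mem_univ _, hk⟩, rfl⟩

/-- Double counting of the pairs formed by an error and an adjacent check. -/
theorem sum_localErrs (h : G.IsAdjLists M N) (hG : G.IsRegular c d) (x y : Word n) :
    ∑ v, localErrs N x y v = c * hammingDist x y := by
  classical
  simp only [localErrs_eq h]
  have := Finset.sum_card_bipartiteAbove_eq_sum_card_bipartiteBelow (s := errs x y)
    (t := (Finset.univ : Finset (Fin m))) G.Adj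
  simp only [Finset.bipartiteAbove, Finset.bipartiteBelow] at this
  rw [← this]
  have hc : ∀ u, (Finset.univ.filter fun v => G.Adj u v).card = c := by
    intro u
    rw [← hG.1 u, Set.ncard_eq_toFinset_card']
    congr 1
    ext; simp
  simp [hc, card_errs, mul_comm]

theorem mem_nbhd_errs (h : G.IsAdjLists M N) {x y : Word n} {v : Fin m} :
    v ∈ G.nbhd (errs x y) ↔ 1 ≤ localErrs N x y v := by
  classical
  rw [localErrs_eq h, Nat.one_le_iff_ne_zero, ← Nat.pos_iff_ne_zero, Finset.card_pos]
  simp only [BipGraph.nbhd, Finset.mem_filter, Finset.mem_univ, true_and, Finset.Nonempty]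

theorem card_nbhd_errs {α δ : ℝ} (hG : G.IsExpander c d α δ) {x y : Word n}
    (hx : (hammingDist x y : ℝ) ≤ α * n) :
    δ * c * hammingDist x y ≤ ((G.nbhd (errs x y)).card : ℝ) := by
  have := hG.2 (errs x y)
  rw [card_errs] at this
  exact this hx

variable {C : Submodule (ZMod 2) (Word d)} {d₀ : ℕ}

theorem mem_unsat {x : Word n} {v : Fin m} : v ∈ unsat N C x ↔ localView (N v) x ∉ C := by
  simp [unsat]

theorem one_le_localErrs {x y : Word n} (hy : y ∈ tannerCode N C) {v : Fin m}
    (hv : v ∈ unsat N C x) : 1 ≤ localErrs N x y v := by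
  rw [Nat.one_le_iff_ne_zero]
  intro h0
  rw [localErrs, hammingDist_eq_zero] at h0
  exact mem_unsat.1 hv (h0 ▸ hy v)

/-- An unsatisfied check sees at least one error, and each error is seen by `c` checks. -/
theorem card_unsat_le (h : G.IsAdjLists M N) (hG : G.IsRegular c d) {x y : Word n}
    (hy : y ∈ tannerCode N C) : (unsat N C x).card ≤ c * hammingDist x y := by
  rw [← sum_localErrs h hG, Finset.card_eq_sum_ones]
  calc ∑ v ∈ unsat N C x, 1 ≤ ∑ v ∈ unsat N C x, localErrs N x y v :=
        Finset.sum_le_sum fun v hv => one_le_localErrs hy hv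
    _ ≤ ∑ v, localErrs N x y v :=
        Finset.sum_le_sum_of_subset (Finset.subset_univ _)

/-- A check adjacent to an error sees at least one error. If it is satisfied it sees at least `d₀`,
because its view is then a codeword of the inner code other than that of `y`. The weight `d₀ - 1`
makes up the difference at unsatisfied checks. -/
theorem mul_card_nbhd_le (h : G.IsAdjLists M N) (hG : G.IsRegular c d) (hC : HasMinDist C d₀)
    (hd₀ : 1 ≤ d₀) {x y : Word n} (hy : y ∈ tannerCode N C) :
    d₀ * (G.nbhd (errs x y)).card ≤ c * hammingDist x y + (d₀ - 1) * (unsat N C x).card := by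
  classical
  have key : ∀ v, (if v ∈ G.nbhd (errs x y) then d₀ else 0) ≤
      localErrs N x y v + (if v ∈ unsat N C x then d₀ - 1 else 0) := by
    intro v
    split_ifs with h1 h2 h2
    · have := (mem_nbhd_errs h).1 h1; omega
    · have h3 := (mem_nbhd_errs h).1 h1
      rw [mem_unsat, not_not] at h2
      have : localView (N v) x ≠ localView (N v) y := by
        intro he; rw [localErrs, he, hammingDist_self] at h3; omega
      exact hC.le h2 (hy v) this
    · omega
    · omega
  have := Finset.sum_le_sum fun v (_ : v ∈ Finset.univ) => key v
  rw [Finset.sum_add_distrib, sum_localErrs h hG] at this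
  simpa [Finset.sum_ite_mem, mul_comm] using this

end Counting

end Tanner

namespace Tanner

/-! ### The effect of one flip -/

section Progress

variable {P : Params} {n m : ℕ} {G : BipGraph n m} {M : Fin n → Fin P.c → Fin m}
  {N : Fin m → Fin P.d → Fin n}

theorem Params.Valid.two_lt_minDist (hP : P.Valid) : 2 < P.d₀ := by
  have h : (2 : ℝ) < P.d₀ :=
    hP.two_lt.trans_le (mul_le_of_le_one_left (Nat.cast_nonneg _) hP.δ_le)
  exact_mod_cast h

/-- A check votes for one bit only, so one nonzero vote determines all its votes. -/
theorem vote_eq_ite {x : Word n} {v : Fin m} {i : Fin n} (h : vote P N x v i ≠ 0) (j : Fin n) :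
    vote P N x v j = if j = i then P.d₀ - 2 * localDist P N x v else 0 := by
  obtain ⟨h1, h2, h3⟩ := vote_pos h
  unfold vote
  by_cases hj : j = i
  · subst hj
    rw [if_pos ⟨h1, h2, h3⟩, if_pos rfl]
  · rw [if_neg hj, if_neg]
    rintro ⟨-, -, h4⟩
    rw [h3] at h4
    exact hj (WithTop.coe_injective h4).symm

theorem exists_vote {x : Word n} {v : Fin m} (h1 : 1 ≤ localDist P N x v)
    (h2 : 2 * localDist P N x v < P.d₀) : ∃ i, vote P N x v i ≠ 0 := by
  have hne : (diffSet P N x v).Nonempty := by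
    rw [diffSet, Finset.image_nonempty, ← Finset.card_pos]
    exact h1
  obtain ⟨i, hi⟩ := Finset.min_of_nonempty hne
  refine ⟨i, ?_⟩
  rw [vote, if_pos ⟨h1, h2, hi⟩]
  omega

theorem localDist_of_decode {x y : Word n} {v : Fin m}
    (h : decode P.C₀ (localView (N v) x) = localView (N v) y) :
    localDist P N x v = localErrs N x y v := by
  rw [localDist, h, localErrs, hammingDist_comm]

theorem ne_of_vote_of_decode {x y : Word n} {v : Fin m} {i : Fin n}
    (h : decode P.C₀ (localView (N v) x) = localView (N v) y) (hv : vote P N x v i ≠ 0) :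
    x i ≠ y i := by
  have := mem_diffSet_of_vote hv
  rw [diffSet, Finset.mem_image] at this
  obtain ⟨k, hk, rfl⟩ := this
  have := (Finset.mem_filter.1 hk).2
  rw [h] at this
  exact this.symm

theorem minDist_le_of_decode_ne (hP : P.Valid) {x y : Word n} (hy : y ∈ tannerCode N P.C₀)
    {v : Fin m} (h : decode P.C₀ (localView (N v) x) ≠ localView (N v) y) :
    P.d₀ ≤ localDist P N x v + localErrs N x y v :=
  le_add_of_decode_ne hP.minDist (hy v) h

/-- The sign of a vote for the bit `i`: positive if the bit is wrong. -/
def errSign (x y : Word n) (i : Fin n) : ℤ := if x i ≠ y i then 1 else -1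

theorem neg_one_le_errSign (x y : Word n) (i : Fin n) : -1 ≤ errSign x y i := by
  unfold errSign; split_ifs <;> norm_num

/-- Let `k` be the number of local errors and `e` the decoding distance. A voting check that decodes
correctly has `e = k` and votes for a wrong bit. If it decodes wrongly, then `e + k ≥ d₀`, so that
the possible loss `d₀ - 2 e` is at most `2 k - d₀`. A check that sees errors and casts no vote has
`2 k ≥ d₀`, since otherwise it would decode correctly and vote. -/
theorem le_signed_vote (hP : P.Valid) {x y : Word n} (hy : y ∈ tannerCode N P.C₀) (v : Fin m) :
    (if 1 ≤ localErrs N x y v then (P.d₀ : ℤ) - 2 * localErrs N x y v else 0) ≤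
      ∑ i, errSign x y i * vote P N x v i := by
  by_cases hex : ∃ i, vote P N x v i ≠ 0
  · obtain ⟨i, hi⟩ := hex
    have hlt := (vote_pos hi).2.1
    have hsum : ∑ j, errSign x y j * (vote P N x v j : ℤ) =
        errSign x y i * ((P.d₀ : ℤ) - 2 * localDist P N x v) := by
      rw [Finset.sum_eq_single i]
      · rw [vote_eq_ite hi, if_pos rfl, Nat.cast_sub hlt.le]; push_cast; rfl
      · intro j _ hj
        rw [vote_eq_ite hi, if_neg hj]; simp
      · simp
    rw [hsum]
    by_cases hdec : decode P.C₀ (localView (N v) x) = localView (N v) y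
    · have hs : errSign x y i = 1 := if_pos (ne_of_vote_of_decode hdec hi)
      rw [localDist_of_decode hdec] at hlt ⊢
      rw [hs]
      split_ifs <;> omega
    · have h1 := minDist_le_of_decode_ne hP hy hdec
      have h2 := neg_one_le_errSign x y i
      have h3 : -1 * ((P.d₀ : ℤ) - 2 * localDist P N x v) ≤
          errSign x y i * ((P.d₀ : ℤ) - 2 * localDist P N x v) :=
        mul_le_mul_of_nonneg_right h2 (by omega)
      split_ifs <;> omega
  · push Not at hex
    simp only [hex, Nat.cast_zero, mul_zero, Finset.sum_const_zero]
    split_ifs with h1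
    · by_contra! hlt
      have hdec : decode P.C₀ (localView (N v) x) = localView (N v) y :=
        decode_eq_of_lt hP.minDist (hy v) (by unfold localErrs at hlt; omega)
      have hld := localDist_of_decode hdec
      obtain ⟨i, hi⟩ := exists_vote (P := P) (N := N) (x := x) (v := v) (by omega) (by omega)
      exact hi (hex i)
    · exact le_rfl

/-- Summation of `le_signed_vote` over the checks: every neighbour of an error contributes `d₀`, and
the local errors add up to `c` times the number of errors. -/
theorem le_signed_voteCount (hP : P.Valid) (h : G.IsAdjLists M N) (hG : G.IsRegular P.c P.d)
    {x y : Word n} (hy : y ∈ tannerCode N P.C₀) :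
    (P.d₀ : ℤ) * (G.nbhd (errs x y)).card - 2 * (P.c * hammingDist x y) ≤
      ∑ i, errSign x y i * voteCount P N x i := by
  classical
  have h1 : ∑ i, errSign x y i * (voteCount P N x i : ℤ) =
      ∑ v, ∑ i, errSign x y i * (vote P N x v i : ℤ) := by
    rw [Finset.sum_comm]
    refine Finset.sum_congr rfl fun i _ => ?_
    rw [voteCount, Nat.cast_sum, Finset.mul_sum]
  rw [h1]
  refine le_trans (le_of_eq ?_) (Finset.sum_le_sum fun v _ => le_signed_vote hP hy v)
  have h2 : ∀ v, (if 1 ≤ localErrs N x y v then (P.d₀ : ℤ) - 2 * localErrs N x y v else 0) =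
      (if v ∈ G.nbhd (errs x y) then (P.d₀ : ℤ) else 0) - 2 * (localErrs N x y v : ℤ) := by
    intro v
    simp only [mem_nbhd_errs h]
    split_ifs <;> omega
  rw [Finset.sum_congr rfl fun v _ => h2 v, Finset.sum_sub_distrib, ← Finset.mul_sum,
    ← Nat.cast_sum, sum_localErrs h hG, Finset.sum_ite_mem]
  simp [mul_comm]

/-- Only the `c` adjacent checks can vote for a bit. Hence every nonzero vote total is one of the
guesses. -/
theorem voteCount_le (h : G.IsAdjLists M N) (hG : G.IsRegular P.c P.d) (x : Word n) (i : Fin n) :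
    voteCount P N x i ≤ P.c * P.d₀ := by
  classical
  have hadj : ∀ v, vote P N x v i ≠ 0 → G.Adj i v := by
    intro v hv
    obtain ⟨k, hk⟩ := exists_of_vote hv
    have : i ∈ Set.range (N v) := ⟨k, hk⟩
    rwa [h.right_range v] at this
  calc voteCount P N x i ≤ ∑ v, if G.Adj i v then P.d₀ else 0 := by
        refine Finset.sum_le_sum fun v _ => ?_
        split_ifs with hv
        · exact vote_le x v i
        · exact (not_not.1 (mt (hadj v) hv)).le
    _ = (Finset.univ.filter fun v => G.Adj i v).card * P.d₀ := by
        rw [← Finset.sum_filter, Finset.sum_const, smul_eq_mul]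
    _ = P.c * P.d₀ := by
        rw [← hG.1 i, Set.ncard_eq_toFinset_card']
        congr 2
        ext; simp

theorem add_one_eq_of_ne {a b : ZMod 2} (h : a ≠ b) : a + 1 = b := by
  revert a b; decide

/-- The change of the number of errors by a flip of the bits with `j` votes. -/
theorem hammingDist_deterFlip (hP : P.Valid) (x y : Word n) (j : ℕ) :
    (hammingDist (deterFlip P N x ((j : ℝ) / ((P.c : ℝ) * P.d₀))) y : ℤ) =
      hammingDist x y - ∑ i, if voteCount P N x i = j then errSign x y i else 0 := by
  have hd : 0 < P.d₀ := by have := hP.two_lt_minDist; omega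
  simp only [hammingDist, Finset.card_eq_sum_ones, Finset.sum_filter, Nat.cast_sum]
  rw [← Finset.sum_sub_distrib]
  refine Finset.sum_congr rfl fun i _ => ?_
  rw [deterFlip_apply hP.c_pos hd]
  unfold errSign
  by_cases hj : voteCount P N x i = j
  · by_cases hxy : x i = y i
    · simp [hj, hxy]
    · simp [hj, hxy, add_one_eq_of_ne hxy]
  · simp [hj]

/-- The form in which `ε` enters the averaging argument, where `(c d₀)²` bounds the sum of the
levels `1, …, c d₀`. -/
theorem Params.Valid.ε_eq (hP : P.Valid) :
    P.ε * ((P.c : ℝ) * P.d₀) ^ 2 = P.c * (P.δ * P.d₀ - 2) := by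
  have hc : (0 : ℝ) < P.c := by exact_mod_cast hP.c_pos
  have hd : (0 : ℝ) < P.d₀ := by exact_mod_cast (by have := hP.two_lt_minDist; omega : 0 < P.d₀)
  have hδ := hP.δ_pos
  rw [Params.ε, Params.ε₀, Params.t]
  field_simp

/-- Let `a j` be the excess of wrong over correct bits among those with `j` votes, and `F` the
number of errors. Flipping level `j` lowers the number of errors by exactly `a j`. If `a j < ε F`
for all `1 ≤ j ≤ c d₀`, then `∑ j * a j < (c d₀)² ε F = c (δ d₀ - 2) F`, which contradicts
`le_signed_voteCount` combined with expansion. -/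
theorem exists_good_guess (hP : P.Valid) (h : G.IsAdjLists M N)
    (hG : G.IsExpander P.c P.d P.α P.δ) {x y : Word n} (hy : y ∈ tannerCode N P.C₀)
    (hx : (hammingDist x y : ℝ) ≤ P.α * n) :
    ∃ q ∈ P.guesses, (hammingDist (deterFlip P N x q) y : ℝ) ≤ (1 - P.ε) * hammingDist x y := by
  classical
  by_contra! hcon
  have hd : 0 < P.d₀ := by have := hP.two_lt_minDist; omega
  have hcd : 0 < P.c * P.d₀ := Nat.mul_pos hP.c_pos hd
  set F : ℝ := ((hammingDist x y : ℕ) : ℝ) with hF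
  set a : ℕ → ℤ := fun j => ∑ i, if voteCount P N x i = j then errSign x y i else 0 with ha
  have h1 : ∀ j ∈ Finset.range (P.c * P.d₀ + 1), (j : ℝ) * a j ≤ j * (P.ε * F) := by
    intro j hj
    rcases Nat.eq_zero_or_pos j with rfl | hj0
    · simp
    · have h2 := hcon _ (mem_guesses.2 ⟨j, hj0, by have := Finset.mem_range.1 hj; omega, rfl⟩)
      have h3 := congrArg (Int.cast (R := ℝ)) (hammingDist_deterFlip (N := N) hP x y j)
      push_cast at h3
      have h4 : (a j : ℝ) ≤ P.ε * F := by
        simp only [ha]; push_cast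
        linarith
      exact mul_le_mul_of_nonneg_left h4 (Nat.cast_nonneg _)
  -- The summand for `j = 0` is an equality, so strictness of the sum is taken from the top level `j
  -- = c d₀`.
  have h1' : ((P.c * P.d₀ : ℕ) : ℝ) * a (P.c * P.d₀) < ((P.c * P.d₀ : ℕ) : ℝ) * (P.ε * F) := by
    have h2 := hcon _ (mem_guesses.2 ⟨P.c * P.d₀, hcd, le_rfl, rfl⟩)
    have h3 := congrArg (Int.cast (R := ℝ)) (hammingDist_deterFlip (N := N) hP x y (P.c * P.d₀))
    push_cast at h3
    have h4 : (a (P.c * P.d₀) : ℝ) < P.ε * F := by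
      simp only [ha]; push_cast
      push_cast at h2
      linarith
    exact mul_lt_mul_of_pos_left h4 (by exact_mod_cast hcd)
  have hsum : ∑ j ∈ Finset.range (P.c * P.d₀ + 1), (j : ℝ) * a j =
      ((∑ i, errSign x y i * (voteCount P N x i : ℤ) : ℤ) : ℝ) := by
    simp only [ha]
    push_cast
    simp only [Finset.mul_sum]
    rw [Finset.sum_comm]
    refine Finset.sum_congr rfl fun i _ => ?_
    rw [Finset.sum_eq_single (voteCount P N x i)]
    · simp [mul_comm]
    · intro j _ hj
      rw [if_neg (Ne.symm hj)]; simp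
    · intro hj
      exact absurd (Finset.mem_range.2 (Nat.lt_succ_of_le (voteCount_le h hG.1 x i))) hj
  have hlt := Finset.sum_lt_sum h1 ⟨_, Finset.self_mem_range_succ _, h1'⟩
  rw [hsum, ← Finset.sum_mul] at hlt
  have hlow : (P.d₀ : ℝ) * (G.nbhd (errs x y)).card - 2 * (P.c * F) ≤
      ((∑ i, errSign x y i * (voteCount P N x i : ℤ) : ℤ) : ℝ) := by
    have := Int.cast_le (R := ℝ).2 (le_signed_voteCount hP h hG.1 hy (x := x))
    push_cast at this ⊢
    exact this
  have hnb := card_nbhd_errs hG hx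
  have hgauss : ∑ j ∈ Finset.range (P.c * P.d₀ + 1), (j : ℝ) ≤ ((P.c : ℝ) * P.d₀) ^ 2 := by
    have : ∑ j ∈ Finset.range (P.c * P.d₀ + 1), j ≤ (P.c * P.d₀) * (P.c * P.d₀) := by
      rw [Finset.sum_range_succ', add_zero]
      refine (Finset.sum_le_card_nsmul _ _ (P.c * P.d₀) ?_).trans_eq (by simp)
      intro j hj
      have := Finset.mem_range.1 hj; omega
    have := Nat.cast_le (α := ℝ).2 this
    push_cast at this
    rwa [sq]
  have hε := hP.ε_eq
  have hFnn : 0 ≤ F := Nat.cast_nonneg _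
  have hεnn : 0 ≤ P.ε := by
    by_contra! hneg
    have : P.ε * ((P.c : ℝ) * P.d₀) ^ 2 ≤ 0 :=
      mul_nonpos_of_nonpos_of_nonneg hneg.le (sq_nonneg _)
    have h5 : 0 < (P.c : ℝ) * (P.δ * P.d₀ - 2) :=
      mul_pos (by exact_mod_cast hP.c_pos) (by linarith [hP.two_lt])
    linarith
  have hub := mul_le_mul_of_nonneg_right hgauss (mul_nonneg hεnn hFnn)
  have hd' : (0 : ℝ) < P.d₀ := by exact_mod_cast hd
  have hnb' := mul_le_mul_of_nonneg_left hnb hd'.le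
  nlinarith

/-- A flip introduces at most `c / t` new errors per error. -/
theorem hammingDist_deterFlip_le (hP : P.Valid) (h : G.IsAdjLists M N)
    (hG : G.IsRegular P.c P.d) {x y : Word n} (hy : y ∈ tannerCode N P.C₀) {q : ℝ}
    (hq : q ∈ P.guesses) :
    (hammingDist (deterFlip P N x q) y : ℝ) ≤ (1 + P.c / P.t) * hammingDist x y := by
  classical
  obtain ⟨j, hj1, -, rfl⟩ := mem_guesses.1 hq
  have hd : 0 < P.d₀ := by have := hP.two_lt_minDist; omega
  -- A check that votes for a correct bit decodes wrongly at distance below `d₀ / 2`, hence sees at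
  -- least `d₀ / 2` errors. Double counting bounds the number of such checks, and each of them votes
  -- for one bit.
  set bad := Finset.univ.filter fun v : Fin m => P.d₀ ≤ 2 * localErrs N x y v with hbad
  have hbadcard : P.d₀ * bad.card ≤ 2 * (P.c * hammingDist x y) := by
    rw [← sum_localErrs h hG, Finset.mul_sum, mul_comm, ← smul_eq_mul]
    refine (Finset.card_nsmul_le_sum bad (fun v => 2 * localErrs N x y v) P.d₀
      fun v hv => (Finset.mem_filter.1 hv).2).trans
      (Finset.sum_le_sum_of_subset (Finset.subset_univ _))
  set new := errs (deterFlip P N x ((j : ℝ) / ((P.c : ℝ) * P.d₀))) y \ errs x y with hnew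
  have hnewcard : new.card ≤ bad.card := by
    have hsub : new.image (fun i => (some i : Option (Fin n))) ⊆
        bad.image fun v => (diffSet P N x v).min := by
      intro o ho
      obtain ⟨i, hi, rfl⟩ := Finset.mem_image.1 ho
      rw [hnew, Finset.mem_sdiff, mem_errs, mem_errs, not_not,
        deterFlip_apply hP.c_pos hd] at hi
      have hvc : voteCount P N x i = j := by
        by_contra hne
        rw [if_neg hne] at hi
        exact hi.1 hi.2
      obtain ⟨v, hv⟩ := exists_vote_of_voteCount (P := P) (N := N) (x := x) (i := i) (by omega)
      refine Finset.mem_image.2 ⟨v, ?_, (vote_pos hv).2.2⟩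
      refine Finset.mem_filter.2 ⟨Finset.mem_univ _, ?_⟩
      have hdec : decode P.C₀ (localView (N v) x) ≠ localView (N v) y :=
        fun hdec => ne_of_vote_of_decode hdec hv hi.2
      have h1 := minDist_le_of_decode_ne hP hy hdec
      have h2 := (vote_pos hv).2.1
      omega
    have := (Finset.card_le_card hsub).trans Finset.card_image_le
    rwa [Finset.card_image_of_injective _ (Option.some_injective _)] at this
  have htot : hammingDist (deterFlip P N x ((j : ℝ) / ((P.c : ℝ) * P.d₀))) y ≤
      hammingDist x y + bad.card := by
    rw [← card_errs, ← card_errs x y]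
    refine le_trans ?_ ((Nat.add_le_add_left hnewcard _).trans_eq' (Nat.add_comm _ _))
    exact Finset.card_le_card_sdiff_add_card
  have hd' : (0 : ℝ) < P.d₀ := by exact_mod_cast hd
  have h3 : (bad.card : ℝ) ≤ P.c / P.t * hammingDist x y := by
    have : (P.d₀ : ℝ) * bad.card ≤ 2 * (P.c * hammingDist x y) := by exact_mod_cast hbadcard
    rw [Params.t, div_mul_eq_mul_div, le_div_iff₀ (by positivity)]
    linarith
  have h4 : (hammingDist (deterFlip P N x ((j : ℝ) / ((P.c : ℝ) * P.d₀))) y : ℝ) ≤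
      hammingDist x y + bad.card := by exact_mod_cast htot
  linarith

end Progress

end Tanner

namespace Tanner

/-! ### Inequalities between the parameters -/

/-- Division by the negative number `log a` reverses the inequality. If the quotient is negative,
the exponent is `0` and the bound is still true. -/
theorem pow_ceil_log_div_log_le {a g : ℝ} (ha : 0 < a) (ha1 : a < 1) (hg : 0 < g) :
    a ^ ⌈Real.log g / Real.log a⌉₊ ≤ g := by
  have hlog : Real.log a < 0 := Real.log_neg ha ha1
  have h := Nat.le_ceil (Real.log g / Real.log a)
  rw [div_le_iff_of_neg hlog] at h
  rw [← Real.log_le_log_iff (pow_pos ha _) hg, Real.log_pow]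
  exact h

namespace Params

/-- The factor `(δ d₀ - 1) / (d₀ - 1)`. -/
noncomputable def ratio (P : Params) : ℝ := (P.δ * P.d₀ - 1) / (P.d₀ - 1)

/-- The radius `α / (1 + c / t)`. -/
noncomputable def β (P : Params) : ℝ := P.α / (1 + P.c / P.t)

theorem γ_eq (P : Params) : P.γ = P.ratio * P.β := by
  rw [γ, β, ratio]; ring

namespace Valid

variable {P : Params} (hP : P.Valid)

include hP

theorem c_pos' : (0 : ℝ) < P.c := by exact_mod_cast hP.c_pos

theorem minDist_pos : 0 < P.d₀ := by have := hP.two_lt_minDist; omega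

theorem minDist_gt' : (2 : ℝ) < P.d₀ := by exact_mod_cast hP.two_lt_minDist

theorem factor_ge_one : 1 ≤ 1 + P.c / P.t := by
  have h1 := hP.c_pos'
  have h2 := hP.minDist_gt'
  have : 0 ≤ P.c / P.t := by unfold t; positivity
  linarith

theorem ratio_pos : 0 < P.ratio :=
  div_pos (by linarith [hP.two_lt]) (by linarith [hP.minDist_gt'])

theorem ratio_le_one : P.ratio ≤ 1 := by
  have h := hP.minDist_gt'
  rw [ratio, div_le_one (by linarith)]
  have := mul_le_of_le_one_left (Nat.cast_nonneg (α := ℝ) P.d₀) hP.δ_le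
  linarith

theorem β_pos : 0 < P.β := div_pos hP.α_pos (by linarith [hP.factor_ge_one])

theorem factor_mul_β : (1 + P.c / P.t) * P.β = P.α :=
  mul_div_cancel₀ _ (by linarith [hP.factor_ge_one] : (1 + P.c / P.t) ≠ 0)

theorem β_le : P.β ≤ P.α := div_le_self hP.α_pos.le hP.factor_ge_one

theorem γ_pos : 0 < P.γ := by rw [P.γ_eq]; exact mul_pos hP.ratio_pos hP.β_pos

theorem γ_le_β : P.γ ≤ P.β := by
  rw [P.γ_eq]; exact mul_le_of_le_one_left hP.β_pos.le hP.ratio_le_one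

theorem γ_le_one : P.γ ≤ 1 := hP.γ_le_β.trans (hP.β_le.trans hP.α_le)

theorem ε_pos : 0 < P.ε := by
  have h1 := hP.c_pos'
  have h2 := hP.minDist_gt'
  have h3 := hP.two_lt
  have h : 0 < P.ε * ((P.c : ℝ) * P.d₀) ^ 2 := by
    rw [hP.ε_eq]; exact mul_pos h1 (by linarith)
  exact pos_of_mul_pos_left h (by positivity)

/-- Keeps `1 - ε` positive, as the logarithms in `r` and `s` require: `ε (c d₀)² = c (δ d₀ - 2) < c
d₀ ≤ (c d₀)²`. -/
theorem ε_lt_one : P.ε < 1 := by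
  have h1 : (1 : ℝ) ≤ P.c := by exact_mod_cast hP.c_pos
  have h2 := hP.minDist_gt'
  have h3 := mul_le_of_le_one_left (Nat.cast_nonneg (α := ℝ) P.d₀) hP.δ_le
  have h4 := hP.ε_eq
  have h5 : (P.c : ℝ) * (P.δ * P.d₀ - 2) < P.c * P.d₀ :=
    mul_lt_mul_of_pos_left (by linarith) (by linarith)
  have h6 : (1 : ℝ) ≤ P.c * P.d₀ := by nlinarith
  by_contra! hε
  have h7 : ((P.c : ℝ) * P.d₀) ^ 2 ≤ P.ε * ((P.c : ℝ) * P.d₀) ^ 2 :=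
    le_mul_of_one_le_left (sq_nonneg _) hε
  nlinarith

theorem pow_r_le : (1 - P.ε) ^ P.r ≤ P.γ :=
  pow_ceil_log_div_log_le (by linarith [hP.ε_lt_one]) (by linarith [hP.ε_pos]) hP.γ_pos

theorem pow_s_le : (1 - P.ε) ^ P.s ≤ P.ratio / 2 := by
  have : (P.δ * P.d₀ - 1) / (2 * (P.d₀ - 1)) = P.ratio / 2 := by
    rw [ratio, div_div, mul_comm 2]
  rw [s, this]
  exact pow_ceil_log_div_log_le (by linarith [hP.ε_lt_one]) (by linarith [hP.ε_pos])
    (half_pos hP.ratio_pos)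

/-- Less than one error is left after `rounds n` halvings of `γ n`. The summand `1` in the number of
rounds makes the inequality strict, and truncating a negative number to zero only increases it. -/
theorem pow_rounds {n : ℕ} (hn : 0 < n) : P.γ * n < 2 ^ P.rounds n := by
  have hpos : 0 < P.γ * n := mul_pos hP.γ_pos (by exact_mod_cast hn)
  have h1 : Real.logb 2 (P.γ * n) < P.rounds n := by
    have h2 : (⌈Real.logb 2 (P.γ * n)⌉ + 1 : ℤ) ≤ (P.rounds n : ℤ) := Int.self_le_toNat _
    have h3 := Int.le_ceil (Real.logb 2 (P.γ * n))
    have h4 : ((⌈Real.logb 2 (P.γ * n)⌉ + 1 : ℤ) : ℝ) ≤ (P.rounds n : ℝ) := by exact_mod_cast h2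
    push_cast at h4
    linarith
  rw [Real.logb_lt_iff_lt_rpow one_lt_two hpos] at h1
  exact_mod_cast h1

end Valid

end Params

/-! ### Sequences of guesses. -/

theorem mem_seqs {W : List ℝ} : ∀ {k : ℕ} {l : List ℝ},
    l ∈ seqs W k ↔ l.length = k ∧ ∀ q ∈ l, q ∈ W
  | 0, l => by
    simp only [seqs, List.mem_singleton, List.length_eq_zero_iff]
    constructor
    · rintro rfl; simp
    · exact fun h => h.1
  | k + 1, l => by
    simp only [seqs, List.mem_flatMap, List.mem_map, mem_seqs (k := k)]
    constructor
    · rintro ⟨q, hq, l, ⟨hl, hW⟩, rfl⟩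
      exact ⟨by simp [hl], by simpa using ⟨hq, hW⟩⟩
    · rintro ⟨hl, hW⟩
      cases l with
      | nil => simp at hl
      | cons q l =>
        simp only [List.mem_cons, forall_eq_or_imp] at hW
        exact ⟨q, hW.1, l, ⟨by simpa using hl, hW.2⟩, rfl⟩

/-! ### Correctness of the decoder -/

section Correct

variable {P : Params} {n m : ℕ} {G : BipGraph n m} {M : Fin n → Fin P.c → Fin m}
  {N : Fin m → Fin P.d → Fin n}

/-- Expansion inserted into `mul_card_nbhd_le`: with `F` errors, `δ d₀ c F ≤ d₀ |N| ≤ c F + (d₀ - 1)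
|U|`. This turns the visible quantity `|U|` into a bound on the errors. -/
theorem hammingDist_le_of_card_unsat (hP : P.Valid) (h : G.IsAdjLists M N)
    (hG : G.IsExpander P.c P.d P.α P.δ) {x y : Word n} (hy : y ∈ tannerCode N P.C₀)
    (hx : (hammingDist x y : ℝ) ≤ P.α * n) :
    P.ratio * (P.c * hammingDist x y) ≤ (unsat N P.C₀ x).card := by
  have h1 := Nat.cast_le (α := ℝ).2
    (mul_card_nbhd_le h hG.1 hP.minDist hP.minDist_pos hy (x := x))
  have h2 := card_nbhd_errs hG hx
  have h3 := hP.minDist_gt'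
  push_cast [Nat.cast_sub (show 1 ≤ P.d₀ from hP.minDist_pos)] at h1
  have h4 := mul_le_mul_of_nonneg_left h2 (by linarith : (0 : ℝ) ≤ P.d₀)
  rw [Params.ratio, div_mul_eq_mul_div, div_le_iff₀ (by linarith)]
  linarith

/-- Iteration of `exists_good_guess`. The good guesses never increase the number of errors, so the
expansion hypothesis remains available. -/
theorem exists_seq (hP : P.Valid) (h : G.IsAdjLists M N) (hG : G.IsExpander P.c P.d P.α P.δ)
    {y : Word n} (hy : y ∈ tannerCode N P.C₀) :
    ∀ (k : ℕ) {x : Word n}, (hammingDist x y : ℝ) ≤ P.α * n →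
      ∃ qs ∈ seqs P.guesses k, (hammingDist (qs.foldl (deterFlip P N) x) y : ℝ) ≤
        (1 - P.ε) ^ k * hammingDist x y
  | 0, x, _ => ⟨[], by simp [seqs], by simp⟩
  | k + 1, x, hx => by
    obtain ⟨q, hq, h1⟩ := exists_good_guess hP h hG hy hx
    have h0 : (0 : ℝ) ≤ 1 - P.ε := by linarith [hP.ε_lt_one]
    have h1' : (hammingDist (deterFlip P N x q) y : ℝ) ≤ P.α * n :=
      h1.trans ((mul_le_of_le_one_left (Nat.cast_nonneg _) (by linarith [hP.ε_pos])).trans hx)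
    obtain ⟨qs, hqs, h2⟩ := exists_seq hP h hG hy k h1'
    rw [mem_seqs] at hqs
    refine ⟨q :: qs, mem_seqs.2 ⟨by simp [hqs.1], by simpa using ⟨hq, hqs.2⟩⟩, ?_⟩
    rw [List.foldl_cons, pow_succ, mul_assoc]
    exact h2.trans (mul_le_mul_of_nonneg_left h1 (pow_nonneg h0 _))

/-- The guard does not stop the good sequence, since at most `γ n` errors leave at most `c γ n`
checks unsatisfied. -/
theorem exists_guardedRun (hP : P.Valid) (h : G.IsAdjLists M N)
    (hG : G.IsExpander P.c P.d P.α P.δ) {y : Word n} (hy : y ∈ tannerCode N P.C₀) :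
    ∀ (k : ℕ) {x : Word n}, (hammingDist x y : ℝ) ≤ P.γ * n →
      ∃ qs ∈ seqs P.guesses k, ∃ z, guardedRun P N x qs = some z ∧
        (hammingDist z y : ℝ) ≤ (1 - P.ε) ^ k * hammingDist x y
  | 0, x, _ => ⟨[], by simp [seqs], x, rfl, by simp⟩
  | k + 1, x, hx => by
    have hαn : P.γ * n ≤ P.α * n :=
      mul_le_mul_of_nonneg_right (hP.γ_le_β.trans hP.β_le) (Nat.cast_nonneg _)
    obtain ⟨q, hq, h1⟩ := exists_good_guess hP h hG hy (hx.trans hαn)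
    have h0 : (0 : ℝ) ≤ 1 - P.ε := by linarith [hP.ε_lt_one]
    have h1' : (hammingDist (deterFlip P N x q) y : ℝ) ≤ P.γ * n :=
      h1.trans ((mul_le_of_le_one_left (Nat.cast_nonneg _) (by linarith [hP.ε_pos])).trans hx)
    obtain ⟨qs, hqs, z, hz, h2⟩ := exists_guardedRun hP h hG hy k h1'
    rw [mem_seqs] at hqs
    refine ⟨q :: qs, mem_seqs.2 ⟨by simp [hqs.1], by simpa using ⟨hq, hqs.2⟩⟩, z, ?_, ?_⟩
    · rw [guardedRun, if_neg, hz]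
      rw [not_lt, mul_assoc]
      refine le_trans ?_ (mul_le_mul_of_nonneg_left h1' (Nat.cast_nonneg _))
      exact_mod_cast card_unsat_le h hG.1 hy
    · rw [pow_succ, mul_assoc]
      exact h2.trans (mul_le_mul_of_nonneg_left h1 (pow_nonneg h0 _))

/-- This concerns all surviving sequences, including bad ones. One flip takes at most `β n` errors
to at most `α n`, where the lower bound on `|U|` still applies. As `γ = ratio * β`, the guard `|U| ≤
c γ n` then brings the number of errors back to at most `β n`. -/
theorem hammingDist_guardedRun_le (hP : P.Valid) (h : G.IsAdjLists M N)
    (hG : G.IsExpander P.c P.d P.α P.δ) {y : Word n} (hy : y ∈ tannerCode N P.C₀) :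
    ∀ {qs : List ℝ} {x z : Word n}, (∀ q ∈ qs, q ∈ P.guesses) →
      (hammingDist x y : ℝ) ≤ P.β * n → guardedRun P N x qs = some z →
      (hammingDist z y : ℝ) ≤ P.β * n
  | [], x, z, _, hx, hz => by
    rw [guardedRun, Option.some_inj] at hz
    exact hz ▸ hx
  | q :: qs, x, z, hqs, hx, hz => by
    simp only [List.mem_cons, forall_eq_or_imp] at hqs
    rw [guardedRun] at hz
    split_ifs at hz with hU
    refine hammingDist_guardedRun_le hP h hG hy hqs.2 ?_ hz
    have h1 := hammingDist_deterFlip_le hP h hG.1 hy hqs.1 (x := x)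
    have h2 : (hammingDist (deterFlip P N x q) y : ℝ) ≤ P.α * n := by
      refine h1.trans ?_
      rw [← hP.factor_mul_β, mul_assoc]
      exact mul_le_mul_of_nonneg_left hx (by linarith [hP.factor_ge_one])
    have h3 := hammingDist_le_of_card_unsat hP h hG hy h2
    rw [not_lt] at hU
    have h4 := h3.trans hU
    rw [P.γ_eq] at h4
    have h5 : P.ratio * P.c * (hammingDist (deterFlip P N x q) y : ℝ) ≤
        P.ratio * P.c * (P.β * n) := by linarith
    exact le_of_mul_le_mul_left h5 (mul_pos hP.ratio_pos hP.c_pos')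

/-- The fold is a running minimum: it never increases, is at most the score of each surviving
sequence, and is either the initial value or attained by such a sequence. -/
theorem foldl_deepFlipStep (x : Word n) : ∀ (l : List (List ℝ)) (best : ℕ × Option (Word n)),
    (l.foldl (deepFlipStep P N x) best).1 ≤ best.1 ∧
    (∀ qs ∈ l, ∀ z, guardedRun P N x qs = some z →
      (l.foldl (deepFlipStep P N x) best).1 ≤ (unsat N P.C₀ z).card) ∧
    (l.foldl (deepFlipStep P N x) best = best ∨ ∃ qs ∈ l, ∃ z, guardedRun P N x qs = some z ∧
      l.foldl (deepFlipStep P N x) best = ((unsat N P.C₀ z).card, some z))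
  | [], best => by simp
  | qs :: l, best => by
    obtain ⟨h1, h2, h3⟩ := foldl_deepFlipStep x l (deepFlipStep P N x best qs)
    simp only [List.foldl_cons, List.mem_cons, forall_eq_or_imp, exists_eq_or_imp]
    have h4 : (deepFlipStep P N x best qs).1 ≤ best.1 ∧
        (∀ z, guardedRun P N x qs = some z →
          (deepFlipStep P N x best qs).1 ≤ (unsat N P.C₀ z).card) ∧
        (deepFlipStep P N x best qs = best ∨ ∃ z, guardedRun P N x qs = some z ∧
          deepFlipStep P N x best qs = ((unsat N P.C₀ z).card, some z)) := by
      rw [deepFlipStep]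
      cases hr : guardedRun P N x qs with
      | none => simp
      | some w =>
        dsimp only
        split_ifs with hlt
        · simpa using hlt.le
        · simpa using hlt
    refine ⟨h1.trans h4.1, ⟨fun z hz => h1.trans (h4.2.1 z hz), h2⟩, ?_⟩
    rcases h3 with h3 | h3
    · rw [h3]
      rcases h4.2.2 with h5 | h5
      · exact Or.inl h5
      · exact Or.inr (Or.inl h5)
    · exact Or.inr (Or.inr h3)

/-- The selected sequence scores at least as well as the good one, which leaves at most a fraction
`ratio / 2` of the errors. Passing from unsatisfied checks back to errors costs a factor `1 /
ratio`, which leaves the fraction `1 / 2`. -/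
theorem deepFlip_correct (hP : P.Valid) (h : G.IsAdjLists M N)
    (hG : G.IsExpander P.c P.d P.α P.δ) {x y : Word n} (hy : y ∈ tannerCode N P.C₀)
    (hx : (hammingDist x y : ℝ) ≤ P.γ * n) :
    ∃ z, deepFlip P N x = some z ∧ (hammingDist z y : ℝ) ≤ hammingDist x y / 2 ∧
      ((unsat N P.C₀ z).card : ℝ) ≤ P.c * (hammingDist x y / 2) := by
  obtain ⟨qs, hqs, w, hw, hwy⟩ := exists_guardedRun hP h hG hy P.s hx
  obtain ⟨-, h2, h3⟩ := foldl_deepFlipStep (P := P) (N := N) x (seqs P.guesses P.s) (m + 1, none)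
  have h4 := h2 qs hqs w hw
  have hm : (unsat N P.C₀ w).card ≤ m := (Finset.card_le_univ _).trans_eq (Fintype.card_fin m)
  -- If nothing had been recorded, the initial value `m + 1` would be at most `|U(w)| ≤ m`.
  rcases h3 with h3 | ⟨ps, hps, z, hz, h3⟩
  · rw [h3] at h4; simp only at h4; omega
  rw [h3] at h4
  refine ⟨z, by rw [deepFlip, h3], ?_⟩
  have hzβ := hammingDist_guardedRun_le hP h hG hy (mem_seqs.1 hps).2
    (hx.trans (mul_le_mul_of_nonneg_right hP.γ_le_β (Nat.cast_nonneg _))) hz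
  have h5 := hammingDist_le_of_card_unsat hP h hG hy
    (hzβ.trans (mul_le_mul_of_nonneg_right hP.β_le (Nat.cast_nonneg _)))
  have h6 : ((unsat N P.C₀ w).card : ℝ) ≤ P.c * hammingDist w y := by
    exact_mod_cast card_unsat_le h hG.1 hy
  have h7 : ((unsat N P.C₀ z).card : ℝ) ≤ (unsat N P.C₀ w).card := by exact_mod_cast h4
  have hF : (0 : ℝ) ≤ hammingDist x y := Nat.cast_nonneg _
  have h8 : (hammingDist w y : ℝ) ≤ P.ratio / 2 * hammingDist x y :=
    hwy.trans (mul_le_mul_of_nonneg_right hP.pow_s_le hF)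
  have h9 : ((unsat N P.C₀ z).card : ℝ) ≤ P.c * (P.ratio / 2 * hammingDist x y) :=
    (h7.trans h6).trans (mul_le_mul_of_nonneg_left h8 hP.c_pos'.le)
  constructor
  · have h10 : P.ratio * P.c * (hammingDist z y : ℝ) ≤
        P.ratio * P.c * (hammingDist x y / 2) := by linarith
    exact le_of_mul_le_mul_left h10 (mul_pos hP.ratio_pos hP.c_pos')
  · refine h9.trans (mul_le_mul_of_nonneg_left ?_ hP.c_pos'.le)
    have := mul_le_of_le_one_left hF hP.ratio_le_one
    linarith

/-- With `F` errors, the invariant `F * 2 ^ i ≤ γ n` after round `i` allows the next call of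
`DeepFlip`, and the halving makes the test on `|U|` succeed. -/
theorem foldl_mainRound (hP : P.Valid) (h : G.IsAdjLists M N)
    (hG : G.IsExpander P.c P.d P.α P.δ) {y : Word n} (hy : y ∈ tannerCode N P.C₀) :
    ∀ (k i : ℕ) {x : Word n}, (hammingDist x y : ℝ) * 2 ^ i ≤ P.γ * n →
      ∃ z, (List.range' (i + 1) k).foldl (mainRound P N) (some x) = some z ∧
        (hammingDist z y : ℝ) * 2 ^ (i + k) ≤ P.γ * n
  | 0, i, x, hx => ⟨x, by simp, by simpa using hx⟩
  | k + 1, i, x, hx => by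
    have h1 : (1 : ℝ) ≤ 2 ^ i := one_le_pow₀ one_le_two
    obtain ⟨w, hw, hwy, hU⟩ := deepFlip_correct hP h hG hy
      ((le_mul_of_one_le_right (Nat.cast_nonneg _) h1).trans hx)
    have hwi : (hammingDist w y : ℝ) * 2 ^ (i + 1) ≤ P.γ * n := by
      rw [pow_succ]
      refine le_trans ?_ hx
      have := mul_le_mul_of_nonneg_right hwy (by positivity : (0 : ℝ) ≤ 2 ^ i * 2)
      linarith
    have hround : mainRound P N (some x) (i + 1) = some w := by
      rw [mainRound, Option.bind_some, hw]
      dsimp only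
      rw [if_neg]
      rw [not_lt]
      refine hU.trans ?_
      rw [mul_assoc, mul_assoc]
      refine mul_le_mul_of_nonneg_left ?_ hP.c_pos'.le
      rw [inv_mul_eq_div, le_div_iff₀ (by positivity), pow_succ]
      linarith
    obtain ⟨z, hz, hzy⟩ := foldl_mainRound hP h hG hy k (i + 1) hwi
    refine ⟨z, ?_, by rwa [show i + (k + 1) = i + 1 + k by ring]⟩
    rw [List.range'_succ, List.foldl_cons, hround, hz]

theorem mem_tannerCode_of_unsat {z : Word n} (hz : (unsat N P.C₀ z).card = 0) :
    z ∈ tannerCode N P.C₀ := by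
  intro v
  by_contra hv
  rw [Finset.card_eq_zero] at hz
  exact absurd (mem_unsat.2 hv) (hz ▸ Finset.notMem_empty v)

/-- Two codewords within the decoding radius of the same word coincide. -/
theorem eq_of_hammingDist_le (hP : P.Valid) (h : G.IsAdjLists M N)
    (hG : G.IsExpander P.c P.d P.α P.δ) {x y z : Word n} (hy : y ∈ tannerCode N P.C₀)
    (hz : z ∈ tannerCode N P.C₀) (hxy : (hammingDist x y : ℝ) ≤ P.α * n)
    (hxz : (hammingDist x z : ℝ) ≤ P.α * n) : z = y := by
  by_contra hne
  have hpos : 0 < hammingDist z y := hammingDist_pos.2 hne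
  set a := ⌊P.α * n⌋₊ with ha
  have hαn : 0 ≤ P.α * n := mul_nonneg hP.α_pos.le (Nat.cast_nonneg _)
  have h1 : hammingDist x y ≤ a := Nat.le_floor hxy
  have h2 : hammingDist x z ≤ a := Nat.le_floor hxz
  have h3 : hammingDist z y ≤ 2 * a := by
    have := hammingDist_triangle z x y
    rw [hammingDist_comm z x] at this
    omega
  -- Expansion is available only up to size `α n`, so it is applied to a subset `S` with at least
  -- half of the differences. Then `δ d₀ c |S| ≤ d₀ |N(S)| ≤ c * hammingDist z y ≤ 2 c |S|`,
  -- contrary to `δ d₀ > 2`.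
  obtain ⟨S, hS, hScard⟩ := Finset.exists_subset_card_eq
    (s := errs z y) (n := min a (hammingDist z y)) (by rw [card_errs]; exact min_le_right _ _)
  have h4 := hG.2 S (by
    rw [hScard]
    exact (Nat.cast_le.2 (min_le_left _ _)).trans (Nat.floor_le hαn))
  have h5 : (G.nbhd S).card ≤ (G.nbhd (errs z y)).card := by
    refine Finset.card_le_card fun v hv => ?_
    simp only [BipGraph.nbhd, Finset.mem_filter, Finset.mem_univ, true_and] at hv ⊢
    obtain ⟨u, hu, huv⟩ := hv
    exact ⟨u, hS hu, huv⟩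
  have h6 := mul_card_nbhd_le h hG.1 hP.minDist hP.minDist_pos hy (x := z)
  have h7 : (unsat N P.C₀ z).card = 0 := by
    rw [Finset.card_eq_zero, Finset.eq_empty_iff_forall_notMem]
    exact fun v hv => mem_unsat.1 hv (hz v)
  rw [h7, mul_zero, add_zero] at h6
  have h8 : hammingDist z y ≤ 2 * S.card := by
    rw [hScard]; rcases min_cases a (hammingDist z y) with h | h <;> omega
  have h9 : (P.d₀ : ℝ) * (G.nbhd S).card ≤ P.c * hammingDist z y := by
    exact_mod_cast (Nat.mul_le_mul_left _ h5).trans h6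
  have h10 : (hammingDist z y : ℝ) ≤ 2 * S.card := by exact_mod_cast h8
  have hSpos : (0 : ℝ) < S.card := by
    have : 0 < S.card := by omega
    exact_mod_cast this
  have h11 : P.c * (hammingDist z y : ℝ) ≤ P.c * (2 * S.card) :=
    mul_le_mul_of_nonneg_left h10 hP.c_pos'.le
  have h12 := mul_le_mul_of_nonneg_left h4 (by linarith [hP.minDist_gt'] : (0 : ℝ) ≤ P.d₀)
  have h13 : P.c * S.card * 2 < P.c * S.card * (P.δ * P.d₀) :=
    mul_lt_mul_of_pos_left hP.two_lt (mul_pos hP.c_pos' hSpos)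
  linarith

/-- A branch that returns a word returns `y`, by uniqueness. The order of the search is therefore
irrelevant, and it suffices that one sequence succeeds. -/
theorem mainDecode_correct (hP : P.Valid) (hn : 0 < n) (h : G.IsAdjLists M N)
    (hG : G.IsExpander P.c P.d P.α P.δ) {x y : Word n} (hy : y ∈ tannerCode N P.C₀)
    (hx : (hammingDist x y : ℝ) ≤ P.α * n) : mainDecode P N x = some y := by
  have hsound : ∀ qs z, mainBranch P N x qs = some z → z = y := by
    intro qs z hz
    rw [mainBranch] at hz
    split at hz
    · simp at hz
    · split_ifs at hz with hcond
      rw [Option.some_inj] at hz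
      subst hz
      exact eq_of_hammingDist_le hP h hG hy (mem_tannerCode_of_unsat hcond.1) hx hcond.2
  obtain ⟨qs, hqs, hqy⟩ := exists_seq hP h hG hy P.r hx
  have h1 : (hammingDist (qs.foldl (deterFlip P N) x) y : ℝ) * 2 ^ 0 ≤ P.γ * n := by
    rw [pow_zero, mul_one]
    refine hqy.trans (mul_le_mul hP.pow_r_le ?_ (Nat.cast_nonneg _) hP.γ_pos.le)
    exact hx.trans (mul_le_of_le_one_left (Nat.cast_nonneg _) hP.α_le)
  obtain ⟨z, hz, hzy⟩ := foldl_mainRound hP h hG hy (P.rounds n) 0 h1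
  have hzy0 : hammingDist z y = 0 := by
    have h2 := hP.pow_rounds hn
    rw [zero_add] at hzy
    by_contra hne
    have h3 : (1 : ℝ) ≤ hammingDist z y := by
      exact_mod_cast Nat.one_le_iff_ne_zero.2 hne
    have h4 := le_mul_of_one_le_left (by positivity : (0 : ℝ) ≤ 2 ^ P.rounds n) h3
    linarith
  rw [hammingDist_eq_zero] at hzy0
  subst hzy0
  have hbranch : mainBranch P N x qs = some z := by
    rw [mainBranch, hz]
    dsimp only
    have := card_unsat_le h hG.1 hy (x := z)
    rw [hammingDist_self] at this
    exact if_pos ⟨Nat.le_zero.1 this, hx⟩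
  rw [mainDecode]
  cases hfind : (seqs P.guesses P.r).findSome? (mainBranch P N x) with
  | none =>
    rw [List.findSome?_eq_none_iff] at hfind
    rw [hfind qs hqs] at hbranch
    simp at hbranch
  | some w =>
    obtain ⟨ps, -, hps⟩ := List.exists_of_findSome?_eq_some hfind
    rw [hsound ps w hps]

end Correct

end Tanner

namespace RAM

/-! ### Reasoning about programs -/

@[simp] theorem State.setReg_reg (σ : State) (r k s : ℕ) :
    (σ.setReg r k).reg s = if s = r then k else σ.reg s := by
  simp [State.setReg, Function.update_apply]

@[simp] theorem State.setReg_mem (σ : State) (r k : ℕ) : (σ.setReg r k).mem = σ.mem := rfl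

@[simp] theorem State.setMem_reg (σ : State) (A a k : ℕ) : (σ.setMem A a k).reg = σ.reg := rfl

@[simp] theorem State.setMem_mem (σ : State) (A a k B : ℕ) :
    (σ.setMem A a k).mem B = if B = A then Function.update (σ.mem A) a k else σ.mem B := by
  simp [State.setMem, Function.update_apply]

/-- The product of an expression with a constant. -/
def Expr.mulc : ℕ → Expr → Expr
  | 0, _ => .const 0
  | k + 1, e => .add (mulc k e) e

@[simp] theorem Expr.eval_mulc (σ : State) (k : ℕ) (e : Expr) :
    (Expr.mulc k e).eval σ = k * e.eval σ := by
  induction k with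
  | zero => simp [Expr.mulc, Expr.eval]
  | succ k ih => simp [Expr.mulc, Expr.eval, ih, Nat.succ_mul]

attribute [simp] Expr.eval Cond.Holds

namespace Cmd

/-- The command contains no loop. -/
def LoopFree : Cmd → Prop
  | skip => True
  | assign _ _ => True
  | write _ _ _ => True
  | seq p q => p.LoopFree ∧ q.LoopFree
  | cond _ p q => p.LoopFree ∧ q.LoopFree
  | loop _ _ => False

/-- The command does not assign to the register `r`. -/
def KeepsReg (r : ℕ) : Cmd → Prop
  | skip => True
  | assign s _ => r ≠ s
  | write _ _ _ => True
  | seq p q => p.KeepsReg r ∧ q.KeepsReg r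
  | cond _ p q => p.KeepsReg r ∧ q.KeepsReg r
  | loop _ p => p.KeepsReg r

/-- The command does not write to the array `A`. -/
def KeepsMem (A : ℕ) : Cmd → Prop
  | skip => True
  | assign _ _ => True
  | write B _ _ => A ≠ B
  | seq p q => p.KeepsMem A ∧ q.KeepsMem A
  | cond _ p q => p.KeepsMem A ∧ q.KeepsMem A
  | loop _ p => p.KeepsMem A

/-- A bound for the running time of a loop-free command, or of one iteration of a loop with a
loop-free body. -/
def wc : Cmd → ℕ
  | skip => 1
  | assign _ e => e.cost + 1
  | write _ e f => e.cost + f.cost + 1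
  | seq p q => p.wc + q.wc
  | cond b p q => b.cost + max p.wc q.wc
  | loop b p => b.cost + p.wc

open scoped Classical in
/-- The final state of a loop-free command. -/
noncomputable def sem (ρ : Fin 2 → ℝ) : Cmd → State → State
  | skip, σ => σ
  | assign r e, σ => σ.setReg r (e.eval σ)
  | write A e f, σ => σ.setMem A (e.eval σ) (f.eval σ)
  | seq p q, σ => q.sem ρ (p.sem ρ σ)
  | cond b p q, σ => if b.Holds ρ σ then p.sem ρ σ else q.sem ρ σ
  | loop _ _, σ => σ

attribute [simp] LoopFree KeepsReg KeepsMem sem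

end Cmd

variable {ρ : Fin 2 → ℝ}

/-! ### Frame rules and loop-free commands. -/

theorem Exec.reg_eq {p : Cmd} {σ τ : State} {T r : ℕ} (h : Exec ρ p σ T τ) (hr : p.KeepsReg r) :
    τ.reg r = σ.reg r := by
  induction h with
  | skip => rfl
  | assign s e σ => simp only [Cmd.KeepsReg] at hr; simp [hr]
  | write A e f σ => rfl
  | seq _ _ ih1 ih2 => rw [ih2 hr.2, ih1 hr.1]
  | condTrue _ _ ih => exact ih hr.1
  | condFalse _ _ ih => exact ih hr.2
  | loopFalse => rfl
  | loopTrue _ _ _ ih1 ih2 => rw [ih2 hr, ih1 hr]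

theorem Exec.mem_eq {p : Cmd} {σ τ : State} {T A : ℕ} (h : Exec ρ p σ T τ) (hA : p.KeepsMem A) :
    τ.mem A = σ.mem A := by
  induction h with
  | skip => rfl
  | assign s e σ => rfl
  | write B e f σ => simp only [Cmd.KeepsMem] at hA; simp [hA]
  | seq _ _ ih1 ih2 => rw [ih2 hA.2, ih1 hA.1]
  | condTrue _ _ ih => exact ih hA.1
  | condFalse _ _ ih => exact ih hA.2
  | loopFalse => rfl
  | loopTrue _ _ _ ih1 ih2 => rw [ih2 hA, ih1 hA]

/-- A loop-free command acts as a function on states, with a time bound that does not depend on the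
state. -/
theorem Cmd.exec_sem (ρ : Fin 2 → ℝ) : ∀ {p : Cmd}, p.LoopFree → ∀ σ : State,
    ∃ T ≤ p.wc, Exec ρ p σ T (p.sem ρ σ)
  | .skip, _, σ => ⟨1, le_rfl, .skip σ⟩
  | .assign r e, _, σ => ⟨_, le_rfl, .assign r e σ⟩
  | .write A e f, _, σ => ⟨_, le_rfl, .write A e f σ⟩
  | .seq p q, h, σ => by
    obtain ⟨S, hS, h1⟩ := exec_sem ρ h.1 σ
    obtain ⟨T, hT, h2⟩ := exec_sem ρ h.2 (p.sem ρ σ)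
    exact ⟨S + T, Nat.add_le_add hS hT, .seq h1 h2⟩
  | .cond b p q, h, σ => by
    by_cases hb : b.Holds ρ σ
    · obtain ⟨S, hS, h1⟩ := exec_sem ρ h.1 σ
      refine ⟨b.cost + S, Nat.add_le_add_left (hS.trans (le_max_left _ _)) _, ?_⟩
      rw [Cmd.sem, if_pos hb]
      exact .condTrue hb h1
    · obtain ⟨S, hS, h1⟩ := exec_sem ρ h.2 σ
      refine ⟨b.cost + S, Nat.add_le_add_left (hS.trans (le_max_right _ _)) _, ?_⟩
      rw [Cmd.sem, if_neg hb]
      exact .condFalse hb h1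

theorem Cmd.sem_reg {p : Cmd} (hp : p.LoopFree) {r : ℕ} (hr : p.KeepsReg r) (σ : State) :
    (p.sem ρ σ).reg r = σ.reg r := by
  obtain ⟨T, -, h⟩ := Cmd.exec_sem ρ hp σ
  exact h.reg_eq hr

theorem Cmd.sem_mem {p : Cmd} (hp : p.LoopFree) {A : ℕ} (hA : p.KeepsMem A) (σ : State) :
    (p.sem ρ σ).mem A = σ.mem A := by
  obtain ⟨T, -, h⟩ := Cmd.exec_sem ρ hp σ
  exact h.mem_eq hA

/-- Started in `σ`, the program `p` halts within `B` steps in a state that satisfies `Q`. -/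
def Runs (ρ : Fin 2 → ℝ) (p : Cmd) (σ : State) (B : ℕ) (Q : State → Prop) : Prop :=
  ∃ T τ, T ≤ B ∧ Exec ρ p σ T τ ∧ Q τ

/-! ### Rules for triples with a time bound. -/

namespace Runs

variable {p q : Cmd} {b : Cond} {σ : State} {B B' C D : ℕ} {Q Q' : State → Prop}

theorem mono (h : Runs ρ p σ B Q) (hB : B ≤ B') (hQ : ∀ τ, Q τ → Q' τ) : Runs ρ p σ B' Q' := by
  obtain ⟨T, τ, hT, he, hq⟩ := h
  exact ⟨T, τ, hT.trans hB, he, hQ τ hq⟩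

/-- Adds the syntactic frame conditions to a postcondition, so that a specification need only
describe what changes. -/
theorem frame (h : Runs ρ p σ B Q) :
    Runs ρ p σ B fun τ => Q τ ∧ (∀ r, p.KeepsReg r → τ.reg r = σ.reg r) ∧
      ∀ A, p.KeepsMem A → τ.mem A = σ.mem A := by
  obtain ⟨T, τ, hT, he, hq⟩ := h
  exact ⟨T, τ, hT, he, hq, fun r hr => he.reg_eq hr, fun A hA => he.mem_eq hA⟩

theorem of_sem (hp : p.LoopFree) (hQ : Q (p.sem ρ σ)) : Runs ρ p σ p.wc Q := by
  obtain ⟨T, hT, h⟩ := Cmd.exec_sem ρ hp σ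
  exact ⟨T, _, hT, h, hQ⟩

theorem seq (hp : Runs ρ p σ B Q) (hq : ∀ τ, Q τ → Runs ρ q τ C Q') :
    Runs ρ (.seq p q) σ (B + C) Q' := by
  obtain ⟨S, τ, hS, h1, hτ⟩ := hp
  obtain ⟨T, υ, hT, h2, hυ⟩ := hq τ hτ
  exact ⟨S + T, υ, Nat.add_le_add hS hT, .seq h1 h2, hυ⟩

theorem cond (hp : b.Holds ρ σ → Runs ρ p σ B Q) (hq : ¬ b.Holds ρ σ → Runs ρ q σ B Q) :
    Runs ρ (.cond b p q) σ (b.cost + B) Q := by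
  by_cases hb : b.Holds ρ σ
  · obtain ⟨S, τ, hS, h1, hτ⟩ := hp hb
    exact ⟨b.cost + S, τ, Nat.add_le_add_left hS _, .condTrue hb h1, hτ⟩
  · obtain ⟨S, τ, hS, h1, hτ⟩ := hq hb
    exact ⟨b.cost + S, τ, Nat.add_le_add_left hS _, .condFalse hb h1, hτ⟩

theorem loop_done (hb : ¬ b.Holds ρ σ) (hQ : Q σ) : Runs ρ (.loop b p) σ b.cost Q :=
  ⟨_, σ, le_rfl, .loopFalse hb, hQ⟩

theorem loop_step (hb : b.Holds ρ σ) (hp : Runs ρ p σ B Q)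
    (hl : ∀ τ, Q τ → Runs ρ (.loop b p) τ C Q') :
    Runs ρ (.loop b p) σ (b.cost + B + C) Q' := by
  obtain ⟨S, τ, hS, h1, hτ⟩ := hp
  obtain ⟨T, υ, hT, h2, hυ⟩ := hl τ hτ
  exact ⟨b.cost + S + T, υ, by omega, .loopTrue hb h1 h2, hυ⟩

/-- A loop with an invariant that counts the remaining iterations. -/
theorem loop_count {I : ℕ → State → Prop}
    (hT : ∀ k σ, I (k + 1) σ → b.Holds ρ σ ∧ Runs ρ p σ C (I k))
    (hF : ∀ σ, I 0 σ → ¬ b.Holds ρ σ) :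
    ∀ k σ, I k σ → Runs ρ (.loop b p) σ (k * (b.cost + C) + b.cost) (I 0)
  | 0, σ, h => by
    rw [Nat.zero_mul, Nat.zero_add]
    exact loop_done (hF σ h) h
  | k + 1, σ, h => by
    obtain ⟨hb, hp⟩ := hT k σ h
    refine (loop_step hb hp fun τ hτ => loop_count hT hF k τ hτ).mono ?_ fun _ h => h
    rw [Nat.succ_mul]; omega

/-- A loop with a loop-free body and an invariant that counts the remaining iterations. -/
theorem loop_sem {I : ℕ → State → Prop} (hp : p.LoopFree)
    (hT : ∀ k σ, I (k + 1) σ → b.Holds ρ σ ∧ I k (p.sem ρ σ))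
    (hF : ∀ σ, I 0 σ → ¬ b.Holds ρ σ) {k : ℕ} (h : I k σ) :
    Runs ρ (.loop b p) σ ((Cmd.loop b p).wc * (k + 1)) (I 0) := by
  refine (loop_count (C := p.wc) (fun k σ h => ⟨(hT k σ h).1, of_sem hp (hT k σ h).2⟩)
    hF k σ h).mono ?_ fun _ h => h
  rw [Cmd.wc, Nat.mul_succ, Nat.mul_comm]
  omega

/-- A loop as in `loop_sem`, after a loop-free initialization. -/
theorem init_loop {I : ℕ → State → Prop} {k : ℕ} (hp : p.LoopFree) (hq : q.LoopFree)
    (hI : I k (p.sem ρ σ)) (hT : ∀ k σ, I (k + 1) σ → b.Holds ρ σ ∧ I k (q.sem ρ σ))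
    (hF : ∀ σ, I 0 σ → ¬ b.Holds ρ σ) :
    Runs ρ (.seq p (.loop b q)) σ ((Cmd.seq p (.loop b q)).wc * (k + 1)) (I 0) := by
  refine (Runs.seq (Runs.of_sem hp (Q := I k) hI)
    fun τ hτ => Runs.loop_sem hq hT hF hτ).mono ?_ fun _ h => h
  refine (Nat.add_le_add_right (Nat.le_mul_of_pos_right _ (Nat.succ_pos k)) _).trans_eq ?_
  exact (Nat.add_mul _ _ _).symm

end Runs

/-! ### Branching on the bits of a word -/

open Tanner

/-- Execute `f z`, where `z` is the word of the values of the expressions `e`. -/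
def branch : (k : ℕ) → (Fin k → Expr) → (Word k → Cmd) → Cmd
  | 0, _, f => f Fin.elim0
  | k + 1, e, f => .cond (.eq (e 0) (.const 0))
      (branch k (fun i => e i.succ) fun z => f (Fin.cons 0 z))
      (branch k (fun i => e i.succ) fun z => f (Fin.cons 1 z))

/-- A decision tree on the bits of `z` compiles a finite table over all words of length `k` into the
program. With `k = d`, inner decoding and membership in `C₀` thus take constant time. -/
theorem branch_sem (σ : State) : ∀ {k : ℕ} {e : Fin k → Expr} {f : Word k → Cmd} {z : Word k},
    (∀ i, (e i).eval σ = (z i).val) → (branch k e f).sem ρ σ = (f z).sem ρ σ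
  | 0, _, f, z, _ => by rw [branch, Subsingleton.elim z Fin.elim0]
  | k + 1, e, f, z, h => by
    have hz : z = Fin.cons (z 0) fun i => z i.succ := (Fin.cons_self_tail z).symm
    have h01 : z 0 = 0 ∨ z 0 = 1 := by generalize z 0 = a; revert a; decide
    have h0 := h 0
    rw [branch, Cmd.sem]
    rcases h01 with h1 | h1
    · rw [h1] at h0 hz
      rw [if_pos (by simpa using h0), branch_sem σ (z := fun i => z i.succ) fun i => h i.succ, ← hz]
    · rw [h1] at h0 hz
      have h0' : (e 0).eval σ = 1 := h0
      rw [if_neg (by simp [h0']), branch_sem σ (z := fun i => z i.succ) fun i => h i.succ, ← hz]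

theorem branch_forall {Φ : Cmd → Prop} (hcond : ∀ b p q, Φ p → Φ q → Φ (.cond b p q)) :
    ∀ {k : ℕ} {e : Fin k → Expr} {f : Word k → Cmd}, (∀ z, Φ (f z)) → Φ (branch k e f)
  | 0, _, _, h => h _
  | _ + 1, _, _, h =>
    hcond _ _ _ (branch_forall hcond fun _ => h _) (branch_forall hcond fun _ => h _)

theorem branch_loopFree {k : ℕ} {e : Fin k → Expr} {f : Word k → Cmd}
    (h : ∀ z, (f z).LoopFree) : (branch k e f).LoopFree :=
  branch_forall (fun _ _ _ h1 h2 => ⟨h1, h2⟩) h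

theorem branch_keepsReg {k r : ℕ} {e : Fin k → Expr} {f : Word k → Cmd}
    (h : ∀ z, (f z).KeepsReg r) : (branch k e f).KeepsReg r :=
  branch_forall (fun _ _ _ h1 h2 => ⟨h1, h2⟩) h

theorem branch_keepsMem {k A : ℕ} {e : Fin k → Expr} {f : Word k → Cmd}
    (h : ∀ z, (f z).KeepsMem A) : (branch k e f).KeepsMem A :=
  branch_forall (fun _ _ _ h1 h2 => ⟨h1, h2⟩) h

end RAM

namespace Tanner

open RAM

/-! ### The set of unsatisfied checks in memory

The registers `0` and `1` hold `n` and `m`, register `2` the number of unsatisfied checks, register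
`3` the length of the log of flips. The arrays `0`, `1`, `2` are those of the input, array `3` lists
the unsatisfied checks, array `4` holds for each unsatisfied check its position in that list plus
one (and zero for the other checks), array `5` the votes, array `6` the stack of the bits with a
nonzero vote, array `7` the log, array `8` a copy of the received word. -/

/-- Array `3`, of length register `2`, lists the set `U`; array `4` is the inverse map. -/
structure SetRep {m : ℕ} (U : Finset (Fin m)) (σ : State) : Prop where
  card : σ.reg 2 = U.card
  pos : ∀ v ∈ U, ∃ b < U.card, σ.mem 4 v = b + 1 ∧ σ.mem 3 b = v
  neg : ∀ v ∉ U, σ.mem 4 v = 0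

theorem SetRep.congr {m : ℕ} {U : Finset (Fin m)} {σ τ : State} (h : SetRep U σ)
    (h2 : τ.reg 2 = σ.reg 2) (h3 : τ.mem 3 = σ.mem 3) (h4 : τ.mem 4 = σ.mem 4) : SetRep U τ := by
  constructor
  · rw [h2, h.card]
  · rw [h3, h4]; exact h.pos
  · rw [h4]; exact h.neg

/-- The positions of the elements of the listed set. -/
theorem SetRep.bijOn {m : ℕ} {U : Finset (Fin m)} {σ : State} (h : SetRep U σ) :
    Set.BijOn (fun v : Fin m => σ.mem 4 v - 1) U (Finset.range U.card) := by
  have hmaps : Set.MapsTo (fun v : Fin m => σ.mem 4 v - 1) U (Finset.range U.card) := by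
    intro v hv
    obtain ⟨b, hb, h1, -⟩ := h.pos v hv
    simpa [h1] using hb
  have hinj : Set.InjOn (fun v : Fin m => σ.mem 4 v - 1) U := by
    intro v hv u hu huv
    obtain ⟨b, -, h1, h2⟩ := h.pos v hv
    obtain ⟨a, -, h3, h4⟩ := h.pos u hu
    simp only [h1, h3, Nat.add_sub_cancel] at huv
    rw [huv, h4] at h2
    exact (Fin.val_injective h2).symm
  exact ⟨hmaps, hinj, Finset.surjOn_of_injOn_of_card_le _ hmaps hinj (by simp)⟩

/-- `SetRep` sends each element of `U` to a slot. That map is injective into a range of the same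
size, hence onto, so every slot below `U.card` holds an element. -/
theorem SetRep.list {m : ℕ} {U : Finset (Fin m)} {σ : State} (h : SetRep U σ) {b : ℕ}
    (hb : b < U.card) : ∃ v ∈ U, σ.mem 4 v = b + 1 ∧ σ.mem 3 b = v := by
  obtain ⟨v, hv, hvb⟩ := h.bijOn.surjOn (Finset.mem_coe.2 (Finset.mem_range.2 hb))
  obtain ⟨a, -, h1, h2⟩ := h.pos v hv
  simp only [h1, Nat.add_sub_cancel] at hvb
  subst hvb
  exact ⟨v, hv, h1, h2⟩

/-- Insert the check in register `7`. -/
def insertCmd : Cmd :=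
  .cond (.eq (.read 4 (.reg 7)) (.const 0))
    (.seq (.write 3 (.reg 2) (.reg 7))
      (.seq (.assign 2 (.add (.reg 2) (.const 1))) (.write 4 (.reg 7) (.reg 2))))
    .skip

/-- Remove the check in register `7`: the last check of the list takes its place. -/
def removeCmd : Cmd :=
  .cond (.eq (.read 4 (.reg 7)) (.const 0)) .skip
    (.seq (.assign 2 (.sub (.reg 2) (.const 1)))
      (.seq (.assign 9 (.read 3 (.reg 2)))
        (.seq (.assign 8 (.read 4 (.reg 7)))
          (.seq (.write 3 (.sub (.reg 8) (.const 1)) (.reg 9))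
            (.seq (.write 4 (.reg 9) (.reg 8)) (.write 4 (.reg 7) (.const 0)))))))

section SetOps

variable {ρ : Fin 2 → ℝ} {m : ℕ} {U : Finset (Fin m)} {σ : State} {v : Fin m}

theorem SetRep.insert_sem (h : SetRep U σ) (hv : σ.reg 7 = v) :
    SetRep (insert v U) (insertCmd.sem ρ σ) := by
  by_cases hU : v ∈ U
  · obtain ⟨b, -, h1, -⟩ := h.pos v hU
    rw [Finset.insert_eq_of_mem hU]
    simpa [insertCmd, hv, h1] using h
  · have h1 := h.neg v hU
    have hcard := Finset.card_insert_of_notMem hU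
    have hsem : insertCmd.sem ρ σ = ((σ.setMem 3 U.card v).setReg 2 (U.card + 1)).setMem 4 v
        (U.card + 1) := by
      simp [insertCmd, hv, h1, h.card]
    rw [hsem]
    constructor
    · simp [hcard]
    · intro u hu
      rw [hcard]
      rcases Finset.mem_insert.1 hu with rfl | hu'
      · exact ⟨U.card, by omega, by simp⟩
      · have hne : (u : ℕ) ≠ v := fun he => hU (Fin.val_injective he ▸ hu')
        obtain ⟨b, hb, h2, h3⟩ := h.pos u hu'
        refine ⟨b, by omega, ?_⟩
        simp [hne, h2, h3, hb.ne]
    · intro u hu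
      have hne : (u : ℕ) ≠ v := fun he => hu (Fin.val_injective he ▸ Finset.mem_insert_self _ _)
      simp [hne, h.neg u fun hu' => hu (Finset.mem_insert_of_mem hu')]

/-- Here `l` is the last check of the list and `a` the slot of `v`. The case `l = v` needs no
separate treatment, because the entry of `v` is cleared last and overrides the new position written
for `l`. -/
theorem SetRep.remove_sem (h : SetRep U σ) (hv : σ.reg 7 = v) :
    SetRep (U.erase v) (removeCmd.sem ρ σ) := by
  by_cases hU : v ∈ U
  · obtain ⟨a, ha, h1, h2⟩ := h.pos v hU
    have hcard := Finset.card_erase_of_mem hU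
    obtain ⟨l, hl, hl4, hl3⟩ := h.list (b := U.card - 1) (by omega)
    have hsem : removeCmd.sem ρ σ = ((((((σ.setReg 2 (U.card - 1)).setReg 9 l).setReg 8
        (a + 1)).setMem 3 a l).setMem 4 l (a + 1)).setMem 4 v 0) := by
      simp [removeCmd, hv, h1, h.card, hl3]
    rw [hsem]
    constructor
    · simp [hcard]
    · intro u hu
      rw [hcard]
      obtain ⟨hne, hu'⟩ := Finset.mem_erase.1 hu
      have hne' : (u : ℕ) ≠ v := fun he => hne (Fin.val_injective he)
      obtain ⟨b, hb, h3, h4⟩ := h.pos u hu'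
      have hba : b ≠ a := by
        rintro rfl
        exact hne' (h4.symm.trans h2)
      by_cases hlast : b = U.card - 1
      · have hul : (u : ℕ) = l := by rw [← h4, hlast, hl3]
        refine ⟨a, by omega, ?_⟩
        have hlv : (l : ℕ) ≠ v := hul ▸ hne'
        simp [hul, hlv]
      · have hul : (u : ℕ) ≠ l := by
          intro he
          rw [he, hl4] at h3
          omega
        refine ⟨b, by omega, ?_⟩
        simp [hne', hul, hba, h3, h4]
    · intro u hu
      by_cases huv : u = v
      · simp [huv]
      · have hne' : (u : ℕ) ≠ v := fun he => huv (Fin.val_injective he)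
        have huU : u ∉ U := fun hu' => hu (Finset.mem_erase.2 ⟨huv, hu'⟩)
        have hul : (u : ℕ) ≠ l := fun he => huU (Fin.val_injective he ▸ hl)
        simp [hne', hul, h.neg u huU]
  · have h1 := h.neg v hU
    rw [Finset.erase_eq_of_notMem hU]
    simpa [removeCmd, hv, h1] using h

end SetOps

/-! ### Flipping a bit -/

/-- The parts of the memory that hold the input: the adjacency lists, the current word `w` and the
received word `x`. -/
structure Base {n m c d : ℕ} (M : Fin n → Fin c → Fin m) (N : Fin m → Fin d → Fin n)
    (x w : Word n) (σ : State) : Prop where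
  reg_n : σ.reg 0 = n
  reg_m : σ.reg 1 = m
  word : ∀ i : Fin n, σ.mem 0 i = (w i).val
  left : ∀ (u : Fin n) (j : Fin c), σ.mem 1 (c * u + j) = M u j
  right : ∀ (v : Fin m) (k : Fin d), σ.mem 2 (d * v + k) = N v k
  copy : ∀ i : Fin n, σ.mem 8 i = (x i).val

/-- Every check is in the adjacency lists of its neighbours. -/
def Linked {n m c d : ℕ} (M : Fin n → Fin c → Fin m) (N : Fin m → Fin d → Fin n) : Prop :=
  ∀ v k, ∃ j, M (N v k) j = v

/-- The word `w` with the bit `i` flipped. -/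
def flipAt {n : ℕ} (w : Word n) (i : Fin n) : Word n := Function.update w i (w i + 1)

/-- The bit at position `k` of the local view of the check in register `7`. -/
def viewBit {d : ℕ} (k : Fin d) : Expr :=
  .read 0 (.read 2 (.add (.mulc d (.reg 7)) (.const k)))

open scoped Classical in
/-- Update the membership of the check in register `7` in the set of unsatisfied checks. -/
noncomputable def checkCmd {d : ℕ} (C : Submodule (ZMod 2) (Word d)) : Cmd :=
  branch d viewBit fun z => if z ∈ C then removeCmd else insertCmd

/-- Update the membership of the first `k` neighbours of the bit in register `6`. -/
noncomputable def checksCmd (c : ℕ) {d : ℕ} (C : Submodule (ZMod 2) (Word d)) : ℕ → Cmd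
  | 0 => .skip
  | k + 1 => .seq (checksCmd c C k)
      (.seq (.assign 7 (.read 1 (.add (.mulc c (.reg 6)) (.const k)))) (checkCmd C))

/-- Flip the bit in register `6`. -/
noncomputable def flipCmd (c : ℕ) {d : ℕ} (C : Submodule (ZMod 2) (Word d)) : Cmd :=
  .seq (.write 0 (.reg 6) (.sub (.const 1) (.read 0 (.reg 6)))) (checksCmd c C c)

section Flip

variable {ρ : Fin 2 → ℝ} {n m c d : ℕ} {M : Fin n → Fin c → Fin m} {N : Fin m → Fin d → Fin n}
  {C : Submodule (ZMod 2) (Word d)} {x w : Word n} {σ τ : State}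

theorem Base.congr (h : Base M N x w σ) (h0 : τ.reg 0 = σ.reg 0) (h1 : τ.reg 1 = σ.reg 1)
    (hm0 : τ.mem 0 = σ.mem 0) (hm1 : τ.mem 1 = σ.mem 1) (hm2 : τ.mem 2 = σ.mem 2)
    (hm8 : τ.mem 8 = σ.mem 8) : Base M N x w τ := by
  constructor
  · rw [h0, h.reg_n]
  · rw [h1, h.reg_m]
  · rw [hm0]; exact h.word
  · rw [hm1]; exact h.left
  · rw [hm2]; exact h.right
  · rw [hm8]; exact h.copy

theorem Base.eval_viewBit (h : Base M N x w σ) {v : Fin m} (hv : σ.reg 7 = v) (k : Fin d) :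
    (viewBit k).eval σ = (localView (N v) w k).val := by
  simp [viewBit, hv, h.right, h.word, localView]

@[simp] theorem flipAt_flipAt (w : Word n) (i : Fin n) : flipAt (flipAt w i) i = w := by
  have : w i + 1 + 1 = w i := by generalize w i = a; revert a; decide
  simp [flipAt, this]

theorem flipAt_of_ne (w : Word n) {i j : Fin n} (h : j ≠ i) : flipAt w i j = w j := by
  simp [flipAt, h]

theorem checkCmd_loopFree : (checkCmd C).LoopFree :=
  branch_loopFree fun z => by split_ifs <;> simp [insertCmd, removeCmd]

theorem checkCmd_keepsReg {r : ℕ} (h2 : r ≠ 2) (h8 : r ≠ 8) (h9 : r ≠ 9) :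
    (checkCmd C).KeepsReg r :=
  branch_keepsReg fun z => by split_ifs <;> simp [insertCmd, removeCmd, *]

theorem checkCmd_keepsMem {A : ℕ} (h3 : A ≠ 3) (h4 : A ≠ 4) : (checkCmd C).KeepsMem A :=
  branch_keepsMem fun z => by split_ifs <;> simp [insertCmd, removeCmd, *]

theorem checksCmd_loopFree (k : ℕ) : (checksCmd c C k).LoopFree := by
  induction k with
  | zero => simp [checksCmd]
  | succ k ih => simp [checksCmd, ih, checkCmd_loopFree]

theorem checksCmd_keepsReg {r : ℕ} (h2 : r ≠ 2) (h7 : r ≠ 7) (h8 : r ≠ 8) (h9 : r ≠ 9) (k : ℕ) :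
    (checksCmd c C k).KeepsReg r := by
  induction k with
  | zero => simp [checksCmd]
  | succ k ih => exact ⟨ih, h7, checkCmd_keepsReg h2 h8 h9⟩

theorem checksCmd_keepsMem {A : ℕ} (h3 : A ≠ 3) (h4 : A ≠ 4) (k : ℕ) :
    (checksCmd c C k).KeepsMem A := by
  induction k with
  | zero => simp [checksCmd]
  | succ k ih => exact ⟨ih, trivial, checkCmd_keepsMem h3 h4⟩

theorem flipCmd_loopFree : (flipCmd c C).LoopFree := ⟨trivial, checksCmd_loopFree c⟩

theorem flipCmd_keepsReg {r : ℕ} (h2 : r ≠ 2) (h7 : r ≠ 7) (h8 : r ≠ 8) (h9 : r ≠ 9) :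
    (flipCmd c C).KeepsReg r := ⟨trivial, checksCmd_keepsReg h2 h7 h8 h9 c⟩

theorem flipCmd_keepsMem {A : ℕ} (h0 : A ≠ 0) (h3 : A ≠ 3) (h4 : A ≠ 4) :
    (flipCmd c C).KeepsMem A := ⟨h0, checksCmd_keepsMem h3 h4 c⟩

theorem Base.checkCmd_sem (h : Base M N x w σ) : Base M N x w ((checkCmd C).sem ρ σ) := by
  apply h.congr
  any_goals exact Cmd.sem_reg checkCmd_loopFree (checkCmd_keepsReg (by simp) (by simp) (by simp)) σ
  all_goals exact Cmd.sem_mem checkCmd_loopFree (checkCmd_keepsMem (by simp) (by simp)) σ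

/-- `U` is arbitrary because in the middle of a flip the stored set belongs neither to the old word
nor to the new one. Only the membership of the single check `v` is corrected. -/
theorem SetRep.checkCmd_sem (h : Base M N x w σ) {U : Finset (Fin m)} (hU : SetRep U σ)
    {v : Fin m} (hv : σ.reg 7 = v) :
    ∃ U' : Finset (Fin m), SetRep U' ((checkCmd C).sem ρ σ) ∧
      ∀ u, u ∈ U' ↔ if u = v then v ∈ unsat N C w else u ∈ U := by
  rw [checkCmd, branch_sem σ (z := localView (N v) w) fun k => h.eval_viewBit hv k]
  by_cases hC : localView (N v) w ∈ C
  · rw [if_pos hC]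
    refine ⟨_, hU.remove_sem hv, fun u => ?_⟩
    rw [Finset.mem_erase, mem_unsat]
    split_ifs with hu <;> simp [hu, hC]
  · rw [if_neg hC]
    refine ⟨_, hU.insert_sem hv, fun u => ?_⟩
    rw [Finset.mem_insert, mem_unsat]
    split_ifs with hu <;> simp [hu, hC]

/-- Invariant in the middle of a flip: the neighbours visited so far are classified by the current
word, all other checks as before. -/
theorem checksCmd_sem (h : Base M N x w σ) {U : Finset (Fin m)} (hU : SetRep U σ)
    {i : Fin n} (hi : σ.reg 6 = i) (k : ℕ) (hk : k ≤ c) :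
    Base M N x w ((checksCmd c C k).sem ρ σ) ∧
    ∃ U' : Finset (Fin m), SetRep U' ((checksCmd c C k).sem ρ σ) ∧
      ∀ u, (∃ j : Fin c, (j : ℕ) < k ∧ M i j = u) ∧ (u ∈ U' ↔ u ∈ unsat N C w) ∨
        (∀ j : Fin c, (j : ℕ) < k → M i j ≠ u) ∧ (u ∈ U' ↔ u ∈ U) := by
  induction k with
  | zero => exact ⟨h, U, hU, fun u => Or.inr ⟨by simp, Iff.rfl⟩⟩
  | succ k ih =>
    obtain ⟨hb, U₁, hU₁, h1⟩ := ih (by omega)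
    have h6 : ((checksCmd c C k).sem ρ σ).reg 6 = i := by
      rw [Cmd.sem_reg (checksCmd_loopFree k)
        (checksCmd_keepsReg (by simp) (by simp) (by simp) (by simp) k), hi]
    rw [checksCmd, Cmd.sem, Cmd.sem, Cmd.sem]
    set σ₁ := (checksCmd c C k).sem ρ σ with hσ₁
    have hval : (Expr.read 1 (.add (.mulc c (.reg 6)) (.const k))).eval σ₁ = M i ⟨k, hk⟩ := by
      have := hb.left i ⟨k, hk⟩
      simp only at this
      simp [h6, this]
    rw [hval]
    have hb' : Base M N x w (σ₁.setReg 7 (M i ⟨k, hk⟩)) :=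
      hb.congr (by simp) (by simp) rfl rfl rfl rfl
    have hU' : SetRep U₁ (σ₁.setReg 7 (M i ⟨k, hk⟩)) := hU₁.congr (by simp) rfl rfl
    refine ⟨hb'.checkCmd_sem, ?_⟩
    obtain ⟨U₂, hU₂, h2⟩ := SetRep.checkCmd_sem (C := C) (ρ := ρ) hb' hU' (v := M i ⟨k, hk⟩)
      (by simp)
    refine ⟨U₂, hU₂, fun u => ?_⟩
    have h2u := h2 u
    by_cases hu : u = M i ⟨k, hk⟩
    · rw [if_pos hu, ← hu] at h2u
      exact Or.inl ⟨⟨⟨k, hk⟩, Nat.lt_succ_self k, hu.symm⟩, h2u⟩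
    · rw [if_neg hu] at h2u
      rcases h1 u with ⟨⟨j, hj, hju⟩, h3⟩ | ⟨h3, h4⟩
      · exact Or.inl ⟨⟨j, by omega, hju⟩, h2u.trans h3⟩
      · refine Or.inr ⟨fun j hj => ?_, h2u.trans h4⟩
        rcases Nat.lt_succ_iff_lt_or_eq.1 hj with hj | hj
        · exact h3 j hj
        · have : j = ⟨k, hk⟩ := Fin.ext hj
          exact fun he => hu (by rw [← he, this])

theorem mem_unsat_flipAt_of_ne (hMN : Linked M N) {i : Fin n} {v : Fin m}
    (h : ∀ j, M i j ≠ v) : v ∈ unsat N C (flipAt w i) ↔ v ∈ unsat N C w := by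
  have : localView (N v) (flipAt w i) = localView (N v) w := by
    funext k
    refine flipAt_of_ne w fun he => ?_
    obtain ⟨j, hj⟩ := hMN v k
    exact h j (he ▸ hj)
  rw [mem_unsat, mem_unsat, this]

/-- A flip changes the local views of adjacent checks only, and these are the ones revisited. The
set of unsatisfied checks is thus maintained in constant time. -/
theorem flipCmd_sem (hMN : Linked M N) (h : Base M N x w σ) (hU : SetRep (unsat N C w) σ)
    {i : Fin n} (hi : σ.reg 6 = i) :
    Base M N x (flipAt w i) ((flipCmd c C).sem ρ σ) ∧
      SetRep (unsat N C (flipAt w i)) ((flipCmd c C).sem ρ σ) := by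
  rw [flipCmd, Cmd.sem, Cmd.sem]
  have hval : (Expr.sub (.const 1) (.read 0 (.reg 6))).eval σ = (flipAt w i i).val := by
    simp only [Expr.eval, hi, h.word, flipAt, Function.update_self]
    generalize w i = a
    revert a
    decide
  rw [hval]
  simp only [Expr.eval, hi]
  have hb : Base M N x (flipAt w i) (σ.setMem 0 i (flipAt w i i).val) := by
    refine ⟨h.reg_n, h.reg_m, fun j => ?_, ?_, ?_, ?_⟩
    · by_cases hj : j = i
      · simp [hj]
      · have : (j : ℕ) ≠ i := fun he => hj (Fin.val_injective he)
        simp [this, h.word, flipAt_of_ne w hj]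
    · simpa using h.left
    · simpa using h.right
    · simpa using h.copy
  have hU' : SetRep (unsat N C w) (σ.setMem 0 i (flipAt w i i).val) :=
    hU.congr rfl (by simp) (by simp)
  obtain ⟨h1, U', h2, h3⟩ := checksCmd_sem (C := C) (ρ := ρ) hb hU' (i := i) (by simpa using hi)
    c le_rfl
  refine ⟨h1, ?_⟩
  have : U' = unsat N C (flipAt w i) := by
    ext v
    rcases h3 v with ⟨-, h4⟩ | ⟨h4, h5⟩
    · exact h4
    · rw [h5, mem_unsat_flipAt_of_ne hMN fun j => h4 j j.2]
  rwa [← this]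

end Flip

end Tanner

namespace Tanner

open RAM

/-! ### Stacks -/

/-- The array `a` holds the stack `l`, whose top is the head of the list. -/
def IsStack {n : ℕ} (a : ℕ → ℕ) : List (Fin n) → Prop
  | [] => True
  | i :: l => a l.length = i ∧ IsStack a l

theorem IsStack.update {n : ℕ} {a : ℕ → ℕ} {b k : ℕ} : ∀ {l : List (Fin n)}, IsStack a l →
    l.length ≤ b → IsStack (Function.update a b k) l
  | [], _, _ => trivial
  | i :: l, h, hb => by
    rw [List.length_cons] at hb
    refine ⟨?_, h.2.update (by omega)⟩
    rw [Function.update_of_ne (by omega), h.1]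

theorem IsStack.push {n : ℕ} {a : ℕ → ℕ} {l : List (Fin n)} (h : IsStack a l) (i : Fin n) :
    IsStack (Function.update a l.length i) (i :: l) :=
  ⟨by simp, h.update le_rfl⟩

/-- The array `7`, of length register `3`, holds a log of at most `B` flips that lead from `w` back
to `y`. -/
def LogRep {n : ℕ} (y w : Word n) (B : ℕ) (σ : State) : Prop :=
  ∃ L : List (Fin n), σ.reg 3 = L.length ∧ IsStack (σ.mem 7) L ∧ L.foldl flipAt w = y ∧
    L.length ≤ B

theorem LogRep.congr {n : ℕ} {y w : Word n} {B B' : ℕ} {σ τ : State} (h : LogRep y w B σ)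
    (hB : B ≤ B') (h3 : τ.reg 3 = σ.reg 3) (h7 : τ.mem 7 = σ.mem 7) : LogRep y w B' τ := by
  obtain ⟨L, h1, h2, h4, h5⟩ := h
  exact ⟨L, by rw [h3, h1], by rwa [h7], h4, h5.trans hB⟩

/-- The array `5` holds the votes `p`, and the stack in array `6`, of length register `4`, lists the
bits with a nonzero vote. -/
def Tally {n : ℕ} (p : Fin n → ℕ) (σ : State) : Prop :=
  (∀ i : Fin n, σ.mem 5 i = p i) ∧ ∃ l : List (Fin n), l.Nodup ∧ (∀ i, i ∈ l ↔ p i ≠ 0) ∧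
    σ.reg 4 = l.length ∧ IsStack (σ.mem 6) l

theorem Tally.congr {n : ℕ} {p : Fin n → ℕ} {σ τ : State} (h : Tally p σ)
    (h4 : τ.reg 4 = σ.reg 4) (h5 : τ.mem 5 = σ.mem 5) (h6 : τ.mem 6 = σ.mem 6) : Tally p τ := by
  rw [Tally, h4, h5, h6]; exact h

/-! ### Casting the votes -/

/-- The neighbour number `k` of the check in register `7`. -/
def nbrExpr {d : ℕ} (k : Fin d) : Expr := .read 2 (.add (.mulc d (.reg 7)) (.const k))

/-- Store the smallest of the listed neighbours in register `10`. -/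
def minCmd {d : ℕ} : List (Fin d) → Cmd
  | [] => .assign 10 (.reg 0)
  | k :: l => .seq (minCmd l) (.cond (.lt (nbrExpr k) (.reg 10)) (.assign 10 (nbrExpr k)) .skip)

/-- Add `a` to the votes for the bit in register `10`. -/
def castCmd (a : ℕ) : Cmd :=
  .seq (.cond (.eq (.read 5 (.reg 10)) (.const 0))
      (.seq (.write 6 (.reg 4) (.reg 10)) (.assign 4 (.add (.reg 4) (.const 1)))) .skip)
    (.write 5 (.reg 10) (.add (.read 5 (.reg 10)) (.const a)))

/-- Cast the vote of the check in register `7`. -/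
noncomputable def voteCmd (P : Params) : Cmd :=
  branch P.d viewBit fun z =>
    if 1 ≤ hammingDist (decode P.C₀ z) z ∧ 2 * hammingDist (decode P.C₀ z) z < P.d₀ then
      .seq (minCmd (Finset.univ.filter fun k => decode P.C₀ z k ≠ z k).toList)
        (castCmd (P.d₀ - 2 * hammingDist (decode P.C₀ z) z))
    else .skip

section Vote

variable {ρ : Fin 2 → ℝ} {P : Params} {n m : ℕ} {M : Fin n → Fin P.c → Fin m}
  {N : Fin m → Fin P.d → Fin n} {x w y : Word n} {σ τ : State}

theorem minCmd_loopFree {d : ℕ} (l : List (Fin d)) : (minCmd l).LoopFree := by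
  induction l <;> simp_all [minCmd]

theorem minCmd_keepsReg {d r : ℕ} (hr : r ≠ 10) (l : List (Fin d)) : (minCmd l).KeepsReg r := by
  induction l <;> simp_all [minCmd]

theorem minCmd_keepsMem {d : ℕ} (A : ℕ) (l : List (Fin d)) : (minCmd l).KeepsMem A := by
  induction l <;> simp_all [minCmd]

theorem voteCmd_loopFree : (voteCmd P).LoopFree :=
  branch_loopFree fun z => by split_ifs <;> simp [castCmd, minCmd_loopFree]

theorem voteCmd_keepsReg {r : ℕ} (h4 : r ≠ 4) (h10 : r ≠ 10) : (voteCmd P).KeepsReg r :=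
  branch_keepsReg fun z => by split_ifs <;> simp [castCmd, minCmd_keepsReg, *]

theorem voteCmd_keepsMem {A : ℕ} (h5 : A ≠ 5) (h6 : A ≠ 6) : (voteCmd P).KeepsMem A :=
  branch_keepsMem fun z => by split_ifs <;> simp [castCmd, minCmd_keepsMem, *]

/-- The default `n` exceeds every index and serves as infinity. -/
theorem minCmd_sem {c d : ℕ} {M : Fin n → Fin c → Fin m} {N : Fin m → Fin d → Fin n}
    (h : Base M N x w σ) {v : Fin m} (hv : σ.reg 7 = v) (l : List (Fin d)) :
    (∀ k ∈ l, ((minCmd l).sem ρ σ).reg 10 ≤ N v k) ∧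
      (((minCmd l).sem ρ σ).reg 10 = n ∨ ∃ k ∈ l, ((minCmd l).sem ρ σ).reg 10 = N v k) := by
  induction l with
  | nil => simp [minCmd, h.reg_n]
  | cons k l ih =>
    obtain ⟨ih1, ih2⟩ := ih
    have h7 : ((minCmd l).sem ρ σ).reg 7 = v := by
      rw [Cmd.sem_reg (minCmd_loopFree l) (minCmd_keepsReg (by simp) l), hv]
    have hmem : ((minCmd l).sem ρ σ).mem 2 = σ.mem 2 :=
      Cmd.sem_mem (minCmd_loopFree l) (minCmd_keepsMem 2 l) σ
    have hval : (nbrExpr k).eval ((minCmd l).sem ρ σ) = N v k := by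
      simp [nbrExpr, h7, hmem, h.right]
    simp only [minCmd, Cmd.sem, Cond.Holds, hval, Expr.eval]
    split_ifs with hlt
    · simp only [State.setReg_reg, if_true, List.mem_cons, forall_eq_or_imp, exists_eq_or_imp]
      exact ⟨⟨le_rfl, fun j hj => hlt.le.trans (ih1 j hj)⟩, Or.inr (Or.inl trivial)⟩
    · simp only [List.mem_cons, forall_eq_or_imp, exists_eq_or_imp]
      refine ⟨⟨not_lt.1 hlt, ih1⟩, ?_⟩
      rcases ih2 with h2 | h2
      · exact Or.inl h2
      · exact Or.inr (Or.inr h2)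

/-- A bit is pushed only when its total was zero, and `a ≠ 0` makes the total nonzero. The stack
therefore lists each voted bit exactly once. -/
theorem Tally.castCmd_sem {p : Fin n → ℕ} (h : Tally p σ) {i : Fin n} (hi : σ.reg 10 = i) {a : ℕ}
    (ha : a ≠ 0) : Tally (Function.update p i (p i + a)) ((castCmd a).sem ρ σ) := by
  obtain ⟨h5, l, hnd, hl, h4, hst⟩ := h
  have hval : ∀ j : Fin n, Function.update (σ.mem 5) i (p i + a) j =
      Function.update p i (p i + a) j := by
    intro j
    by_cases hj : j = i
    · simp [hj]
    · have : (j : ℕ) ≠ i := fun he => hj (Fin.val_injective he)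
      simp [this, hj, h5]
  by_cases h0 : p i = 0
  · have hsem : (castCmd a).sem ρ σ =
        ((σ.setMem 6 l.length i).setReg 4 (l.length + 1)).setMem 5 i (p i + a) := by
      simp [castCmd, hi, h5, h0, h4]
    rw [hsem]
    refine ⟨fun j => by simpa using hval j, i :: l, ?_, fun j => ?_, by simp, ?_⟩
    · exact List.nodup_cons.2 ⟨fun hm => (hl i).1 hm h0, hnd⟩
    · by_cases hj : j = i
      · simp [hj, ha]
      · simp [hj, hl]
    · simpa using hst.push i
  · have hsem : (castCmd a).sem ρ σ = σ.setMem 5 i (p i + a) := by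
      simp [castCmd, hi, h5, h0]
    rw [hsem]
    refine ⟨fun j => by simpa using hval j, l, hnd, fun j => ?_, by simpa using h4, by simpa using hst⟩
    by_cases hj : j = i
    · simp [hj, ha, hl, h0]
    · simp [hj, hl]

theorem Base.voteCmd_sem (h : Base M N x w σ) : Base M N x w ((voteCmd P).sem ρ σ) := by
  apply h.congr
  any_goals exact Cmd.sem_reg voteCmd_loopFree (voteCmd_keepsReg (by simp) (by simp)) σ
  all_goals exact Cmd.sem_mem voteCmd_loopFree (voteCmd_keepsMem (by simp) (by simp)) σ

/-- At the leaf selected by the local view, the positions that differ and the weight of the vote are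
constants. Only the smallest neighbour at those positions depends on the graph and has to be
computed. -/
theorem Tally.voteCmd_sem (hb : Base M N x w σ) {p : Fin n → ℕ} (h : Tally p σ) {v : Fin m}
    (hv : σ.reg 7 = v) : Tally (fun i => p i + vote P N w v i) ((voteCmd P).sem ρ σ) := by
  rw [voteCmd, branch_sem σ (z := localView (N v) w) fun k => hb.eval_viewBit hv k]
  split_ifs with hc
  · obtain ⟨i, hi⟩ := exists_vote (P := P) (N := N) (x := w) (v := v) hc.1 hc.2
    have hmin := (vote_pos hi).2.2
    set l := (Finset.univ.filter fun k => decode P.C₀ (localView (N v) w) k ≠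
      localView (N v) w k).toList with hl
    obtain ⟨h1, h2⟩ := minCmd_sem (ρ := ρ) hb hv l
    have hmem : ∀ k, k ∈ l → N v k ∈ diffSet P N w v := fun k hk =>
      Finset.mem_image.2 ⟨k, by simpa [hl] using hk, rfl⟩
    have h10 : ((minCmd l).sem ρ σ).reg 10 = i := by
      obtain ⟨k, hk, hki⟩ := Finset.mem_image.1 (mem_diffSet_of_vote hi)
      have h3 := h1 k (by simpa [hl] using hk)
      rw [hki] at h3
      rcases h2 with h2 | ⟨k', hk', h2⟩
      · have := i.2; omega
      · have h4 : i ≤ N v k' := Finset.min_le_of_eq (hmem k' hk') hmin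
        exact le_antisymm h3 (h2 ▸ h4)
    have hT : Tally p ((minCmd l).sem ρ σ) :=
      h.congr (Cmd.sem_reg (minCmd_loopFree l) (minCmd_keepsReg (by simp) l) σ)
        (Cmd.sem_mem (minCmd_loopFree l) (minCmd_keepsMem _ l) σ)
        (Cmd.sem_mem (minCmd_loopFree l) (minCmd_keepsMem _ l) σ)
    have hT' := hT.castCmd_sem (ρ := ρ) h10
      (a := P.d₀ - 2 * hammingDist (decode P.C₀ (localView (N v) w)) (localView (N v) w)) (by omega)
    rw [Cmd.sem]
    convert hT' using 1
    funext j
    rw [vote_eq_ite hi]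
    by_cases hj : j = i
    · subst hj; simp [localDist]
    · simp [hj]
  · have hz : ∀ i, vote P N w v i = 0 := by
      intro i
      by_contra hne
      exact hc ⟨(vote_pos hne).1, (vote_pos hne).2.1⟩
    simpa [hz] using h

/-- Cast the votes of all unsatisfied checks. -/
noncomputable def tallyCmd (P : Params) : Cmd :=
  .loop (.lt (.const 0) (.reg 5))
    (.seq (.assign 5 (.sub (.reg 5) (.const 1)))
      (.seq (.assign 7 (.read 3 (.reg 5))) (voteCmd P)))

/-- Satisfied checks do not vote, so visiting the listed ones suffices and the time depends on `|U|`
rather than on `m`. -/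
theorem tallyCmd_runs (hb : Base M N x w σ) (hU : SetRep (unsat N P.C₀ w) σ)
    (hT : Tally (fun _ : Fin n => 0) σ) (h5 : σ.reg 5 = (unsat N P.C₀ w).card) :
    Runs ρ (tallyCmd P) σ ((tallyCmd P).wc * ((unsat N P.C₀ w).card + 1)) fun τ =>
      Base M N x w τ ∧ SetRep (unsat N P.C₀ w) τ ∧ Tally (voteCount P N w) τ := by
  classical
  set U := unsat N P.C₀ w with hUdef
  -- The list is traversed downwards, and `S` consists of the checks in slots `k` and above, whose
  -- votes have been cast. Array `4` stores positions plus one, hence `k + 1`.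
  let I : ℕ → State → Prop := fun k τ => Base M N x w τ ∧ SetRep U τ ∧ τ.reg 5 = k ∧ k ≤ U.card ∧
    ∃ S ⊆ U, Tally (fun i => ∑ v ∈ S, vote P N w v i) τ ∧ ∀ v ∈ U, v ∈ S ↔ k + 1 ≤ τ.mem 4 v
  have h0 : I U.card σ := by
    refine ⟨hb, hU, h5, le_rfl, ∅, by simp, by simpa using hT, fun v hv => ?_⟩
    obtain ⟨b, hb, h1, -⟩ := hU.pos v hv
    simp only [Finset.notMem_empty, false_iff, h1]
    omega
  refine Runs.mono (Runs.loop_sem (I := I) (by exact ⟨trivial, trivial, voteCmd_loopFree⟩) ?_ ?_ h0) le_rfl ?_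
  · rintro k τ ⟨hb, hU, h5, hk, S, hSU, hT, hS⟩
    refine ⟨by simp [h5], ?_⟩
    obtain ⟨v, hv, hv4, hv3⟩ := hU.list (b := k) hk
    have hsem : (Cmd.seq (.assign 5 (.sub (.reg 5) (.const 1)))
        (.seq (.assign 7 (.read 3 (.reg 5))) (voteCmd P))).sem ρ τ =
        (voteCmd P).sem ρ ((τ.setReg 5 k).setReg 7 v) := by
      simp [h5, hv3]
    rw [hsem]
    set τ' := (τ.setReg 5 k).setReg 7 v with hτ'
    have hb' : Base M N x w τ' := hb.congr (by simp [hτ']) (by simp [hτ']) rfl rfl rfl rfl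
    have hU' : SetRep U τ' := hU.congr (by simp [hτ']) rfl rfl
    have hT' := (hT.congr (τ := τ') (by simp [hτ']) rfl rfl).voteCmd_sem (ρ := ρ) hb' (v := v)
      (by simp [hτ'])
    have hvS : v ∉ S := fun hm => by
      have := (hS v hv).1 hm
      omega
    have hkeep : ∀ A, A ≠ 5 → A ≠ 6 → ((voteCmd P).sem ρ τ').mem A = τ.mem A := fun A h1 h2 =>
      Cmd.sem_mem voteCmd_loopFree (voteCmd_keepsMem h1 h2) τ'
    have hkeepr : ∀ r, r ≠ 4 → r ≠ 10 → ((voteCmd P).sem ρ τ').reg r = τ'.reg r := fun r h1 h2 =>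
      Cmd.sem_reg voteCmd_loopFree (voteCmd_keepsReg h1 h2) τ'
    refine ⟨hb'.voteCmd_sem, ?_, ?_, by omega, insert v S, ?_, ?_, ?_⟩
    · exact hU'.congr (hkeepr 2 (by simp) (by simp)) (hkeep 3 (by simp) (by simp))
        (hkeep 4 (by simp) (by simp))
    · rw [hkeepr 5 (by simp) (by simp)]
      simp [hτ']
    · exact Finset.insert_subset hv hSU
    · convert hT' using 2
      rw [Finset.sum_insert hvS, add_comm]
    · intro u hu
      rw [hkeep 4 (by simp) (by simp), Finset.mem_insert, hS u hu]
      obtain ⟨b, -, hu4, hu3⟩ := hU.pos u hu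
      constructor
      · rintro (rfl | h1)
        · omega
        · omega
      · intro h1
        by_cases hbk : b = k
        · left
          rw [hbk, hv3] at hu3
          exact (Fin.val_injective hu3).symm
        · right; omega
  · rintro τ ⟨-, -, h5, -⟩
    simp [h5]
  · rintro τ ⟨hb, hU, -, -, S, hSU, hT, hS⟩
    refine ⟨hb, hU, ?_⟩
    have hSU' : S = U := by
      refine Finset.Subset.antisymm hSU fun v hv => (hS v hv).2 ?_
      obtain ⟨b, -, h1, -⟩ := hU.pos v hv
      omega
    convert hT using 1
    funext i
    rw [hSU', voteCount]
    exact (Finset.sum_subset (Finset.subset_univ _) fun v _ hv => vote_eq_zero_of_notMem hv i).symm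

end Vote

end Tanner

namespace Tanner

open RAM

/-! ### `DeterFlip` as a program -/

/-- The memory holds the received word `x`, the current word `w` with its set of unsatisfied checks,
no votes, and a log of at most `B` flips that lead from `w` back to `y`. -/
structure Rep {n m c d : ℕ} (M : Fin n → Fin c → Fin m) (N : Fin m → Fin d → Fin n)
    (C : Submodule (ZMod 2) (Word d)) (x y w : Word n) (B : ℕ) (σ : State) : Prop where
  base : Base M N x w σ
  set : SetRep (unsat N C w) σ
  votes : ∀ i : Fin n, σ.mem 5 i = 0
  log : LogRep y w B σ

/-- Flip the bit in register `6` and log the flip. -/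
noncomputable def logFlipCmd (P : Params) : Cmd :=
  .seq (.write 7 (.reg 3) (.reg 6))
    (.seq (.assign 3 (.add (.reg 3) (.const 1))) (flipCmd P.c P.C₀))

/-- Flip the bits with `j` votes and erase the votes. -/
noncomputable def drainCmd (P : Params) (j : ℕ) : Cmd :=
  .loop (.lt (.const 0) (.reg 4))
    (.seq (.assign 4 (.sub (.reg 4) (.const 1)))
      (.seq (.assign 6 (.read 6 (.reg 4)))
        (.seq (.cond (.eq (.read 5 (.reg 6)) (.const j)) (logFlipCmd P) .skip)
          (.write 5 (.reg 6) (.const 0)))))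

/-- `DeterFlip` with the guess `j / (c d₀)`. -/
noncomputable def detCmd (P : Params) (j : ℕ) : Cmd :=
  .seq (.assign 4 (.const 0))
    (.seq (.assign 5 (.reg 2)) (.seq (tallyCmd P) (drainCmd P j)))

/-- Undo the logged flips. -/
noncomputable def undoCmd (P : Params) : Cmd :=
  .loop (.lt (.const 0) (.reg 3))
    (.seq (.assign 3 (.sub (.reg 3) (.const 1)))
      (.seq (.assign 6 (.read 7 (.reg 3))) (flipCmd P.c P.C₀)))

section Det

variable {ρ : Fin 2 → ℝ} {P : Params} {n m : ℕ} {M : Fin n → Fin P.c → Fin m}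
  {N : Fin m → Fin P.d → Fin n} {x w y : Word n} {σ τ : State}

theorem Rep.congr {B B' : ℕ} (h : Rep M N P.C₀ x y w B σ) (hB : B ≤ B')
    (hreg : ∀ r < 4, τ.reg r = σ.reg r) (hmem : τ.mem = σ.mem) : Rep M N P.C₀ x y w B' τ := by
  constructor
  · exact h.base.congr (hreg 0 (by simp)) (hreg 1 (by simp)) (by rw [hmem]) (by rw [hmem])
      (by rw [hmem]) (by rw [hmem])
  · exact h.set.congr (hreg 2 (by simp)) (by rw [hmem]) (by rw [hmem])
  · rw [hmem]; exact h.votes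
  · exact h.log.congr hB (hreg 3 (by simp)) (by rw [hmem])

theorem logFlipCmd_loopFree : (logFlipCmd P).LoopFree := ⟨trivial, trivial, flipCmd_loopFree⟩

theorem logFlipCmd_sem (hMN : Linked M N) (hb : Base M N x w σ) (hU : SetRep (unsat N P.C₀ w) σ)
    {B : ℕ} (hL : LogRep y w B σ) {i : Fin n} (hi : σ.reg 6 = i) :
    Base M N x (flipAt w i) ((logFlipCmd P).sem ρ σ) ∧
      SetRep (unsat N P.C₀ (flipAt w i)) ((logFlipCmd P).sem ρ σ) ∧
      LogRep y (flipAt w i) (B + 1) ((logFlipCmd P).sem ρ σ) := by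
  obtain ⟨L, h3, h7, hy, hB⟩ := hL
  have hsem : (logFlipCmd P).sem ρ σ = (flipCmd P.c P.C₀).sem ρ
      ((σ.setMem 7 L.length i).setReg 3 (L.length + 1)) := by
    simp [logFlipCmd, hi, h3]
  rw [hsem]
  set τ := (σ.setMem 7 L.length i).setReg 3 (L.length + 1) with hτ
  have hb' : Base M N x w τ := by apply hb.congr <;> simp [hτ]
  have hU' : SetRep (unsat N P.C₀ w) τ := by apply hU.congr <;> simp [hτ]
  obtain ⟨h1, h2⟩ := flipCmd_sem (ρ := ρ) hMN hb' hU' (i := i) (by simp [hτ, hi])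
  refine ⟨h1, h2, i :: L, ?_, ?_, ?_, ?_⟩
  · rw [Cmd.sem_reg flipCmd_loopFree (flipCmd_keepsReg (by simp) (by simp) (by simp) (by simp))]
    simp [hτ]
  · rw [Cmd.sem_mem flipCmd_loopFree (flipCmd_keepsMem (by simp) (by simp) (by simp))]
    simpa [hτ] using h7.push i
  · simpa using hy
  · simpa using hB

theorem logFlipCmd_keepsReg {r : ℕ} (h2 : r ≠ 2) (h3 : r ≠ 3) (h7 : r ≠ 7) (h8 : r ≠ 8)
    (h9 : r ≠ 9) : (logFlipCmd P).KeepsReg r := ⟨trivial, h3, flipCmd_keepsReg h2 h7 h8 h9⟩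

theorem logFlipCmd_keepsMem {A : ℕ} (h0 : A ≠ 0) (h3 : A ≠ 3) (h4 : A ≠ 4) (h7 : A ≠ 7) :
    (logFlipCmd P).KeepsMem A := ⟨h7, trivial, flipCmd_keepsMem h0 h3 h4⟩

/-- The stack holds at most `|U|` bits, so flipping one level and clearing all votes costs `O(|U| +
1)`. Bits off the stack have no votes and are not to be flipped, because `j ≠ 0`. -/
theorem drainCmd_runs (hMN : Linked M N) {B j : ℕ} (hj : j ≠ 0) (hb : Base M N x w σ)
    (hU : SetRep (unsat N P.C₀ w) σ) (hL : LogRep y w B σ) (hT : Tally (voteCount P N w) σ) :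
    Runs ρ (drainCmd P j) σ ((drainCmd P j).wc * ((unsat N P.C₀ w).card + 1)) fun τ =>
      Rep M N P.C₀ x y (fun i => if voteCount P N w i = j then w i + 1 else w i)
        (B + (unsat N P.C₀ w).card) τ := by
  classical
  obtain ⟨h5, l₀, hnd₀, hl₀, h4₀, hst₀⟩ := hT
  have hlen : l₀.length ≤ (unsat N P.C₀ w).card := by
    rw [← List.toFinset_card_of_nodup hnd₀]
    refine le_trans (Finset.card_le_card fun i hi => ?_) (card_voted_le (P := P) (N := N) w)
    simpa [hl₀] using hi
  set u := (unsat N P.C₀ w).card with hu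
  let p := voteCount P N w
  -- `l` is what remains of the stack. The voted bits outside `l` have been processed, and the log
  -- has at most `u - k` new entries.
  let I : ℕ → State → Prop := fun k τ => ∃ (l : List (Fin n)) (w' : Word n), l.length = k ∧
    k ≤ u ∧ l.Nodup ∧ τ.reg 4 = k ∧ IsStack (τ.mem 6) l ∧
    (∀ i : Fin n, τ.mem 5 i = if i ∈ l then p i else 0) ∧ Base M N x w' τ ∧
    SetRep (unsat N P.C₀ w') τ ∧ LogRep y w' (B + (u - k)) τ ∧
    ∀ i, w' i = if i ∉ l ∧ p i = j then w i + 1 else w i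
  have h0 : I l₀.length σ := by
    refine ⟨l₀, w, rfl, hlen, hnd₀, h4₀, hst₀, fun i => ?_, hb, hU,
      hL.congr (Nat.le_add_right _ _) rfl rfl, fun i => ?_⟩
    · by_cases hi : i ∈ l₀
      · rw [if_pos hi, h5]
      · rw [if_neg hi, h5]
        simpa [hl₀] using hi
    · rw [if_neg]
      rintro ⟨hi, hpi⟩
      exact hi ((hl₀ i).2 (by simp only [p] at hpi; omega))
  refine Runs.mono (Runs.loop_sem (I := I)
    (by exact ⟨trivial, trivial, ⟨logFlipCmd_loopFree, trivial⟩, trivial⟩) ?_ ?_ h0)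
    (Nat.mul_le_mul_left _ (by omega)) ?_
  · rintro k τ ⟨l, w', hlk, hk, hnd, h4, hst, h5, hb, hU, hL, hw'⟩
    refine ⟨by simp [h4], ?_⟩
    cases l with
    | nil => simp at hlk
    | cons i l =>
      rw [List.length_cons, Nat.add_right_cancel_iff] at hlk
      obtain ⟨hil, hndl⟩ := List.nodup_cons.1 hnd
      obtain ⟨hi6, hst⟩ := hst
      rw [hlk] at hi6
      have h5i : τ.mem 5 i = p i := by rw [h5, if_pos List.mem_cons_self]
      set τ₁ := (τ.setReg 4 k).setReg 6 i with hτ₁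
      have hb₁ : Base M N x w' τ₁ := by apply hb.congr <;> simp [hτ₁]
      have hU₁ : SetRep (unsat N P.C₀ w') τ₁ := by apply hU.congr <;> simp [hτ₁]
      have hL₁ : LogRep y w' (B + (u - (k + 1))) τ₁ := by apply hL.congr le_rfl <;> simp [hτ₁]
      have h6₁ : τ₁.reg 6 = i := by simp [hτ₁]
      have h5' : ∀ i' : Fin n, Function.update (τ.mem 5) i 0 i' =
          if i' ∈ l then p i' else 0 := by
        intro i'
        by_cases hi' : i' = i
        · subst hi'; simp [hil]
        · have : (i' : ℕ) ≠ i := fun he => hi' (Fin.val_injective he)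
          simp [this, h5, hi']
      by_cases hpj : p i = j
      · have hsem : ∀ q : Cmd, (Cmd.seq (.assign 4 (.sub (.reg 4) (.const 1)))
            (.seq (.assign 6 (.read 6 (.reg 4)))
              (.seq (.cond (.eq (.read 5 (.reg 6)) (.const j)) q .skip)
                (.write 5 (.reg 6) (.const 0))))).sem ρ τ =
            (q.sem ρ τ₁).setMem 5 ((q.sem ρ τ₁).reg 6) 0 := by
          intro q
          simp [h4, hi6, h5i, hpj, hτ₁]
        rw [hsem]
        obtain ⟨hb₂, hU₂, hL₂⟩ := logFlipCmd_sem (ρ := ρ) hMN hb₁ hU₁ hL₁ h6₁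
        have hkeep : ∀ A, A = 5 ∨ A = 6 → ((logFlipCmd P).sem ρ τ₁).mem A = τ.mem A := by
          intro A hA
          rw [Cmd.sem_mem logFlipCmd_loopFree (logFlipCmd_keepsMem (by omega) (by omega) (by omega)
            (by omega))]
          rfl
        have hkeepr : ∀ r, r = 4 ∨ r = 6 → ((logFlipCmd P).sem ρ τ₁).reg r = τ₁.reg r :=
          fun r hr => Cmd.sem_reg logFlipCmd_loopFree (logFlipCmd_keepsReg (by omega) (by omega)
            (by omega) (by omega) (by omega)) _
        rw [hkeepr 6 (by simp), h6₁]
        refine ⟨l, flipAt w' i, hlk, by omega, hndl, ?_, ?_, fun i' => ?_, ?_, ?_, ?_, fun i' => ?_⟩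
        · rw [State.setMem_reg, hkeepr 4 (by simp)]
          simp [hτ₁]
        · simpa [hkeep] using hst
        · simpa [hkeep] using h5' i'
        · apply hb₂.congr <;> simp
        · apply hU₂.congr <;> simp
        · apply hL₂.congr (by omega) <;> simp
        · by_cases hi' : i' = i
          · subst hi'
            simp [flipAt, hw', hil, hpj]
          · rw [flipAt_of_ne _ hi', hw']
            simp [hi']
      · have hsem : ∀ q : Cmd, (Cmd.seq (.assign 4 (.sub (.reg 4) (.const 1)))
            (.seq (.assign 6 (.read 6 (.reg 4)))
              (.seq (.cond (.eq (.read 5 (.reg 6)) (.const j)) q .skip)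
                (.write 5 (.reg 6) (.const 0))))).sem ρ τ = τ₁.setMem 5 i 0 := by
          intro q
          simp [h4, hi6, h5i, hpj, hτ₁]
        rw [hsem]
        refine ⟨l, w', hlk, by omega, hndl, ?_, ?_, fun i' => ?_, ?_, ?_, ?_, fun i' => ?_⟩
        · simp [hτ₁]
        · simpa [hτ₁] using hst
        · simpa [hτ₁] using h5' i'
        · apply hb₁.congr <;> simp
        · apply hU₁.congr <;> simp
        · apply hL₁.congr (by omega) <;> simp
        · rw [hw']
          by_cases hi' : i' = i
          · subst hi'; simp [hpj]
          · simp [hi']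
  · rintro τ ⟨l, w', -, -, -, h4, -⟩
    simp [h4]
  · rintro τ ⟨l, w', hl, -, -, -, -, h5, hb, hU, hL, hw'⟩
    rw [List.length_eq_zero_iff] at hl
    subst hl
    have : w' = fun i => if voteCount P N w i = j then w i + 1 else w i := by
      funext i
      simpa [p] using hw' i
    rw [← this]
    exact ⟨hb, hU, by simpa using h5, by simpa using hL⟩

theorem tallyCmd_keepsReg {r : ℕ} (h4 : r ≠ 4) (h5 : r ≠ 5) (h7 : r ≠ 7) (h10 : r ≠ 10) :
    (tallyCmd P).KeepsReg r := ⟨h5, h7, voteCmd_keepsReg h4 h10⟩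

theorem tallyCmd_keepsMem {A : ℕ} (h5 : A ≠ 5) (h6 : A ≠ 6) : (tallyCmd P).KeepsMem A :=
  ⟨trivial, trivial, voteCmd_keepsMem h5 h6⟩

theorem drainCmd_keepsReg {r j : ℕ} (hr : 10 < r) : (drainCmd P j).KeepsReg r :=
  ⟨by simp; omega, by simp; omega, ⟨logFlipCmd_keepsReg (by omega) (by omega) (by omega) (by omega) (by omega),
    trivial⟩, trivial⟩

theorem detCmd_keepsReg {r j : ℕ} (hr : 10 < r) : (detCmd P j).KeepsReg r :=
  ⟨by simp; omega, by simp; omega, tallyCmd_keepsReg (by omega) (by omega) (by omega) (by omega),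
    drainCmd_keepsReg hr⟩

theorem undoCmd_keepsReg {r : ℕ} (hr : 10 < r) : (undoCmd P).KeepsReg r :=
  ⟨by simp; omega, by simp; omega, flipCmd_keepsReg (by omega) (by omega) (by omega) (by omega)⟩

/-- The number `c d₀ q` of votes that corresponds to the guess `q`. -/
noncomputable def guessNum (P : Params) (q : ℝ) : ℕ := ⌊q * ((P.c : ℝ) * P.d₀)⌋₊

theorem guessNum_eq (hP : P.Valid) {q : ℝ} (hq : q ∈ P.guesses) :
    guessNum P q ≠ 0 ∧ q = (guessNum P q : ℝ) / ((P.c : ℝ) * P.d₀) := by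
  obtain ⟨j, h1, -, rfl⟩ := mem_guesses.1 hq
  have hc := hP.c_pos'
  have hd := hP.minDist_gt'
  have : guessNum P ((j : ℝ) / ((P.c : ℝ) * P.d₀)) = j := by
    rw [guessNum, div_mul_cancel₀ _ (by positivity), Nat.floor_natCast]
  rw [this]
  exact ⟨by omega, rfl⟩

theorem detCmd_runs (hP : P.Valid) (hMN : Linked M N) {q : ℝ} (hq : q ∈ P.guesses) {B : ℕ}
    (h : Rep M N P.C₀ x y w B σ) :
    Runs ρ (detCmd P (guessNum P q)) σ
      ((detCmd P (guessNum P q)).wc * ((unsat N P.C₀ w).card + 1)) fun τ =>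
      Rep M N P.C₀ x y (deterFlip P N w q) (B + (unsat N P.C₀ w).card) τ := by
  obtain ⟨hj, hqj⟩ := guessNum_eq hP hq
  set j := guessNum P q with hjdef
  set τ₁ := (σ.setReg 4 0).setReg 5 (σ.reg 2) with hτ₁
  have hdet : deterFlip P N w q = fun i => if voteCount P N w i = j then w i + 1 else w i := by
    funext i
    rw [hqj, deterFlip_apply hP.c_pos hP.minDist_pos]
  rw [hdet]
  have h1 : Rep M N P.C₀ x y w B τ₁ := by
    refine h.congr le_rfl (fun r hr => ?_) rfl
    simp [hτ₁, (show r ≠ 4 by omega), (show r ≠ 5 by omega)]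
  refine Runs.mono (Runs.seq (Runs.of_sem trivial (Q := fun τ => τ = σ.setReg 4 0) rfl) ?_)
    (B := (Cmd.assign 4 (.const 0)).wc + ((Cmd.assign 5 (.reg 2)).wc +
      ((tallyCmd P).wc * ((unsat N P.C₀ w).card + 1) +
        (drainCmd P j).wc * ((unsat N P.C₀ w).card + 1)))) ?_ fun _ h => h
  · rintro _ rfl
    refine Runs.seq (Runs.of_sem trivial (Q := fun τ => τ = τ₁) (by simp [hτ₁])) ?_
    rintro _ rfl
    refine Runs.seq (tallyCmd_runs h1.base h1.set ?_ ?_).frame ?_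
    · exact ⟨fun i => h1.votes i, [], by simp [hτ₁, IsStack]⟩
    · simp [hτ₁, h.set.card]
    · rintro τ ⟨⟨hb, hU, hT⟩, hr, hm⟩
      refine drainCmd_runs hMN hj hb hU ?_ hT
      exact h1.log.congr le_rfl (hr 3 (tallyCmd_keepsReg (by simp) (by simp) (by simp) (by simp)))
        (hm 7 (tallyCmd_keepsMem (by simp) (by simp)))
  · simp only [detCmd, Cmd.wc]
    ring_nf
    omega

/-- Popping the log replays its flips back to `y`, in time proportional to its length and without a
stored copy of `y`. -/
theorem undoCmd_runs (hMN : Linked M N) {B : ℕ} (h : Rep M N P.C₀ x y w B σ) :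
    Runs ρ (undoCmd P) σ ((undoCmd P).wc * (B + 1)) fun τ => Rep M N P.C₀ x y y 0 τ := by
  obtain ⟨hb, hU, h5, L, h3, h7, hy, hB⟩ := h
  let I : ℕ → State → Prop := fun k τ => ∃ (L : List (Fin n)) (w : Word n), L.length = k ∧
    Base M N x w τ ∧ SetRep (unsat N P.C₀ w) τ ∧ (∀ i : Fin n, τ.mem 5 i = 0) ∧
    τ.reg 3 = k ∧ IsStack (τ.mem 7) L ∧ L.foldl flipAt w = y
  refine Runs.mono (Runs.loop_sem (I := I) (by exact ⟨trivial, trivial, flipCmd_loopFree⟩) ?_ ?_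
    (⟨L, w, rfl, hb, hU, h5, h3, h7, hy⟩ : I L.length σ)) (Nat.mul_le_mul_left _ (by omega)) ?_
  · rintro k τ ⟨L, w, hk, hb, hU, h5, h3, h7, hy⟩
    refine ⟨by simp [h3], ?_⟩
    cases L with
    | nil => simp at hk
    | cons i L =>
      rw [List.length_cons, Nat.add_right_cancel_iff] at hk
      obtain ⟨hi7, h7⟩ := h7
      rw [hk] at hi7
      have hsem : ∀ q : Cmd, (Cmd.seq (.assign 3 (.sub (.reg 3) (.const 1)))
          (.seq (.assign 6 (.read 7 (.reg 3))) q)).sem ρ τ =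
          q.sem ρ ((τ.setReg 3 k).setReg 6 i) := by
        intro q
        simp [h3, hi7]
      rw [hsem]
      set τ₁ := (τ.setReg 3 k).setReg 6 i with hτ₁
      have hb₁ : Base M N x w τ₁ := by apply hb.congr <;> simp [hτ₁]
      have hU₁ : SetRep (unsat N P.C₀ w) τ₁ := by apply hU.congr <;> simp [hτ₁]
      obtain ⟨hb₂, hU₂⟩ := flipCmd_sem (ρ := ρ) hMN hb₁ hU₁ (i := i) (by simp [hτ₁])
      have hkeep : ∀ A, A = 5 ∨ A = 7 → ((flipCmd P.c P.C₀).sem ρ τ₁).mem A = τ.mem A := by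
        intro A hA
        rw [Cmd.sem_mem flipCmd_loopFree (flipCmd_keepsMem (by omega) (by omega) (by omega))]
        rfl
      refine ⟨L, flipAt w i, hk, hb₂, hU₂, ?_, ?_, ?_, hy⟩
      · rw [hkeep 5 (by simp)]; exact h5
      · rw [Cmd.sem_reg flipCmd_loopFree
          (flipCmd_keepsReg (by simp) (by simp) (by simp) (by simp))]
        simp [hτ₁]
      · rw [hkeep 7 (by simp)]; exact h7
  · rintro τ ⟨L, w, -, -, -, -, h3, -⟩
    simp [h3]
  · rintro τ ⟨L, w, hk, hb, hU, h5, h3, h7, hy⟩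
    rw [List.length_eq_zero_iff] at hk
    subst hk
    rw [List.foldl_nil] at hy
    subst hy
    exact ⟨hb, hU, h5, [], h3, trivial, rfl, le_rfl⟩

/-- The flips of `DeterFlip` affect at most `c` checks for each unsatisfied check. -/
theorem card_unsat_deterFlip_le (hP : P.Valid) (hMN : Linked M N) (w : Word n) {q : ℝ}
    (hq : q ∈ P.guesses) : (unsat N P.C₀ (deterFlip P N w q)).card ≤
      (1 + P.c) * (unsat N P.C₀ w).card := by
  classical
  obtain ⟨hj, hqj⟩ := guessNum_eq hP hq
  have hsub : unsat N P.C₀ (deterFlip P N w q) ⊆ unsat N P.C₀ w ∪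
      (Finset.univ.filter fun i => voteCount P N w i ≠ 0).biUnion
        fun i => Finset.univ.image (M i) := by
    intro v hv
    by_contra hcon
    rw [Finset.mem_union, not_or, Finset.mem_biUnion, not_exists] at hcon
    have : localView (N v) (deterFlip P N w q) = localView (N v) w := by
      funext k
      obtain ⟨l, hl⟩ := hMN v k
      rw [localView, hqj, deterFlip_apply hP.c_pos hP.minDist_pos, if_neg]
      · rfl
      · intro he
        refine hcon.2 (N v k) ⟨by simp; omega, Finset.mem_image.2 ⟨l, Finset.mem_univ _, hl⟩⟩
    rw [mem_unsat, this, ← mem_unsat] at hv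
    exact hcon.1 hv
  refine (Finset.card_le_card hsub).trans ((Finset.card_union_le _ _).trans ?_)
  have h1 := Finset.card_biUnion_le_card_mul
    (Finset.univ.filter fun i => voteCount P N w i ≠ 0) (fun i => Finset.univ.image (M i)) P.c
    (fun i _ => Finset.card_image_le.trans_eq (by simp))
  have h2 := Nat.mul_le_mul_right P.c (card_voted_le (P := P) (N := N) w)
  rw [Nat.add_mul, Nat.one_mul, Nat.mul_comm P.c]
  omega

end Det

end Tanner

namespace Tanner

open RAM

/-! ### `DeepFlip` as a program -/

/-- `guardedRun` along a sequence of guesses; register `13` is set to `0` on success and to `1` on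
failure. -/
noncomputable def guardCmd (P : Params) : List ℝ → Cmd
  | [] => .assign 13 (.const 0)
  | q :: qs => .seq (detCmd P (guessNum P q))
      (.cond (.scaledLt 1 (.mulc P.c (.reg 0)) (.reg 2)) (.assign 13 (.const 1)) (guardCmd P qs))

/-- Try a sequence of guesses and undo the flips. Register `11` holds the least number of
unsatisfied checks seen, register `12` the number of the sequence that attains it. -/
noncomputable def tryCmd (P : Params) (k : ℕ) (qs : List ℝ) : Cmd :=
  .seq (guardCmd P qs)
    (.seq (.cond (.eq (.reg 13) (.const 0))
      (.cond (.lt (.reg 2) (.reg 11))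
        (.seq (.assign 11 (.reg 2)) (.assign 12 (.const k))) .skip) .skip) (undoCmd P))

/-- Try all sequences of a list, numbered from `k` on. -/
noncomputable def scanCmd (P : Params) : ℕ → List (List ℝ) → Cmd
  | _, [] => .skip
  | k, qs :: l => .seq (tryCmd P k qs) (scanCmd P (k + 1) l)

/-- Run the sequence whose number is in register `12`; the list is numbered from `k` on. -/
noncomputable def pickCmd (P : Params) : ℕ → List (List ℝ) → Cmd
  | _, [] => .skip
  | k, qs :: l => .cond (.eq (.reg 12) (.const k)) (guardCmd P qs) (pickCmd P (k + 1) l)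

/-- `DeepFlip`; register `12` is `0` if the result is `⊥`. -/
noncomputable def deepCmd (P : Params) : Cmd :=
  .seq (.seq (.assign 3 (.const 0)) (.seq (.assign 11 (.add (.reg 1) (.const 1)))
    (.assign 12 (.const 0))))
    (.seq (scanCmd P 1 (seqs P.guesses P.s)) (pickCmd P 1 (seqs P.guesses P.s)))

section Deep

variable {P : Params}

theorem guardCmd_keepsReg {r : ℕ} (hr : 10 < r) (hr13 : r ≠ 13) (qs : List ℝ) :
    (guardCmd P qs).KeepsReg r := by
  induction qs with
  | nil => exact hr13
  | cons q qs ih => exact ⟨detCmd_keepsReg hr, hr13, ih⟩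

theorem tryCmd_keepsReg {r k : ℕ} (hr : 13 < r) (qs : List ℝ) : (tryCmd P k qs).KeepsReg r :=
  ⟨guardCmd_keepsReg (by omega) (by omega) qs,
    ⟨⟨⟨by simp; omega, by simp; omega⟩, trivial⟩, trivial⟩, undoCmd_keepsReg (by omega)⟩

theorem scanCmd_keepsReg {r : ℕ} (hr : 13 < r) (k : ℕ) (l : List (List ℝ)) :
    (scanCmd P k l).KeepsReg r := by
  induction l generalizing k with
  | nil => trivial
  | cons qs l ih => exact ⟨tryCmd_keepsReg hr qs, ih _⟩

theorem pickCmd_keepsReg {r : ℕ} (hr : 10 < r) (hr13 : r ≠ 13) (k : ℕ) (l : List (List ℝ)) :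
    (pickCmd P k l).KeepsReg r := by
  induction l generalizing k with
  | nil => trivial
  | cons qs l ih => exact ⟨guardCmd_keepsReg hr hr13 qs, ih _⟩

theorem deepCmd_keepsReg {r : ℕ} (hr : 13 < r) : (deepCmd P).KeepsReg r :=
  ⟨⟨by simp; omega, by simp; omega, by simp; omega⟩, scanCmd_keepsReg hr _ _,
    pickCmd_keepsReg (by omega) (by omega) _ _⟩

/-- Each flip multiplies `|U|` by at most `1 + c` and the sequence is fixed, so one constant `K`,
chosen before `n`, bounds the time, the growth of the log and the final `|U|`. The guard is tested
in the form `γ (c n) < |U|`, which needs only repeated addition. -/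
theorem guardCmd_runs (hP : P.Valid) : ∀ qs : List ℝ, (∀ q ∈ qs, q ∈ P.guesses) →
    ∃ K, ∀ {n m : ℕ} {M : Fin n → Fin P.c → Fin m} {N : Fin m → Fin P.d → Fin n}
      {x y w : Word n} {σ : State} {B : ℕ}, Linked M N → Rep M N P.C₀ x y w B σ →
      Runs ![P.α, P.γ] (guardCmd P qs) σ (K * ((unsat N P.C₀ w).card + 1)) fun τ =>
        ∃ w', Rep M N P.C₀ x y w' (B + K * ((unsat N P.C₀ w).card + 1)) τ ∧
          (unsat N P.C₀ w').card ≤ K * ((unsat N P.C₀ w).card + 1) ∧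
          guardedRun P N w qs = if τ.reg 13 = 0 then some w' else none
  | [], _ => by
    refine ⟨2, fun {n m M N x y w σ B} hMN h => ?_⟩
    refine (Runs.of_sem (ρ := ![P.α, P.γ]) (σ := σ) (p := guardCmd P []) trivial
      (Q := fun τ => τ = σ.setReg 13 0) rfl).mono ?_ ?_
    · simp only [guardCmd, Cmd.wc, Expr.cost]; omega
    · rintro _ rfl
      refine ⟨w, h.congr (by omega) (fun r hr => ?_) rfl, by omega, by simp [guardedRun]⟩
      simp [show r ≠ 13 by omega]
  | q :: qs, hqs => by
    simp only [List.mem_cons, forall_eq_or_imp] at hqs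
    obtain ⟨K, hK⟩ := guardCmd_runs hP qs hqs.2
    -- The factor `1 + c` on `K` accounts for the growth of `|U|` in the first flip. The summand `3
    -- + c` pays for the failure assignment and covers the first flip's contribution to `|U|` and to
    -- the log.
    refine ⟨(detCmd P (guessNum P q)).wc + (Cond.scaledLt 1 (.mulc P.c (.reg 0)) (.reg 2)).cost +
        3 + P.c + K * (1 + P.c), fun {n m M N x y w σ B} hMN h => ?_⟩
    have hdet := card_unsat_deterFlip_le hP hMN w hqs.1
    have hbound : K * ((unsat N P.C₀ (deterFlip P N w q)).card + 1) ≤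
        K * (1 + P.c) * ((unsat N P.C₀ w).card + 1) := by
      rw [mul_assoc]
      refine Nat.mul_le_mul_left _ ?_
      rw [Nat.mul_succ]
      omega
    have hring : ((detCmd P (guessNum P q)).wc +
        (Cond.scaledLt 1 (.mulc P.c (.reg 0)) (.reg 2)).cost + 3 + P.c + K * (1 +
        P.c)) * ((unsat N P.C₀ w).card + 1) =
        (detCmd P (guessNum P q)).wc * ((unsat N P.C₀ w).card + 1) +
            (Cond.scaledLt 1 (.mulc P.c (.reg 0)) (.reg 2)).cost * ((unsat N P.C₀ w).card + 1) +
            (2 * ((unsat N P.C₀ w).card + 1)) + (1 + P.c) * (unsat N P.C₀ w).card + (1 + P.c) +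
          K * (1 + P.c) * ((unsat N P.C₀ w).card + 1) := by ring
    have hE1 : (Cond.scaledLt 1 (.mulc P.c (.reg 0)) (.reg 2)).cost ≤
        (Cond.scaledLt 1 (.mulc P.c (.reg 0)) (.reg 2)).cost * ((unsat N P.C₀ w).card + 1) :=
        Nat.le_mul_of_pos_right _ (by omega)
    refine Runs.mono (Runs.seq (C := (Cond.scaledLt 1 (.mulc P.c (.reg 0)) (.reg 2)).cost + (2 +
        K * (1 + P.c) * ((unsat N P.C₀ w).card + 1)))
      (detCmd_runs hP hMN hqs.1 h) ?_) (by rw [hring]; omega) fun _ h => h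
    intro τ hτ
    have hcond : (Cond.scaledLt 1 (.mulc P.c (.reg 0)) (.reg 2)).Holds ![P.α, P.γ] τ ↔
        (P.c : ℝ) * P.γ * n < ((unsat N P.C₀ (deterFlip P N w q)).card : ℝ) := by
      simp only [Cond.Holds, Expr.eval_mulc, Expr.eval, hτ.base.reg_n, hτ.set.card]
      push_cast
      rw [show (P.c : ℝ) * P.γ * n = P.γ * (P.c * n) by ring]
    refine Runs.cond (fun hb => ?_) fun hb => ?_
    · refine (Runs.of_sem (ρ := ![P.α, P.γ]) (σ := τ) (p := .assign 13 (.const 1)) trivial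
        (Q := fun υ => υ = τ.setReg 13 1) rfl).mono ?_ ?_
      · simp only [Cmd.wc, Expr.cost]; omega
      · rintro _ rfl
        refine ⟨deterFlip P N w q, hτ.congr (by rw [hring]; omega) (fun r hr => ?_) rfl,
          by rw [hring]; omega, ?_⟩
        · simp [show r ≠ 13 by omega]
        · rw [guardedRun, if_pos (hcond.1 hb)]
          rfl
    · refine (hK hMN hτ).mono (by omega) ?_
      rintro υ ⟨w', h1, h2, h3⟩
      refine ⟨w', h1.congr (by rw [hring]; omega) (fun _ _ => rfl) rfl, by rw [hring]; omega, ?_⟩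
      rw [guardedRun, if_neg (mt hcond.2 hb), h3]

/-- The registers `11` and `12` represent the pair `(k_min, x_min)`. -/
def BestRep (P : Params) {n m : ℕ} (N : Fin m → Fin P.d → Fin n) (w : Word n)
    (l : List (List ℝ)) (best : ℕ × Option (Word n)) (σ : State) : Prop :=
  σ.reg 11 = best.1 ∧ ((best.2 = none ∧ σ.reg 12 = 0) ∨
    ∃ z k qs, best.2 = some z ∧ σ.reg 12 = k + 1 ∧ l[k]? = some qs ∧ guardedRun P N w qs = some z)

/-- The log is initially empty with target `w`, so that undoing returns to `w`. Sequences are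
numbered from `1`, because `0` in register `12` stands for `⊥`. -/
theorem tryCmd_runs (hP : P.Valid) (qs : List ℝ) (hqs : ∀ q ∈ qs, q ∈ P.guesses) (k : ℕ) :
    ∃ K, ∀ {n m : ℕ} {M : Fin n → Fin P.c → Fin m} {N : Fin m → Fin P.d → Fin n}
      {x w : Word n} {σ : State} {best : ℕ × Option (Word n)} {l : List (List ℝ)}, Linked M N →
      Rep M N P.C₀ x w w 0 σ → BestRep P N w l best σ → l[k]? = some qs →
      Runs ![P.α, P.γ] (tryCmd P (k + 1) qs) σ (K * ((unsat N P.C₀ w).card + 1)) fun τ =>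
        Rep M N P.C₀ x w w 0 τ ∧ BestRep P N w l (deepFlipStep P N w best qs) τ := by
  obtain ⟨K, hK⟩ := guardCmd_runs hP qs hqs
  let mid : Cmd := .cond (.eq (.reg 13) (.const 0))
      (.cond (.lt (.reg 2) (.reg 11))
        (.seq (.assign 11 (.reg 2)) (.assign 12 (.const (k + 1)))) .skip) .skip
  have hmidfree : mid.LoopFree := by simp [mid]
  refine ⟨K + mid.wc + (undoCmd P).wc * (K + 1), fun {n m M N x w σ best l} hMN h hbest hl => ?_⟩
  refine Runs.mono (Runs.seq (C := mid.wc + (undoCmd P).wc * (0 + K * ((unsat N P.C₀ w).card + 1) +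
      1))
    (hK hMN h).frame ?_) ?_ fun _ h => h
  swap
  · have h1 : (undoCmd P).wc * (K * ((unsat N P.C₀ w).card + 1) + 1) ≤ (undoCmd P).wc * (K +
      1) * ((unsat N P.C₀ w).card + 1) := by
      rw [mul_assoc]
      refine Nat.mul_le_mul_left _ ?_
      rw [Nat.add_mul]; omega
    have h2 : mid.wc ≤ mid.wc * ((unsat N P.C₀ w).card + 1) := Nat.le_mul_of_pos_right _ (by omega)
    rw [Nat.zero_add, Nat.add_mul, Nat.add_mul]
    omega
  rintro τ ⟨⟨w', h1, -, h3⟩, hr, -⟩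
  have h11 : τ.reg 11 = σ.reg 11 := hr 11 (guardCmd_keepsReg (by simp) (by simp) qs)
  have h12 : τ.reg 12 = σ.reg 12 := hr 12 (guardCmd_keepsReg (by simp) (by simp) qs)
  have hmid : Rep M N P.C₀ x w w' (0 + K * ((unsat N P.C₀ w).card + 1)) (mid.sem ![P.α, P.γ] τ) ∧
      BestRep P N w l (deepFlipStep P N w best qs) (mid.sem ![P.α, P.γ] τ) := by
    by_cases h13 : τ.reg 13 = 0
    · rw [if_pos h13] at h3
      by_cases hlt : (unsat N P.C₀ w').card < best.1
      · have hsem : mid.sem ![P.α, P.γ] τ =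
            (τ.setReg 11 (unsat N P.C₀ w').card).setReg 12 (k + 1) := by
          simp [mid, h13, h1.set.card, h11, hbest.1, hlt]
        rw [hsem]
        refine ⟨h1.congr le_rfl (fun r hr => ?_) rfl, ?_⟩
        · simp [show r ≠ 12 by omega, show r ≠ 11 by omega]
        · rw [deepFlipStep, h3]
          simp only [if_pos hlt]
          exact ⟨by simp, Or.inr ⟨w', k, qs, rfl, by simp, hl, h3⟩⟩
      · have hsem : mid.sem ![P.α, P.γ] τ = τ := by
          simp [mid, h13, h1.set.card, h11, hbest.1, hlt]
        rw [hsem]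
        refine ⟨h1, ?_⟩
        rw [deepFlipStep, h3]
        simp only [if_neg hlt]
        rw [BestRep, h11, h12]
        exact hbest
    · rw [if_neg h13] at h3
      have hsem : mid.sem ![P.α, P.γ] τ = τ := by simp [mid, h13]
      rw [hsem]
      refine ⟨h1, ?_⟩
      rw [deepFlipStep, h3]
      simp only
      rw [BestRep, h11, h12]
      exact hbest
  refine Runs.seq (Runs.of_sem hmidfree (Q := fun υ => υ = mid.sem ![P.α, P.γ] τ) rfl) ?_
  rintro _ rfl
  refine (undoCmd_runs hMN hmid.1).frame.mono le_rfl ?_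
  rintro υ ⟨h4, hr, -⟩
  refine ⟨h4, ?_⟩
  rw [BestRep, hr 11 (undoCmd_keepsReg (by simp)), hr 12 (undoCmd_keepsReg (by simp))]
  exact hmid.2

/-- Recorded numbers refer to the whole list `l`, while the induction runs over the remaining part
`l'`; `l.drop k = l'` links the two. -/
theorem scanCmd_runs (hP : P.Valid) (l : List (List ℝ)) :
    ∀ (l' : List (List ℝ)) (k : ℕ), l.drop k = l' → (∀ qs ∈ l', ∀ q ∈ qs, q ∈ P.guesses) →
    ∃ K, ∀ {n m : ℕ} {M : Fin n → Fin P.c → Fin m} {N : Fin m → Fin P.d → Fin n}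
      {x w : Word n} {σ : State} {best : ℕ × Option (Word n)}, Linked M N →
      Rep M N P.C₀ x w w 0 σ → BestRep P N w l best σ →
      Runs ![P.α, P.γ] (scanCmd P (k + 1) l') σ (K * ((unsat N P.C₀ w).card + 1)) fun τ =>
        Rep M N P.C₀ x w w 0 τ ∧ BestRep P N w l (l'.foldl (deepFlipStep P N w) best) τ
  | [], k, _, _ => by
    refine ⟨1, fun {n m M N x w σ best} hMN h hbest => ?_⟩
    refine (Runs.of_sem (p := .skip) trivial (Q := fun τ => τ = σ) rfl).mono ?_ ?_
    · simp [Cmd.wc]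
    · rintro _ rfl
      exact ⟨h, hbest⟩
  | qs :: l', k, hl, hqs => by
    simp only [List.mem_cons, forall_eq_or_imp] at hqs
    have hk : l[k]? = some qs := by
      have := congrArg (fun t => t[0]?) hl
      simpa using this
    have hdrop : l.drop (k + 1) = l' := by
      rw [← List.tail_drop, hl, List.tail_cons]
    obtain ⟨K₁, h₁⟩ := tryCmd_runs hP qs hqs.1 k
    obtain ⟨K₂, h₂⟩ := scanCmd_runs hP l l' (k + 1) hdrop hqs.2
    refine ⟨K₁ + K₂, fun {n m M N x w σ best} hMN h hbest => ?_⟩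
    rw [Nat.add_mul]
    exact Runs.seq (h₁ hMN h hbest hk) fun τ hτ => h₂ hMN hτ.1 hτ.2

/-- Covers the result `⊥`: the number `0` matches no sequence when numbering starts at `1`. -/
theorem pickCmd_runs_of_lt {ρ : Fin 2 → ℝ} (l : List (List ℝ)) : ∀ k : ℕ,
    ∃ K, ∀ {σ : State}, σ.reg 12 < k → Runs ρ (pickCmd P k l) σ K fun τ => τ = σ := by
  induction l with
  | nil => exact fun k => ⟨1, fun {σ} _ => Runs.of_sem (p := .skip) trivial rfl⟩
  | cons qs l ih =>
    intro k
    obtain ⟨K, hK⟩ := ih (k + 1)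
    refine ⟨_, fun {σ} hσ => Runs.cond (B := K) (fun hb => ?_) fun _ => hK (by omega)⟩
    simp only [Cond.Holds, Expr.eval] at hb
    omega

/-- `guardedRun` depends only on the word and the sequence, so a second run reproduces the recorded
result. Storing that result as a word would take time proportional to `n`. -/
theorem pickCmd_runs (hP : P.Valid) : ∀ (l : List (List ℝ)) (k : ℕ),
    (∀ qs ∈ l, ∀ q ∈ qs, q ∈ P.guesses) →
    ∃ K, ∀ {n m : ℕ} {M : Fin n → Fin P.c → Fin m} {N : Fin m → Fin P.d → Fin n}
      {x y w z : Word n} {σ : State} {B i : ℕ} {qs : List ℝ}, Linked M N →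
      Rep M N P.C₀ x y w B σ → l[i]? = some qs → σ.reg 12 = k + i →
      guardedRun P N w qs = some z →
      Runs ![P.α, P.γ] (pickCmd P k l) σ (K * ((unsat N P.C₀ w).card + 1)) fun τ =>
        (∃ B', Rep M N P.C₀ x y z B' τ) ∧
          (unsat N P.C₀ z).card ≤ K * ((unsat N P.C₀ w).card + 1)
  | [], k, _ => ⟨0, fun {n m M N x y w z σ B i qs} _ _ hi => by simp at hi⟩
  | qs :: l, k, hl => by
    simp only [List.mem_cons, forall_eq_or_imp] at hl
    obtain ⟨K₁, h₁⟩ := guardCmd_runs hP qs hl.1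
    obtain ⟨K₂, h₂⟩ := pickCmd_runs hP l (k + 1) hl.2
    refine ⟨(Cond.eq (.reg 12) (.const k)).cost + (K₁ + K₂),
      fun {n m M N x y w z σ B i ps} hMN h hi h12 hz => ?_⟩
    have hE : (Cond.eq (.reg 12) (.const k)).cost ≤
        (Cond.eq (.reg 12) (.const k)).cost * ((unsat N P.C₀ w).card + 1) :=
        Nat.le_mul_of_pos_right _ (by omega)
    have hring : ((Cond.eq (.reg 12) (.const k)).cost + (K₁ + K₂)) * ((unsat N P.C₀ w).card + 1) =
        (Cond.eq (.reg 12) (.const k)).cost * ((unsat N P.C₀ w).card + 1) +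
        (K₁ * ((unsat N P.C₀ w).card + 1) + K₂ * ((unsat N P.C₀ w).card + 1)) := by ring
    rw [hring]
    refine (Runs.cond (B := K₁ * ((unsat N P.C₀ w).card + 1) + K₂ * ((unsat N P.C₀ w).card +
        1)) (fun hb => ?_) fun hb => ?_).mono
      (Nat.add_le_add_right hE _) fun _ h => h
    · simp only [Cond.Holds, Expr.eval, h12] at hb
      have hi0 : i = 0 := by omega
      subst hi0
      rw [List.getElem?_cons_zero, Option.some_inj] at hi
      subst hi
      refine (h₁ hMN h).mono (Nat.le_add_right _ _) ?_
      rintro τ ⟨w', h3, h4, h5⟩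
      rw [hz] at h5
      split_ifs at h5
      rw [Option.some_inj] at h5
      subst h5
      exact ⟨⟨_, h3⟩, by omega⟩
    · simp only [Cond.Holds, Expr.eval, h12] at hb
      obtain ⟨i, rfl⟩ : ∃ j, i = j + 1 := ⟨i - 1, by omega⟩
      rw [List.getElem?_cons_succ] at hi
      refine (h₂ hMN h hi (by omega) hz).mono (Nat.le_add_left _ _) ?_
      rintro τ ⟨h3, h4⟩
      exact ⟨h3, by omega⟩

/-- Every trial ends by returning to `w`, so each of the boundedly many runs starts with the same
`|U|` and costs a constant times `|U| + 1`. -/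
theorem deepCmd_runs (hP : P.Valid) :
    ∃ K, ∀ {n m : ℕ} {M : Fin n → Fin P.c → Fin m} {N : Fin m → Fin P.d → Fin n}
      {x y w : Word n} {σ : State} {B : ℕ}, Linked M N → Rep M N P.C₀ x y w B σ →
      Runs ![P.α, P.γ] (deepCmd P) σ (K * ((unsat N P.C₀ w).card + 1)) fun τ =>
        ∃ y' w' B', Rep M N P.C₀ x y' w' B' τ ∧
          (unsat N P.C₀ w').card ≤ K * ((unsat N P.C₀ w).card + 1) ∧
          deepFlip P N w = if τ.reg 12 = 0 then none else some w' := by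
  set l := seqs P.guesses P.s with hl
  have hmem : ∀ qs ∈ l, ∀ q ∈ qs, q ∈ P.guesses := fun qs hqs => (mem_seqs.1 hqs).2
  obtain ⟨K₁, h₁⟩ := scanCmd_runs hP l l 0 rfl hmem
  obtain ⟨K₂, h₂⟩ := pickCmd_runs hP l 1 hmem
  obtain ⟨K₃, h₃⟩ := pickCmd_runs_of_lt (P := P) (ρ := ![P.α, P.γ]) l 1
  let init : Cmd := .seq (.assign 3 (.const 0)) (.seq (.assign 11 (.add (.reg 1) (.const 1)))
    (.assign 12 (.const 0)))
  refine ⟨init.wc + (K₁ + (K₂ + K₃)) + 1, fun {n m M N x y w σ B} hMN h => ?_⟩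
  have hring : (init.wc + (K₁ + (K₂ + K₃)) + 1) * ((unsat N P.C₀ w).card + 1) =
    init.wc * ((unsat N P.C₀ w).card + 1) + (K₁ * ((unsat N P.C₀ w).card + 1) +
        (K₂ * ((unsat N P.C₀ w).card + 1) + K₃ * ((unsat N P.C₀ w).card + 1))) +
        ((unsat N P.C₀ w).card + 1) := by ring
  have hK₃ : K₃ ≤ K₃ * ((unsat N P.C₀ w).card + 1) := Nat.le_mul_of_pos_right _ (by omega)
  have hinit : init.wc ≤ init.wc * ((unsat N P.C₀ w).card + 1) :=
      Nat.le_mul_of_pos_right _ (by omega)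
  rw [hring]
  set τ₁ := ((σ.setReg 3 0).setReg 11 (m + 1)).setReg 12 0 with hτ₁
  refine Runs.mono (Runs.seq (C := K₁ * ((unsat N P.C₀ w).card + 1) +
      (K₂ * ((unsat N P.C₀ w).card + 1) + K₃ * ((unsat N P.C₀ w).card + 1)))
    (Runs.of_sem (p := init) ⟨trivial, trivial, trivial⟩ (Q := fun τ => τ = τ₁)
      (by simp [init, h.base.reg_m, hτ₁])) ?_) (by omega) fun _ h => h
  rintro _ rfl
  -- Emptying the log makes the current word the target of the undoing.
  have hrep : Rep M N P.C₀ x w w 0 τ₁ := by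
    refine ⟨?_, ?_, h.votes, [], by simp [hτ₁], trivial, rfl, le_rfl⟩
    · apply h.base.congr <;> simp [hτ₁]
    · apply h.set.congr <;> simp [hτ₁]
  have hbest : BestRep P N w l (m + 1, none) τ₁ := ⟨by simp [hτ₁], Or.inl ⟨rfl, by simp [hτ₁]⟩⟩
  refine Runs.seq (h₁ hMN hrep hbest) ?_
  rintro τ ⟨hτ, -, ⟨h5, h6⟩ | ⟨z, k, qs, h5, h6, h7, h8⟩⟩
  · refine (h₃ (σ := τ) (by omega)).mono (by omega) ?_
    rintro _ rfl
    refine ⟨w, w, 0, hτ, by omega, ?_⟩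
    rw [if_pos h6, deepFlip, ← hl, h5]
  · refine (h₂ hMN hτ h7 (by omega) h8).frame.mono (by omega) ?_
    rintro υ ⟨⟨⟨B', h9⟩, h10⟩, hr, -⟩
    refine ⟨w, z, B', h9, by omega, ?_⟩
    rw [hr 12 (pickCmd_keepsReg (by simp) (by simp) _ _), if_neg (by omega), deepFlip, ← hl, h5]

end Deep

end Tanner

namespace Tanner

open RAM

/-! ### The rounds of `MainDecode` as a program -/

/-- Store the product of the registers `2` and `14` in register `16`. -/
def accCmd : Cmd :=
  .seq (.seq (.assign 16 (.const 0)) (.assign 5 (.reg 2)))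
    (.loop (.lt (.const 0) (.reg 5))
      (.seq (.assign 5 (.sub (.reg 5) (.const 1))) (.assign 16 (.add (.reg 16) (.reg 14)))))

/-- A round of `MainDecode`; register `14` holds a power of two, register `15` is `1` if the
sequence has been abandoned. -/
noncomputable def roundCmd (P : Params) : Cmd :=
  .cond (.eq (.reg 15) (.const 0))
    (.seq (deepCmd P)
      (.cond (.eq (.reg 12) (.const 0)) (.assign 15 (.const 1))
        (.seq accCmd
          (.cond (.scaledLt 1 (.mulc P.c (.reg 0)) (.reg 16)) (.assign 15 (.const 1)) .skip))))
    .skip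

/-- All rounds of `MainDecode`. -/
noncomputable def roundsCmd (P : Params) : Cmd :=
  .seq (.seq (.assign 14 (.const 2)) (.assign 15 (.const 0)))
    (.loop (.ltScaled (.reg 14) 1 (.mulc 4 (.reg 0)))
      (.seq (roundCmd P) (.assign 14 (.add (.reg 14) (.reg 14)))))

section Rounds

variable {P : Params}

/-- `i ≤ ⌈log₂ (γ n)⌉ + 1` means `i - 2 < log₂ (γ n)`, that is `2 ^ i < 4 γ n`, so the machine
counts rounds without logarithms. For `i ≥ 1` the truncation at zero has no effect. -/
theorem Params.Valid.le_rounds_iff (hP : P.Valid) {n i : ℕ} (hn : 0 < n) (hi : 1 ≤ i) :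
    i ≤ P.rounds n ↔ (2 : ℝ) ^ i < P.γ * (4 * n) := by
  have hpos : 0 < P.γ * n := mul_pos hP.γ_pos (by exact_mod_cast hn)
  have h1 : i ≤ P.rounds n ↔ (i : ℤ) - 2 < ⌈Real.logb 2 (P.γ * n)⌉ := by
    rw [Params.rounds]; omega
  rw [h1, Int.lt_ceil, Real.lt_logb_iff_rpow_lt one_lt_two hpos]
  push_cast
  rw [Real.rpow_sub two_pos, Real.rpow_natCast, div_lt_iff₀ (by positivity)]
  have : P.γ * n * (2 : ℝ) ^ (2 : ℝ) = P.γ * (4 * n) := by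
    rw [show ((2 : ℝ) ^ (2 : ℝ)) = 4 by norm_num]; ring
  rw [this]

/-- Crude, but sufficient to pay for the constant overhead of each round. -/
theorem Params.Valid.rounds_le (hP : P.Valid) {n : ℕ} (hn : 0 < n) : P.rounds n ≤ 4 * n := by
  rcases Nat.eq_zero_or_pos (P.rounds n) with h | h
  · omega
  · have h1 := (hP.le_rounds_iff hn h).1 le_rfl
    have h2 : P.γ * (4 * n) ≤ 4 * n := mul_le_of_le_one_left (by positivity) hP.γ_le_one
    have h3 : 2 ^ P.rounds n < 4 * n := by exact_mod_cast h1.trans_le h2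
    exact (Nat.lt_two_pow_self.trans h3).le

/-- The memory holds the received word `x`, and the current word `w` unless the sequence has been
abandoned. -/
def RoundRep {n m : ℕ} (M : Fin n → Fin P.c → Fin m) (N : Fin m → Fin P.d → Fin n)
    (x : Word n) (o : Option (Word n)) (σ : State) : Prop :=
  ∃ y w B, Rep M N P.C₀ x y w B σ ∧
    ((σ.reg 15 = 0 ∧ o = some w) ∨ (σ.reg 15 = 1 ∧ o = none))

theorem Rep.setReg {n m : ℕ} {M : Fin n → Fin P.c → Fin m} {N : Fin m → Fin P.d → Fin n}
    {x y w : Word n} {B r k : ℕ} {σ : State} (h : Rep M N P.C₀ x y w B σ) (hr : 3 < r) :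
    Rep M N P.C₀ x y w B (σ.setReg r k) := by
  refine h.congr le_rfl (fun s hs => ?_) rfl
  rw [State.setReg_reg, if_neg (by omega)]

/-- Multiplication by repeated addition, with `|U|` and not the power of two as the counter. This
keeps its cost within that of `DeepFlip`. -/
theorem accCmd_runs {ρ : Fin 2 → ℝ} {σ : State} :
    Runs ρ accCmd σ (accCmd.wc * (σ.reg 2 + 1)) fun τ =>
      τ.reg 16 = σ.reg 2 * σ.reg 14 ∧ τ.mem = σ.mem ∧
        ∀ r, r ≠ 5 → r ≠ 16 → τ.reg r = σ.reg r := by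
  let I : ℕ → State → Prop := fun k τ => τ.reg 5 = k ∧ k ≤ σ.reg 2 ∧ τ.reg 14 = σ.reg 14 ∧
    τ.reg 16 = (σ.reg 2 - k) * σ.reg 14
  have hrun : Runs ρ accCmd σ (accCmd.wc * (σ.reg 2 + 1)) (I 0) := by
    refine Runs.mono (Runs.seq (Runs.of_sem (by exact ⟨trivial, trivial⟩)
      (Q := fun τ => τ = (σ.setReg 16 0).setReg 5 (σ.reg 2)) (by simp))
      (C := (Cmd.loop (.lt (.const 0) (.reg 5)) (.seq (.assign 5 (.sub (.reg 5) (.const 1)))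
        (.assign 16 (.add (.reg 16) (.reg 14))))).wc * (σ.reg 2 + 1)) ?_) ?_ fun _ h => h
    · rintro _ rfl
      refine Runs.loop_sem (I := I) (k := σ.reg 2) (by exact ⟨trivial, trivial⟩) ?_ ?_ ?_
      · rintro k τ ⟨h5, hk, h14, h16⟩
        refine ⟨by simp [h5], by simp [h5], by omega, by simp [h14], ?_⟩
        obtain ⟨a, ha⟩ : ∃ a, σ.reg 2 = k + 1 + a := ⟨_, (Nat.add_sub_of_le hk).symm⟩
        simp only [Cmd.sem, Expr.eval, State.setReg_reg, if_true, h16, h14, ha]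
        rw [if_neg (by simp), if_neg (by simp), Nat.add_sub_cancel_left,
          show k + 1 + a - k = a + 1 by omega, Nat.succ_mul]
      · rintro τ ⟨h5, -⟩
        simp [h5]
      · exact ⟨by simp, le_rfl, by simp, by simp⟩
    · have := Nat.le_mul_of_pos_right (Cmd.seq (.assign 16 (.const 0)) (.assign 5 (.reg 2))).wc
        (Nat.succ_pos (σ.reg 2))
      exact (Nat.add_le_add_right this _).trans_eq (Nat.add_mul _ _ _).symm
  refine hrun.frame.mono le_rfl ?_
  rintro τ ⟨⟨-, -, -, h16⟩, hr, hm⟩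
  refine ⟨by simpa using h16, ?_, fun r h5 hr16 => hr r ?_⟩
  · funext A
    exact hm A (by simp [accCmd])
  · simp [accCmd, h5, hr16]

/-- The test is cleared of its denominator: `γ (c n) < |U| * 2 ^ i`. A word that passes satisfies
`|U| * 2 ^ i ≤ c n` because `γ ≤ 1`; doubled, this is the bound needed for the time of round `i +
1`. -/
theorem roundCmd_runs (hP : P.Valid) :
    ∃ K, ∀ {n m : ℕ} {M : Fin n → Fin P.c → Fin m} {N : Fin m → Fin P.d → Fin n}
      {x y w : Word n} {σ : State} {B i : ℕ}, Linked M N → Rep M N P.C₀ x y w B σ →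
      σ.reg 15 = 0 → σ.reg 14 = 2 ^ i →
      Runs ![P.α, P.γ] (roundCmd P) σ (K * ((unsat N P.C₀ w).card + 1)) fun τ =>
        RoundRep M N x (mainRound P N (some w) i) τ ∧
          (∀ w', mainRound P N (some w) i = some w' →
            (unsat N P.C₀ w').card * 2 ^ (i + 1) ≤ 2 * P.c * n) ∧ τ.reg 14 = 2 ^ i := by
  obtain ⟨K, hK⟩ := deepCmd_runs hP
  let last : Cmd := .cond (.scaledLt 1 (.mulc P.c (.reg 0)) (.reg 16)) (.assign 15 (.const 1)) .skip
  let abort : Cmd := .assign 15 (.const 1)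
  refine ⟨(Cond.eq (.reg 15) (.const 0)).cost + K + (Cond.eq (.reg 12) (.const 0)).cost + abort.wc +
    accCmd.wc * (K + 1) + last.wc, fun {n m M N x y w σ B i} hMN h h15 h14 => ?_⟩
  obtain ⟨u, hu⟩ : ∃ u, u = (unsat N P.C₀ w).card + 1 := ⟨_, rfl⟩
  have hK' := hK hMN h
  rw [← hu] at hK' ⊢
  refine Runs.mono (Runs.cond (B := K * u + ((Cond.eq (.reg 12) (.const 0)).cost + (abort.wc +
    (accCmd.wc * (K * u + 1) + last.wc)))) (fun _ => ?_) fun hb => absurd (by simpa using h15) hb)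
    ?_ fun _ h => h
  swap
  · have hu1 : 1 ≤ u := by omega
    have h1 : accCmd.wc * (K * u + 1) ≤ accCmd.wc * (K + 1) * u := by
      rw [mul_assoc]
      refine Nat.mul_le_mul_left _ ?_
      rw [Nat.add_mul]; omega
    have h2 : ∀ a : ℕ, a ≤ a * u := fun a => Nat.le_mul_of_pos_right _ hu1
    have h3 := h2 (Cond.eq (.reg 15) (.const 0)).cost
    have h4 := h2 (Cond.eq (.reg 12) (.const 0)).cost
    have h5 := h2 abort.wc
    have h6 := h2 last.wc
    simp only [Nat.add_mul]
    omega
  refine Runs.seq hK'.frame ?_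
  rintro τ ⟨⟨y', w', B', hrep, hcard, hdeep⟩, hr, -⟩
  have h14' : τ.reg 14 = 2 ^ i := by rw [hr 14 (deepCmd_keepsReg (by simp)), h14]
  have h15' : τ.reg 15 = 0 := by rw [hr 15 (deepCmd_keepsReg (by simp)), h15]
  refine Runs.cond (fun hb => ?_) fun hb => ?_
  · have h12 : τ.reg 12 = 0 := by simpa using hb
    rw [if_pos h12] at hdeep
    have hround : mainRound P N (some w) i = none := by
      rw [mainRound, Option.bind_some, hdeep]
    rw [hround]
    refine (Runs.of_sem (p := abort) trivial (Q := fun υ => υ = τ.setReg 15 1) rfl).mono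
      (by omega) ?_
    rintro _ rfl
    exact ⟨⟨y', w', B', hrep.setReg (by simp), Or.inr ⟨by simp, rfl⟩⟩, by simp, by simpa using h14'⟩
  · have h12 : τ.reg 12 ≠ 0 := by simpa using hb
    rw [if_neg h12] at hdeep
    have hacc := accCmd_runs (ρ := ![P.α, P.γ]) (σ := τ)
    rw [hrep.set.card, h14'] at hacc
    refine Runs.mono (Runs.seq (C := last.wc) hacc ?_) ?_ fun _ h => h
    swap
    · have : accCmd.wc * ((unsat N P.C₀ w').card + 1) ≤ accCmd.wc * (K * u + 1) :=
        Nat.mul_le_mul_left _ (by omega)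
      omega
    rintro υ ⟨h16, hm, hr'⟩
    have hrep' : Rep M N P.C₀ x y' w' B' υ :=
      hrep.congr le_rfl (fun r hr => hr' r (by omega) (by omega)) hm
    have hcond : (Cond.scaledLt 1 (.mulc P.c (.reg 0)) (.reg 16)).Holds ![P.α, P.γ] υ ↔
        (P.c : ℝ) * ((2 : ℝ) ^ i)⁻¹ * P.γ * n < ((unsat N P.C₀ w').card : ℝ) := by
      simp only [Cond.Holds, Expr.eval_mulc, Expr.eval, hrep'.base.reg_n, h16]
      push_cast
      rw [show (P.c : ℝ) * ((2 : ℝ) ^ i)⁻¹ * P.γ * n = P.γ * (P.c * n) / 2 ^ i by ring,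
        div_lt_iff₀ (by positivity)]
    refine Runs.of_sem (by exact ⟨trivial, trivial⟩) ?_
    by_cases hc : (Cond.scaledLt 1 (.mulc P.c (.reg 0)) (.reg 16)).Holds ![P.α, P.γ] υ
    · have hround : mainRound P N (some w) i = none := by
        rw [mainRound, Option.bind_some, hdeep]
        exact if_pos (hcond.1 hc)
      rw [Cmd.sem, if_pos hc, hround]
      refine ⟨⟨y', w', B', hrep'.setReg (by simp), Or.inr ⟨by simp, rfl⟩⟩, by simp, ?_⟩
      simp [hr', h14']
    · have hround : mainRound P N (some w) i = some w' := by
        rw [mainRound, Option.bind_some, hdeep]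
        exact if_neg (mt hcond.2 hc)
      rw [Cmd.sem, if_neg hc, hround]
      refine ⟨⟨y', w', B', hrep', Or.inl ⟨?_, rfl⟩⟩, ?_, ?_⟩
      · simp [hr', h15']
      · intro z hz
        rw [Option.some_inj] at hz
        subst hz
        have h1 := not_lt.1 (mt hcond.2 hc)
        rw [show (P.c : ℝ) * ((2 : ℝ) ^ i)⁻¹ * P.γ * n = P.γ * (P.c * n) / 2 ^ i by ring,
          le_div_iff₀ (by positivity)] at h1
        have h2 : P.γ * (P.c * n) ≤ P.c * n := mul_le_of_le_one_left (by positivity) hP.γ_le_one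
        have h3 : (unsat N P.C₀ w').card * 2 ^ i ≤ P.c * n := by exact_mod_cast h1.trans h2
        rw [pow_succ, ← mul_assoc, mul_comm _ 2, mul_assoc]
        exact Nat.mul_le_mul_left _ h3
      · simp [hr', h14']

/-- Before round `i`, `|U|` is at most `2 c n / 2 ^ i`. The potential `2 (2 c n) / 2 ^ i` bounds the
rest of the geometric series, and `k + 1` pays for the constant overhead, including that of the
rounds after abandonment. -/
theorem roundsLoop_runs (hP : P.Valid) :
    ∃ K, ∀ {n m : ℕ} {M : Fin n → Fin P.c → Fin m} {N : Fin m → Fin P.d → Fin n}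
      {x : Word n}, 0 < n → Linked M N → ∀ (k i : ℕ) (σ : State) (o : Option (Word n)),
      P.rounds n + 1 = i + k → 1 ≤ i → RoundRep M N x o σ → σ.reg 14 = 2 ^ i →
      (∀ w, o = some w → (unsat N P.C₀ w).card * 2 ^ i ≤ 2 * P.c * n) →
      Runs ![P.α, P.γ] (.loop (.ltScaled (.reg 14) 1 (.mulc 4 (.reg 0)))
        (.seq (roundCmd P) (.assign 14 (.add (.reg 14) (.reg 14))))) σ
        (K * (2 * (2 * P.c * n) / 2 ^ i + k + 1)) fun τ =>
          RoundRep M N x ((List.range' i k).foldl (mainRound P N) o) τ := by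
  obtain ⟨K, hK⟩ := roundCmd_runs hP
  let bc := (Cond.ltScaled (.reg 14) 1 (.mulc 4 (.reg 0))).cost
  let E := (Cond.eq (.reg 15) (.const 0)).cost + 1
  let A := (Cmd.assign 14 (.add (.reg 14) (.reg 14))).wc
  refine ⟨K + bc + E + A, fun {n m M N x} hn hMN k => ?_⟩
  have hholds : ∀ {σ : State} {i : ℕ} {o : Option (Word n)}, RoundRep M N x o σ →
      σ.reg 14 = 2 ^ i → ((Cond.ltScaled (.reg 14) 1 (.mulc 4 (.reg 0))).Holds ![P.α, P.γ] σ ↔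
        (2 : ℝ) ^ i < P.γ * (4 * n)) := by
    rintro σ i o ⟨y, w, B, hrep, -⟩ h14
    simp only [Cond.Holds, Expr.eval_mulc, Expr.eval, h14, hrep.base.reg_n]
    push_cast
    rfl
  induction k with
  | zero =>
    intro i σ o hik hi hr h14 _
    have hnot : ¬ (Cond.ltScaled (.reg 14) 1 (.mulc 4 (.reg 0))).Holds ![P.α, P.γ] σ := by
      rw [hholds hr h14, ← hP.le_rounds_iff hn hi]
      omega
    refine (Runs.loop_done hnot (by simpa using hr)).mono ?_ fun _ h => h
    refine le_trans ?_ (Nat.le_mul_of_pos_right _ (Nat.succ_pos _))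
    omega
  | succ k ih =>
    intro i σ o hik hi hr h14 ho
    have hb : (Cond.ltScaled (.reg 14) 1 (.mulc 4 (.reg 0))).Holds ![P.α, P.γ] σ := by
      rw [hholds hr h14, ← hP.le_rounds_iff hn hi]
      omega
    -- Rounding down does no harm: the potential is at least `2 a` now and exactly `a` in the next
    -- round, which leaves `a` for the present one.
    set a := 2 * P.c * n / 2 ^ i with ha
    have h2a : 2 * (2 * P.c * n) / 2 ^ (i + 1) = a := by
      rw [pow_succ, mul_comm (2 ^ i) 2, Nat.mul_div_mul_left _ _ two_pos]
    have h2a' : 2 * a ≤ 2 * (2 * P.c * n) / 2 ^ i := Nat.mul_div_le_mul_div_assoc _ _ _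
    have hround : Runs ![P.α, P.γ] (roundCmd P) σ (K * (a + 1) + E) fun τ =>
        RoundRep M N x (mainRound P N o i) τ ∧ (∀ w', mainRound P N o i = some w' →
            (unsat N P.C₀ w').card * 2 ^ (i + 1) ≤ 2 * P.c * n) ∧ τ.reg 14 = 2 ^ i := by
      obtain ⟨y, w, B, hrep, ⟨h15, rfl⟩ | ⟨h15, rfl⟩⟩ := hr
      · refine (hK hMN hrep h15 h14).mono ?_ fun _ h => h
        have h1 : (unsat N P.C₀ w).card ≤ a := by
          rw [ha, Nat.le_div_iff_mul_le (by positivity)]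
          exact ho w rfl
        exact (Nat.mul_le_mul_left _ (by omega)).trans (Nat.le_add_right _ _)
      · have hnone : mainRound P N none i = none := by rw [mainRound]; rfl
        rw [hnone]
        refine Runs.mono (Runs.cond (B := 1) (fun hb => ?_) fun _ => ?_)
          (Nat.le_add_left _ _) fun _ h => h
        · simp [h15] at hb
        · exact Runs.of_sem (p := .skip) trivial
            ⟨⟨y, w, B, hrep, Or.inr ⟨h15, rfl⟩⟩, by simp, h14⟩
    refine Runs.mono (Runs.loop_step (B := K * (a + 1) + E + A)
      (C := (K + bc + E + A) * (2 * (2 * P.c * n) / 2 ^ (i + 1) + k + 1)) hb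
      (Q := fun τ => RoundRep M N x (mainRound P N o i) τ ∧
        (∀ w', mainRound P N o i = some w' →
            (unsat N P.C₀ w').card * 2 ^ (i + 1) ≤ 2 * P.c * n) ∧ τ.reg 14 = 2 ^ (i + 1))
      (Runs.seq hround ?_) ?_) ?_ fun _ h => h
    · rintro τ ⟨⟨y, w, B, hrep, hor⟩, h2, h3⟩
      refine Runs.of_sem trivial ⟨⟨y, w, B, hrep.setReg (by simp), ?_⟩, h2, ?_⟩
      · simpa using hor
      · simp [h3, pow_succ, mul_two]
    · rintro τ ⟨h1, h2, h3⟩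
      rw [List.range'_succ, List.foldl_cons]
      exact ih (i + 1) τ _ (by omega) (by omega) h1 h3 h2
    · rw [h2a]
      have h5 : K * (a + 1) + E + A + bc ≤ (K + bc + E + A) * (a + 1) := by
        have h6 := Nat.le_mul_of_pos_right (bc + E + A) (show 0 < a + 1 by omega)
        rw [show K + bc + E + A = K + (bc + E + A) by omega, Nat.add_mul K]
        omega
      have h7 := Nat.mul_le_mul_left (K + bc + E + A)
        (show a + 1 + (a + k + 1) ≤ 2 * (2 * P.c * n) / 2 ^ i + (k + 1) + 1 by omega)
      rw [Nat.mul_add] at h7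
      change bc + _ + _ ≤ _
      omega

theorem roundsCmd_runs (hP : P.Valid) :
    ∃ K, ∀ {n m : ℕ} {M : Fin n → Fin P.c → Fin m} {N : Fin m → Fin P.d → Fin n}
      {x y w : Word n} {σ : State} {B : ℕ}, 0 < n → m ≤ P.c * n → Linked M N →
      Rep M N P.C₀ x y w B σ →
      Runs ![P.α, P.γ] (roundsCmd P) σ (K * n) fun τ =>
        RoundRep M N x ((List.range' 1 (P.rounds n)).foldl (mainRound P N) (some w)) τ := by
  obtain ⟨K, hK⟩ := roundsLoop_runs hP
  let init : Cmd := .seq (.assign 14 (.const 2)) (.assign 15 (.const 0))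
  -- The initial potential is `2 c n`, there are at most `4 n` rounds, and one more `n` covers the
  -- final loop test.
  refine ⟨init.wc + K * (2 * P.c + 5), fun {n m M N x y w σ B} hn hm hMN h => ?_⟩
  set τ₁ := (σ.setReg 14 2).setReg 15 0 with hτ₁
  have hloop := hK (x := x) hn hMN (P.rounds n) 1 τ₁ (some w) (Nat.add_comm _ _) le_rfl
    ⟨y, w, B, (h.setReg (by simp)).setReg (by simp), Or.inl ⟨by simp [hτ₁], rfl⟩⟩ (by simp [hτ₁]) (by
      intro w' hw'
      rw [Option.some_inj] at hw'
      subst hw'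
      have := (Finset.card_le_univ (unsat N P.C₀ w)).trans_eq (Fintype.card_fin m)
      rw [pow_one, mul_comm, mul_assoc]
      exact Nat.mul_le_mul_left _ (this.trans hm))
  refine Runs.mono (Runs.seq (Runs.of_sem (p := init) ⟨trivial, trivial⟩ (Q := fun τ => τ = τ₁)
    (by simp [init, hτ₁])) (by rintro _ rfl; exact hloop)) ?_ fun _ h => h
  rw [show (init.wc + K * (2 * P.c + 5)) * n = init.wc * n + K * ((2 * P.c + 5) * n) by ring]
  refine Nat.add_le_add (Nat.le_mul_of_pos_right _ hn) (Nat.mul_le_mul_left _ ?_)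
  have h1 := hP.rounds_le hn
  rw [pow_one, Nat.mul_div_cancel_left _ two_pos, Nat.add_mul (2 * P.c)]
  omega

end Rounds

end Tanner

namespace Tanner

open RAM

/-! ### `MainDecode` as a program -/

/-- `DeterFlip` along a sequence of guesses. -/
noncomputable def flipsCmd (P : Params) : List ℝ → Cmd
  | [] => .skip
  | q :: qs => .seq (detCmd P (guessNum P q)) (flipsCmd P qs)

/-- Store the distance of the current word to the received word in register `16`. -/
def distCmd : Cmd :=
  .seq (.seq (.assign 16 (.const 0)) (.assign 5 (.reg 0)))
    (.loop (.lt (.const 0) (.reg 5))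
      (.seq (.assign 5 (.sub (.reg 5) (.const 1)))
        (.cond (.eq (.read 0 (.reg 5)) (.read 8 (.reg 5))) .skip
          (.assign 16 (.add (.reg 16) (.const 1))))))

/-- The final test of a sequence; register `17` is set to `1` if the current word is returned and to
`0` otherwise. -/
def testCmd : Cmd :=
  .seq (.assign 17 (.const 0))
    (.cond (.eq (.reg 15) (.const 0))
      (.cond (.eq (.reg 2) (.const 0))
        (.seq distCmd (.cond (.scaledLt 0 (.reg 0) (.reg 16)) .skip (.assign 17 (.const 1)))) .skip)
      .skip)

/-- One sequence of `MainDecode`. -/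
noncomputable def sequenceCmd (P : Params) (qs : List ℝ) : Cmd :=
  .seq (flipsCmd P qs) (.seq (roundsCmd P) testCmd)

/-- Restore the received word. -/
noncomputable def restoreCmd (P : Params) : Cmd :=
  .seq (.seq (.assign 3 (.const 0)) (.assign 5 (.reg 0)))
    (.loop (.lt (.const 0) (.reg 5))
      (.seq (.assign 5 (.sub (.reg 5) (.const 1)))
        (.cond (.eq (.read 0 (.reg 5)) (.read 8 (.reg 5))) .skip
          (.seq (.assign 6 (.reg 5)) (flipCmd P.c P.C₀)))))

/-- Try the sequences of a list until one of them leads to a return. -/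
noncomputable def searchCmd (P : Params) : List (List ℝ) → Cmd
  | [] => .assign 0 (.const 0)
  | qs :: l => .seq (sequenceCmd P qs)
      (.cond (.eq (.reg 17) (.const 0)) (.seq (restoreCmd P) (searchCmd P l))
        (.assign 0 (.const 1)))

/-- Copy the received word to array `8`. -/
def copyCmd : Cmd :=
  .seq (.assign 5 (.reg 0))
    (.loop (.lt (.const 0) (.reg 5))
      (.seq (.assign 5 (.sub (.reg 5) (.const 1))) (.write 8 (.reg 5) (.read 0 (.reg 5)))))

/-- Collect the unsatisfied checks of the received word. -/
noncomputable def collectCmd (P : Params) : Cmd :=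
  .seq (.assign 5 (.reg 1))
    (.loop (.lt (.const 0) (.reg 5))
      (.seq (.assign 5 (.sub (.reg 5) (.const 1)))
        (.seq (.assign 7 (.reg 5)) (checkCmd P.C₀))))

/-- The program for `MainDecode`. -/
noncomputable def mainCmd (P : Params) : Cmd :=
  .seq copyCmd (.seq (collectCmd P) (searchCmd P (seqs P.guesses P.r)))

theorem card_unsat_succ_le {n m c d : ℕ} {N : Fin m → Fin d → Fin n}
    {C : Submodule (ZMod 2) (Word d)} (hn : 0 < n) (hm : m ≤ c * n) (w : Word n) :
    (unsat N C w).card + 1 ≤ (c + 1) * n := by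
  have := (Finset.card_le_univ (unsat N C w)).trans_eq (Fintype.card_fin m)
  rw [Nat.add_mul]
  omega

section Main

variable {P : Params}

/-- There is no guard in this phase, so each of the boundedly many flips is charged through `|U| ≤ m
≤ c n`. -/
theorem flipsCmd_runs (hP : P.Valid) : ∀ qs : List ℝ, (∀ q ∈ qs, q ∈ P.guesses) →
    ∃ K, ∀ {n m : ℕ} {M : Fin n → Fin P.c → Fin m} {N : Fin m → Fin P.d → Fin n}
      {x y w : Word n} {σ : State} {B : ℕ}, 0 < n → m ≤ P.c * n → Linked M N →
      Rep M N P.C₀ x y w B σ →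
      Runs ![P.α, P.γ] (flipsCmd P qs) σ (K * n) fun τ =>
        ∃ B', Rep M N P.C₀ x y (qs.foldl (deterFlip P N) w) B' τ
  | [], _ => ⟨1, fun {n m M N x y w σ B} hn _ _ h =>
      (Runs.of_sem (p := .skip) trivial (Q := fun τ => ∃ B', Rep M N P.C₀ x y w B' τ)
        ⟨B, h⟩).mono (by rw [Cmd.wc]; omega) fun _ h => h⟩
  | q :: qs, hqs => by
    simp only [List.mem_cons, forall_eq_or_imp] at hqs
    obtain ⟨K, hK⟩ := flipsCmd_runs hP qs hqs.2
    refine ⟨(detCmd P (guessNum P q)).wc * (P.c + 1) + K, fun {n m M N x y w σ B} hn hm hMN h => ?_⟩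
    refine (Runs.seq (detCmd_runs hP hMN hqs.1 h) fun τ hτ => hK hn hm hMN hτ).mono ?_ fun _ h => h
    rw [Nat.add_mul, mul_assoc]
    exact Nat.add_le_add_right (Nat.mul_le_mul_left _ (card_unsat_succ_le hn hm w)) _

theorem distCmd_runs {ρ : Fin 2 → ℝ} {n m c d : ℕ} {M : Fin n → Fin c → Fin m}
    {N : Fin m → Fin d → Fin n} {x w : Word n} {σ : State} (h : Base M N x w σ) :
    Runs ρ distCmd σ (distCmd.wc * (n + 1)) fun τ => τ.reg 16 = hammingDist x w ∧
      τ.mem = σ.mem ∧ ∀ r, r ≠ 5 → r ≠ 16 → τ.reg r = σ.reg r := by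
  let S : ℕ → Finset (Fin n) := fun k => Finset.univ.filter fun i => k ≤ i ∧ x i ≠ w i
  let I : ℕ → State → Prop := fun k τ => τ.reg 5 = k ∧ k ≤ n ∧ τ.mem = σ.mem ∧
    τ.reg 16 = (S k).card
  have hrun : Runs ρ distCmd σ (distCmd.wc * (n + 1)) (I 0) := by
    refine Runs.init_loop (I := I) ⟨trivial, trivial⟩ ⟨trivial, trivial, trivial⟩ ?_ ?_ ?_
    · have : S n = ∅ := by
        refine Finset.filter_eq_empty_iff.2 fun i _ hi => ?_
        have := i.2
        omega
      refine ⟨by simp [h.reg_n], le_rfl, by simp, by simp [this]⟩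
    · rintro k τ ⟨h5, hk, hm, h16⟩
      have h0 : τ.mem 0 k = (w ⟨k, hk⟩).val := by rw [hm]; exact h.word ⟨k, hk⟩
      have h8 : τ.mem 8 k = (x ⟨k, hk⟩).val := by rw [hm]; exact h.copy ⟨k, hk⟩
      refine ⟨by simp [h5], ?_⟩
      by_cases hxw : x ⟨k, hk⟩ = w ⟨k, hk⟩
      · have hS : S k = S (k + 1) := by
          ext i
          simp only [S, Finset.mem_filter, Finset.mem_univ, true_and]
          refine ⟨fun hi => ⟨?_, hi.2⟩, fun hi => ⟨by omega, hi.2⟩⟩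
          rcases Nat.lt_or_eq_of_le hi.1 with hlt | heq
          · exact hlt
          · exact absurd (by have : i = ⟨k, hk⟩ := Fin.ext heq.symm
                             rw [this, hxw]) hi.2
        refine ⟨by simp [h5, h0, h8, hxw], by omega, by simp [h5, h0, h8, hxw, hm], ?_⟩
        simp [h5, h0, h8, hxw, h16, hS]
      · have hval : ¬ (w ⟨k, hk⟩).val = (x ⟨k, hk⟩).val := fun he =>
          hxw (ZMod.val_injective 2 he).symm
        have hS : S k = insert ⟨k, hk⟩ (S (k + 1)) := by
          ext i
          simp only [S, Finset.mem_insert, Finset.mem_filter, Finset.mem_univ, true_and]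
          constructor
          · intro hi
            rcases Nat.lt_or_eq_of_le hi.1 with hlt | heq
            · exact Or.inr ⟨hlt, hi.2⟩
            · exact Or.inl (Fin.ext heq.symm)
          · rintro (rfl | hi)
            · exact ⟨le_rfl, hxw⟩
            · exact ⟨by omega, hi.2⟩
        have hcard : (S k).card = (S (k + 1)).card + 1 := by
          rw [hS, Finset.card_insert_of_notMem]
          simp [S]
        refine ⟨by simp [h5, h0, h8, hval], by omega, by simp [h5, h0, h8, hval, hm], ?_⟩
        simp [h5, h0, h8, hval, h16, hcard]
    · rintro τ ⟨h5, -⟩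
      simp [h5]
  refine hrun.frame.mono le_rfl ?_
  rintro τ ⟨⟨-, -, hm, h16⟩, hr, -⟩
  refine ⟨?_, hm, fun r h5 hr16 => hr r ?_⟩
  · rw [h16, hammingDist]
    simp [S]
  · simp [distCmd, h5, hr16]

theorem testCmd_runs {n m : ℕ} {M : Fin n → Fin P.c → Fin m} {N : Fin m → Fin P.d → Fin n}
    {x : Word n} {o : Option (Word n)} {σ : State} (h : RoundRep M N x o σ) :
    Runs ![P.α, P.γ] testCmd σ (testCmd.wc * (n + 1)) fun τ =>
      ∃ y w B, Rep M N P.C₀ x y w B τ ∧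
        ((τ.reg 17 = 0 ∧ ∀ z, o = some z →
            ¬ ((unsat N P.C₀ z).card = 0 ∧ (hammingDist x z : ℝ) ≤ P.α * n)) ∨
          (τ.reg 17 = 1 ∧ o = some w ∧ (unsat N P.C₀ w).card = 0 ∧
            (hammingDist x w : ℝ) ≤ P.α * n)) := by
  obtain ⟨y, w, B, hrep, hor⟩ := h
  have hrep' : Rep M N P.C₀ x y w B (σ.setReg 17 0) := hrep.setReg (by simp)
  let last : Cmd := .cond (.scaledLt 0 (.reg 0) (.reg 16)) .skip (.assign 17 (.const 1))
  refine Runs.mono (Runs.seq (Runs.of_sem trivial (Q := fun τ => τ = σ.setReg 17 0) rfl)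
    (C := (Cond.eq (.reg 15) (.const 0)).cost + ((Cond.eq (.reg 2) (.const 0)).cost +
      (distCmd.wc * (n + 1) + last.wc))) ?_) ?_ fun _ h => h
  swap
  · have h1 : ∀ a : ℕ, a ≤ a * (n + 1) := fun a => Nat.le_mul_of_pos_right _ (Nat.succ_pos n)
    have h2 := h1 (Cmd.assign 17 (.const 0)).wc
    have h3 := h1 (Cond.eq (.reg 15) (.const 0)).cost
    have h4 := h1 (Cond.eq (.reg 2) (.const 0)).cost
    have h5 := h1 last.wc
    have h6 : (Cmd.assign 17 (.const 0)).wc + ((Cond.eq (.reg 15) (.const 0)).cost +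
        ((Cond.eq (.reg 2) (.const 0)).cost + (distCmd.wc + last.wc))) ≤ testCmd.wc :=
      Nat.add_le_add_left (Nat.add_le_add_left (le_trans (Nat.add_le_add_left (le_max_left _ _) _)
        (le_max_left _ _)) _) _
    refine le_trans ?_ (Nat.mul_le_mul_right (n + 1) h6)
    simp only [Nat.add_mul]
    omega
  have hskip : ∀ (D : ℕ), 1 ≤ D → (∀ z, o = some z →
      ¬ ((unsat N P.C₀ z).card = 0 ∧ (hammingDist x z : ℝ) ≤ P.α * n)) →
      Runs ![P.α, P.γ] .skip (σ.setReg 17 0) D fun τ => ∃ y w B, Rep M N P.C₀ x y w B τ ∧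
        ((τ.reg 17 = 0 ∧ ∀ z, o = some z →
            ¬ ((unsat N P.C₀ z).card = 0 ∧ (hammingDist x z : ℝ) ≤ P.α * n)) ∨
          (τ.reg 17 = 1 ∧ o = some w ∧ (unsat N P.C₀ w).card = 0 ∧
            (hammingDist x w : ℝ) ≤ P.α * n)) := fun D hD ho =>
    (Runs.of_sem (p := .skip) trivial ⟨y, w, B, hrep', Or.inl ⟨by simp, ho⟩⟩).mono hD fun _ h => h
  rintro _ rfl
  have hlast : 1 ≤ last.wc := by
    refine le_trans ?_ (Nat.le_add_right _ _)
    exact Nat.le_add_left _ _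
  refine Runs.cond (fun hb => ?_) fun hb => ?_
  · have h15 : σ.reg 15 = 0 := by simpa using hb
    have ho : o = some w := by
      rcases hor with h | h
      · exact h.2
      · omega
    refine Runs.cond (fun hb => ?_) fun hb => ?_
    · have hU : (unsat N P.C₀ w).card = 0 := by
        rw [← hrep.set.card]; simpa using hb
      refine Runs.seq (distCmd_runs hrep'.base) ?_
      rintro τ ⟨h16, hm, hr⟩
      have hrep'' : Rep M N P.C₀ x y w B τ :=
        hrep'.congr le_rfl (fun r hr' => hr r (by omega) (by omega)) hm
      have hcond : (Cond.scaledLt 0 (.reg 0) (.reg 16)).Holds ![P.α, P.γ] τ ↔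
          P.α * n < (hammingDist x w : ℝ) := by
        simp only [Cond.Holds, Expr.eval, h16, hrep''.base.reg_n]
        rfl
      refine Runs.of_sem (by exact ⟨trivial, trivial⟩) ?_
      by_cases hc : (Cond.scaledLt 0 (.reg 0) (.reg 16)).Holds ![P.α, P.γ] τ
      · rw [Cmd.sem, if_pos hc]
        refine ⟨y, w, B, hrep'', Or.inl ⟨?_, ?_⟩⟩
        · simp [hr]
        · intro z hz hcon
          rw [ho, Option.some_inj] at hz
          subst hz
          exact absurd (hcond.1 hc) (not_lt.2 hcon.2)
      · rw [Cmd.sem, if_neg hc]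
        exact ⟨y, w, B, hrep''.setReg (by simp), Or.inr ⟨by simp, ho, hU,
          not_lt.1 (mt hcond.2 hc)⟩⟩
    · refine hskip _ (by omega) fun z hz hcon => ?_
      rw [ho, Option.some_inj] at hz
      subst hz
      refine hb ?_
      simp [hrep.set.card, hcon.1]
  · have h15 : σ.reg 15 ≠ 0 := by simpa using hb
    refine hskip _ (by omega) fun z hz => ?_
    rcases hor with h | h
    · exact absurd h.1 h15
    · rw [h.2] at hz; simp at hz

theorem sequenceCmd_runs (hP : P.Valid) (qs : List ℝ) (hqs : ∀ q ∈ qs, q ∈ P.guesses) :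
    ∃ K, ∀ {n m : ℕ} {M : Fin n → Fin P.c → Fin m} {N : Fin m → Fin P.d → Fin n}
      {x y : Word n} {σ : State} {B : ℕ}, 0 < n → m ≤ P.c * n → Linked M N →
      Rep M N P.C₀ x y x B σ →
      Runs ![P.α, P.γ] (sequenceCmd P qs) σ (K * n) fun τ =>
        ∃ y w B, Rep M N P.C₀ x y w B τ ∧
          mainBranch P N x qs = if τ.reg 17 = 0 then none else some w := by
  obtain ⟨K₁, h₁⟩ := flipsCmd_runs hP qs hqs
  obtain ⟨K₂, h₂⟩ := roundsCmd_runs hP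
  refine ⟨K₁ + (K₂ + testCmd.wc * 2), fun {n m M N x y σ B} hn hm hMN h => ?_⟩
  refine Runs.mono (Runs.seq (h₁ hn hm hMN h) (C := K₂ * n + testCmd.wc * (n + 1)) ?_) ?_
    fun _ h => h
  swap
  · rw [Nat.add_mul, Nat.add_mul, mul_assoc]
    exact Nat.add_le_add_left (Nat.add_le_add_left (Nat.mul_le_mul_left _ (by omega)) _) _
  rintro τ ⟨B', hτ⟩
  refine Runs.seq (h₂ hn hm hMN hτ) fun υ hυ => (testCmd_runs hυ).mono le_rfl ?_
  rintro φ ⟨y', w', B'', h3, ⟨h17, h4⟩ | ⟨h17, h4, h5, h6⟩⟩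
  · refine ⟨y', w', B'', h3, ?_⟩
    rw [if_pos h17, mainBranch]
    split
    · rfl
    · next z hz => exact if_neg (h4 z hz)
  · refine ⟨y', w', B'', h3, ?_⟩
    rw [if_neg (by omega), mainBranch, h4]
    exact if_pos ⟨h5, h6⟩

/-- `deepCmd` empties the log, so the log need not lead back to the received word. Flipping the bits
that differ from the copy also restores the set of unsatisfied checks. -/
theorem restoreCmd_runs {ρ : Fin 2 → ℝ} {n m : ℕ} {M : Fin n → Fin P.c → Fin m}
    {N : Fin m → Fin P.d → Fin n} {x y w : Word n} {σ : State} {B : ℕ} (hMN : Linked M N)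
    (h : Rep M N P.C₀ x y w B σ) :
    Runs ρ (restoreCmd P) σ ((restoreCmd P).wc * (n + 1)) fun τ =>
      Rep M N P.C₀ x x x 0 τ := by
  let I : ℕ → State → Prop := fun k τ => τ.reg 5 = k ∧ k ≤ n ∧ τ.reg 3 = 0 ∧
    (∀ i : Fin n, τ.mem 5 i = 0) ∧ ∃ w : Word n, Base M N x w τ ∧ SetRep (unsat N P.C₀ w) τ ∧
      ∀ i : Fin n, k ≤ i → w i = x i
  refine (Runs.init_loop (I := I) (by exact ⟨trivial, trivial⟩)
    (by exact ⟨trivial, trivial, trivial, flipCmd_loopFree⟩)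
    ?_ ?_ ?_).mono le_rfl ?_
  · refine ⟨by simp [h.base.reg_n], le_rfl, by simp, h.votes, w, ?_, ?_, fun i hi => ?_⟩
    · apply h.base.congr <;> simp
    · apply h.set.congr <;> simp
    · have := i.2; omega
  · rintro k τ ⟨h5, hk, h3, hv, w, hb, hU, hw⟩
    have h0 : τ.mem 0 k = (w ⟨k, hk⟩).val := hb.word ⟨k, hk⟩
    have h8 : τ.mem 8 k = (x ⟨k, hk⟩).val := hb.copy ⟨k, hk⟩
    refine ⟨by simp [h5], ?_⟩
    by_cases hwx : w ⟨k, hk⟩ = x ⟨k, hk⟩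
    · have hsem : ∀ q : Cmd, (Cmd.seq (.assign 5 (.sub (.reg 5) (.const 1)))
        (.cond (.eq (.read 0 (.reg 5)) (.read 8 (.reg 5))) .skip
          (.seq (.assign 6 (.reg 5)) q))).sem ρ τ = τ.setReg 5 k := by
        intro q
        simp [h5, h0, h8, hwx]
      rw [hsem]
      refine ⟨by simp, by omega, by simp [h3], hv, w, ?_, ?_, fun i hi => ?_⟩
      · apply hb.congr <;> simp
      · apply hU.congr <;> simp
      · rcases Nat.lt_or_eq_of_le hi with hlt | heq
        · exact hw i hlt
        · have : i = ⟨k, hk⟩ := Fin.ext heq.symm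
          rw [this, hwx]
    · have hval : ¬ (w ⟨k, hk⟩).val = (x ⟨k, hk⟩).val := fun he => hwx (ZMod.val_injective 2 he)
      have hsem : ∀ q : Cmd, (Cmd.seq (.assign 5 (.sub (.reg 5) (.const 1)))
        (.cond (.eq (.read 0 (.reg 5)) (.read 8 (.reg 5))) .skip
          (.seq (.assign 6 (.reg 5)) q))).sem ρ τ = q.sem ρ ((τ.setReg 5 k).setReg 6 k) := by
        intro q
        simp [h5, h0, h8, hval]
      rw [hsem]
      set τ₁ := (τ.setReg 5 k).setReg 6 k with hτ₁
      have hb₁ : Base M N x w τ₁ := by apply hb.congr <;> simp [hτ₁]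
      have hU₁ : SetRep (unsat N P.C₀ w) τ₁ := by apply hU.congr <;> simp [hτ₁]
      obtain ⟨hb₂, hU₂⟩ := flipCmd_sem (ρ := ρ) hMN hb₁ hU₁ (i := ⟨k, hk⟩) (by simp [hτ₁])
      have hkeep : ∀ r, r = 3 ∨ r = 5 → ((flipCmd P.c P.C₀).sem ρ τ₁).reg r = τ₁.reg r :=
        fun r hr => Cmd.sem_reg flipCmd_loopFree
          (flipCmd_keepsReg (by omega) (by omega) (by omega) (by omega)) _
      refine ⟨?_, by omega, ?_, ?_, flipAt w ⟨k, hk⟩, hb₂, hU₂, fun i hi => ?_⟩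
      · rw [hkeep 5 (by simp)]; simp [hτ₁]
      · rw [hkeep 3 (by simp)]; simp [hτ₁, h3]
      · rw [Cmd.sem_mem flipCmd_loopFree (flipCmd_keepsMem (by simp) (by simp) (by simp))]
        exact hv
      · by_cases hik : i = ⟨k, hk⟩
        · subst hik
          rw [flipAt, Function.update_self, add_one_eq_of_ne hwx]
        · rw [flipAt_of_ne _ hik]
          refine hw i (Nat.lt_of_le_of_ne hi fun he => hik (Fin.ext he.symm))
  · rintro τ ⟨h5, -⟩
    simp [h5]
  · rintro τ ⟨-, -, h3, hv, w, hb, hU, hw⟩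
    have : w = x := funext fun i => hw i (Nat.zero_le _)
    subst this
    exact ⟨hb, hU, hv, [], h3, trivial, rfl, le_rfl⟩

/-- The number of sequences does not depend on `n`, so linear time per sequence, restoration
included, is affordable. -/
theorem searchCmd_runs (hP : P.Valid) : ∀ l : List (List ℝ),
    (∀ qs ∈ l, ∀ q ∈ qs, q ∈ P.guesses) →
    ∃ K, ∀ {n m : ℕ} {M : Fin n → Fin P.c → Fin m} {N : Fin m → Fin P.d → Fin n}
      {x y : Word n} {σ : State} {B : ℕ}, 0 < n → m ≤ P.c * n → Linked M N →
      Rep M N P.C₀ x y x B σ →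
      Runs ![P.α, P.γ] (searchCmd P l) σ (K * n) fun τ =>
        IsOutput τ (l.findSome? (mainBranch P N x))
  | [], _ => ⟨2, fun {n m M N x y σ B} hn _ _ _ =>
      (Runs.of_sem (p := .assign 0 (.const 0)) trivial (Q := fun τ => τ.reg 0 = 0)
        (by simp)).mono (by simp only [Cmd.wc, Expr.cost]; omega) fun _ h => h⟩
  | qs :: l, hl => by
    simp only [List.mem_cons, forall_eq_or_imp] at hl
    obtain ⟨K₁, h₁⟩ := sequenceCmd_runs hP qs hl.1
    obtain ⟨K₂, h₂⟩ := searchCmd_runs hP l hl.2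
    refine ⟨K₁ + ((Cond.eq (.reg 17) (.const 0)).cost + ((restoreCmd P).wc * 2 + K₂ + 2)),
      fun {n m M N x y σ B} hn hm hMN h => ?_⟩
    refine Runs.mono (Runs.seq (h₁ hn hm hMN h) (C := (Cond.eq (.reg 17) (.const 0)).cost +
      ((restoreCmd P).wc * (n + 1) + K₂ * n + 2)) ?_) ?_ fun _ h => h
    swap
    · have h3 : (restoreCmd P).wc * (n + 1) ≤ (restoreCmd P).wc * 2 * n := by
        rw [mul_assoc]; exact Nat.mul_le_mul_left _ (by omega)
      have h4 : (Cond.eq (.reg 17) (.const 0)).cost ≤ (Cond.eq (.reg 17) (.const 0)).cost * n :=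
        Nat.le_mul_of_pos_right _ hn
      simp only [Nat.add_mul]
      omega
    rintro τ ⟨y', w, B', hrep, hbr⟩
    refine Runs.cond (fun hb => ?_) fun hb => ?_
    · rw [if_pos (by simpa using hb)] at hbr
      rw [List.findSome?_cons, hbr]
      exact (Runs.seq (restoreCmd_runs hMN hrep) fun υ hυ => h₂ hn hm hMN hυ).mono
        (Nat.le_add_right _ _) fun _ h => h
    · rw [if_neg (by simpa using hb)] at hbr
      rw [List.findSome?_cons, hbr]
      refine (Runs.of_sem (p := .assign 0 (.const 1)) trivial ?_).mono
        (Nat.le_add_left _ _) fun _ h => h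
      exact ⟨by simp, fun i => by simpa using hrep.base.word i⟩

end Main

theorem copyCmd_runs {ρ : Fin 2 → ℝ} {n : ℕ} {σ : State} (hn : σ.reg 0 = n) :
    Runs ρ copyCmd σ (copyCmd.wc * (n + 1)) fun τ =>
      (∀ i < n, τ.mem 8 i = σ.mem 0 i) ∧ (∀ r, r ≠ 5 → τ.reg r = σ.reg r) ∧
        ∀ A, A ≠ 8 → τ.mem A = σ.mem A := by
  let I : ℕ → State → Prop := fun k τ => τ.reg 5 = k ∧ τ.mem 0 = σ.mem 0 ∧
    ∀ i, k ≤ i → i < n → τ.mem 8 i = σ.mem 0 i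
  refine (Runs.init_loop (I := I) (k := n) (by exact trivial) (by exact ⟨trivial, trivial⟩)
    ?_ ?_ ?_).frame.mono le_rfl ?_
  · exact ⟨by simp [hn], by simp, fun i h1 h2 => by omega⟩
  · rintro k τ ⟨h5, h0, h8⟩
    refine ⟨by simp [h5], by simp [h5], by simp [h0], fun i h1 h2 => ?_⟩
    by_cases hik : i = k
    · simp [h5, hik, h0]
    · simp [h5, hik, h8 i (by omega) h2]
  · rintro τ ⟨h5, -⟩
    simp [h5]
  · rintro τ ⟨⟨-, -, h8⟩, hr, hm⟩
    exact ⟨fun i hi => h8 i (Nat.zero_le _) hi, fun r h5 => hr r (by simp [h5]),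
      fun A hA => hm A (by simp [hA])⟩

theorem collectCmd_runs {ρ : Fin 2 → ℝ} {P : Params} {n m : ℕ} {M : Fin n → Fin P.c → Fin m}
    {N : Fin m → Fin P.d → Fin n} {x : Word n} {σ : State} (h : Base M N x x σ)
    (h2 : σ.reg 2 = 0) (h3 : σ.reg 3 = 0) (h4 : ∀ v, σ.mem 4 v = 0) (h5 : ∀ i, σ.mem 5 i = 0) :
    Runs ρ (collectCmd P) σ ((collectCmd P).wc * (m + 1)) fun τ =>
      Rep M N P.C₀ x x x 0 τ := by
  classical
  let I : ℕ → State → Prop := fun k τ => τ.reg 5 = k ∧ k ≤ m ∧ Base M N x x τ ∧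
    ∃ U : Finset (Fin m), SetRep U τ ∧ ∀ v, v ∈ U ↔ k ≤ v ∧ v ∈ unsat N P.C₀ x
  refine (Runs.init_loop (I := I) (by exact trivial)
    (by exact ⟨trivial, trivial, checkCmd_loopFree⟩)
    ?_ ?_ ?_).frame.mono le_rfl ?_
  · refine ⟨by simp [h.reg_m], le_rfl, ?_, ∅, ⟨by simp [h2], by simp, fun v _ => h4 v⟩, fun v => ?_⟩
    · apply h.congr <;> simp
    · have := v.2
      simp only [Finset.notMem_empty, false_iff, not_and]
      omega
  · rintro k τ ⟨hk5, hk, hb, U, hU, hmem⟩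
    refine ⟨by simp [hk5], ?_⟩
    have hsem : ∀ q : Cmd, (Cmd.seq (.assign 5 (.sub (.reg 5) (.const 1)))
        (.seq (.assign 7 (.reg 5)) q)).sem ρ τ = q.sem ρ ((τ.setReg 5 k).setReg 7 k) := by
      intro q
      simp [hk5]
    rw [hsem]
    set τ₁ := (τ.setReg 5 k).setReg 7 k with hτ₁
    have hb₁ : Base M N x x τ₁ := by apply hb.congr <;> simp [hτ₁]
    have hU₁ : SetRep U τ₁ := by apply hU.congr <;> simp [hτ₁]
    obtain ⟨U', hU', hmem'⟩ := SetRep.checkCmd_sem (C := P.C₀) (ρ := ρ) hb₁ hU₁ (v := ⟨k, hk⟩)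
      (by simp [hτ₁])
    refine ⟨?_, by omega, hb₁.checkCmd_sem, U', hU', fun v => ?_⟩
    · rw [Cmd.sem_reg checkCmd_loopFree (checkCmd_keepsReg (by simp) (by simp) (by simp))]
      simp [hτ₁]
    · rw [hmem']
      by_cases hv : v = ⟨k, hk⟩
      · simp [hv]
      · have hvk : (v : ℕ) ≠ k := fun he => hv (Fin.ext he)
        rw [if_neg hv, hmem]
        refine and_congr_left fun _ => ?_
        omega
  · rintro τ ⟨hk5, -⟩
    simp [hk5]
  · rintro τ ⟨⟨-, -, hb, U, hU, hmem⟩, hr, hm⟩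
    have hUeq : U = unsat N P.C₀ x := by
      ext v
      simp [hmem]
    rw [hUeq] at hU
    refine ⟨hb, hU, fun i => ?_, [], ?_, trivial, rfl, le_rfl⟩
    · rw [hm 5 ⟨trivial, trivial, trivial, checkCmd_keepsMem (by simp) (by simp)⟩]
      exact h5 i
    · rw [hr 3 ⟨by simp, by simp, by simp, checkCmd_keepsReg (by simp) (by simp) (by simp)⟩, h3]
      rfl

/-! ### The initial memory and the size of the graph. -/

theorem base_inputState {n m c d : ℕ} {M : Fin n → Fin c → Fin m} {N : Fin m → Fin d → Fin n}
    {x : Word n} {τ : State}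
    (h8 : ∀ i < n, τ.mem 8 i = (inputState M N x).mem 0 i)
    (hr : ∀ r, r ≠ 5 → τ.reg r = (inputState M N x).reg r)
    (hm : ∀ A, A ≠ 8 → τ.mem A = (inputState M N x).mem A) : Base M N x x τ := by
  refine ⟨?_, ?_, fun i => ?_, fun u j => ?_, fun v k => ?_, fun i => ?_⟩
  · rw [hr 0 (by simp)]; rfl
  · rw [hr 1 (by simp)]; rfl
  · rw [hm 0 (by simp)]
    simp [inputState]
  · rw [hm 1 (by simp)]
    have hlt : c * u + j < n * c := by
      have h1 := Nat.mul_le_mul_right c (Nat.succ_le_of_lt u.2)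
      rw [Nat.succ_mul, mul_comm (u : ℕ)] at h1
      have := j.2
      omega
    have hu : Fin.divNat ⟨c * u + j, hlt⟩ = u := by
      ext
      simp [Fin.divNat, Nat.mul_add_div (Fin.pos j), Nat.div_eq_of_lt j.2]
    have hj : Fin.modNat ⟨c * u + j, hlt⟩ = j := by
      ext
      simp [Fin.modNat, Nat.mod_eq_of_lt j.2]
    simp [inputState, hlt, hu, hj]
  · rw [hm 2 (by simp)]
    have hlt : d * v + k < m * d := by
      have h1 := Nat.mul_le_mul_right d (Nat.succ_le_of_lt v.2)
      rw [Nat.succ_mul, mul_comm (v : ℕ)] at h1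
      have := k.2
      omega
    have hv : Fin.divNat ⟨d * v + k, hlt⟩ = v := by
      ext
      simp [Fin.divNat, Nat.mul_add_div (Fin.pos k), Nat.div_eq_of_lt k.2]
    have hk : Fin.modNat ⟨d * v + k, hlt⟩ = k := by
      ext
      simp [Fin.modNat, Nat.mod_eq_of_lt k.2]
    simp [inputState, hlt, hv, hk]
  · rw [h8 i i.2]
    simp [inputState]

/-- `Linked` is all that the analysis of the program needs to know about the graph; expansion
matters only for the correctness of the decoding. -/
theorem linked_of_isAdjLists {n m c d : ℕ} {G : BipGraph n m} {M : Fin n → Fin c → Fin m}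
    {N : Fin m → Fin d → Fin n} (h : G.IsAdjLists M N) : Linked M N := by
  intro v k
  have h1 : N v k ∈ {u | G.Adj u v} := by
    rw [← h.right_range v]; exact ⟨k, rfl⟩
  have h2 : v ∈ Set.range (M (N v k)) := by
    rw [h.left_range]; exact h1
  exact h2

/-- Every check has a neighbour because `d > 0`, and so occurs among the `c n` entries of the left
lists. A pass over all checks is therefore linear in `n`. -/
theorem card_le_of_linked {n m c d : ℕ} {M : Fin n → Fin c → Fin m} {N : Fin m → Fin d → Fin n}
    (hd : 0 < d) (h : Linked M N) : m ≤ c * n := by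
  have hsurj : Function.Surjective fun p : Fin n × Fin c => M p.1 p.2 := by
    intro v
    obtain ⟨j, hj⟩ := h v ⟨0, hd⟩
    exact ⟨(_, j), hj⟩
  have := Fintype.card_le_of_surjective _ hsurj
  simpa [mul_comm] using this

theorem mainCmd_runs {P : Params} (hP : P.Valid) :
    ∃ K, ∀ {n m : ℕ} {M : Fin n → Fin P.c → Fin m} {N : Fin m → Fin P.d → Fin n} (x : Word n),
      0 < n → Linked M N →
      Runs ![P.α, P.γ] (mainCmd P) (inputState M N x) (K * n) fun τ =>
        IsOutput τ (mainDecode P N x) := by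
  obtain ⟨K, hK⟩ := searchCmd_runs hP (seqs P.guesses P.r) fun qs hqs => (mem_seqs.1 hqs).2
  refine ⟨copyCmd.wc * 2 + ((collectCmd P).wc * (P.c + 1) + K), fun {n m M N} x hn hMN => ?_⟩
  have hm : m ≤ P.c * n := card_le_of_linked hP.d_pos hMN
  refine Runs.mono (Runs.seq (copyCmd_runs (n := n) rfl)
    (C := (collectCmd P).wc * (m + 1) + K * n) ?_) ?_ fun _ h => h
  · rintro τ ⟨h8, hr, hmem⟩
    refine Runs.seq (collectCmd_runs (base_inputState h8 hr hmem) ?_ ?_ ?_ ?_)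
      fun υ hυ => hK hn hm hMN hυ
    · rw [hr 2 (by simp)]; rfl
    · rw [hr 3 (by simp)]; rfl
    · intro v; rw [hmem 4 (by simp)]; rfl
    · intro i; rw [hmem 5 (by simp)]; rfl
  · have h1 : copyCmd.wc * (n + 1) ≤ copyCmd.wc * 2 * n := by
      rw [mul_assoc]; exact Nat.mul_le_mul_left _ (by omega)
    have h2 : (collectCmd P).wc * (m + 1) ≤ (collectCmd P).wc * (P.c + 1) * n := by
      rw [mul_assoc]
      refine Nat.mul_le_mul_left _ ?_
      rw [Nat.add_mul]
      omega
    rw [Nat.add_mul, Nat.add_mul]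
    omega

end Tanner

/-! ### The theorem. -/

theorem mainTheorem1 (P : Tanner.Params) (hc : 0 < P.c) (hd : 0 < P.d)
    (hα : 0 < P.α) (hα1 : P.α ≤ 1) (hδ : 0 < P.δ) (hδ1 : P.δ ≤ 1)
    (hC₀ : Tanner.HasMinDist P.C₀ P.d₀) (hδd₀ : 2 < P.δ * P.d₀) :
    ∃ (prog : RAM.Cmd) (K : ℕ), ∀ (n m : ℕ), 0 < n → ∀ G : Tanner.BipGraph n m,
      G.IsExpander P.c P.d P.α P.δ →
      ∀ (M : Fin n → Fin P.c → Fin m) (N : Fin m → Fin P.d → Fin n), G.IsAdjLists M N →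
      ∀ x : Tanner.Word n,
        (∃ (T : ℕ) (τ : RAM.State), T ≤ K * n ∧
          RAM.Exec ![P.α, P.γ] prog (RAM.inputState M N x) T τ ∧
          RAM.IsOutput τ (Tanner.mainDecode P N x)) ∧
        ∀ y ∈ Tanner.tannerCode N P.C₀, (hammingDist x y : ℝ) ≤ P.α * n →
          Tanner.mainDecode P N x = some y := by
  have hP : P.Valid := ⟨hc, hd, hα, hα1, hδ, hδ1, hC₀, hδd₀⟩
  obtain ⟨K, hK⟩ := Tanner.mainCmd_runs hP
  refine ⟨Tanner.mainCmd P, K, fun n m hn G hG M N hMN x => ⟨?_, fun y hy hx => ?_⟩⟩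
  · exact hK x hn (Tanner.linked_of_isAdjLists hMN)
  · exact Tanner.mainDecode_correct hP hn hMN hG hy hx
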